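/- **Setting.** Let $\Gamma$ be a $\mathcal C^2$ plane path parametrized by arc length $s\in\mathbb R$ (either unbounded in both directions, or closed of length $\ell$), with signed curvature $\kappa$ satisfying $|\kappa|<\kappa_0$ everywhere; put $R_0=1/\kappa_0$. For $n$ UAVs let $s_i$ be the arc-length parameter of the projection $p_i$ of UAV $i$ on $\Gamma$, $\rho_i$ its signed distance to $\Gamma$ (positive on the left) and $\psi_i$ its heading relative to the tangent at $p_i$. The path following error $\phi_i=(\rho_i,\psi_i)$ obeys, with $\kappa=\kappa(p_i)$, $$\dot s_i=\frac{v_i\cos\psi_i}{1-\kappa\rho_i},\qquad \dot\rho_i=v_i\sin\psi_i,\qquad \dot\psi_i=\omega_i-\frac{\kappa v_i\cos\psi_i}{1-\kappa\rho_i},$$ with the speed constraints $0<v_{\min}\le v_i\le v_{\max}$ and $|\omega_i|\le\omega_{\max}$. The pre-neighbor of UAV $i$ is the first UAV $j\ne i$ whose projection is in front of $p_i$ on $\Gamma$, where only UAVs with $|\rho|<R_0$ are considered and UAVs with equal projections are ordered by their labels, the larger label being in front. $\zeta_i$ is the arc length from $p_i$ to the projection of the pre-neighbor, and $\zeta_i=L$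 if there is none. If $\Gamma$ is closed and $n\ge2$, assume $nL=\ell$. **Parameters.** Assume $0<a<\pi/2$, $0<R_1<R_0$, $R_1<R_2$, $v_{\min}<v_m\le v_{\max}$, $\alpha,c>0$, $0<\epsilon_0<a$, $\kappa_0\le\omega_{\max}/v_{\max}$, $$\sqrt{(a/R_1)^2+\kappa_0^2}+\frac{\alpha}{v_m}\le\frac{\omega_{\max}}{v_m},\quad \frac{\kappa_0}{1-\kappa_0R_1}+\frac{\alpha}{v_m}\le\frac{\omega_{\max}}{v_m},\quad \frac{v_{\min}}{1-\kappa_0R_1}+c\le\frac{v_m\cos a}{1+\kappa_0R_1},$$ $k_1>0$, $k_2,k_3\ge1$, $a\le R_1k_1<ak_2$, and $0<\delta_2\le\delta_1<L$, $0<\lambda<1$. Let $\chi$ be continuous and non-decreasing on $[0,\infty)$, strictly increasing on $[L-\delta_2,L+\delta_2]$, with $\chi=\frac{v_{\min}}{1-\kappa_0R_1}$ on $[0,L-\delta_1)$ and $\chi(L)=\frac{\lambda v_{\min}}{1-\kappa_0R_1}+\frac{(1-\lambda)v_m\cos a}{1+\kappa_0R_1}$. **Regions.** $\mathcal S=[-R_2,R_2]\times[-\pi,\pi)$;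 $\mathcal S_1=\{|\rho|\le R_1,\ |\psi|\le a,\ |a\rho+R_1\psi|\le aR_1\}$; $\mathcal S_2=\mathcal S\setminus\mathcal S_1$; $\mathcal S_2^2=\{-R_2\le\rho<-R_1,\ 0<\psi\le a\}$; $\mathcal S_2^4=\{R_1<\rho\le R_2,\ -a\le\psi<0\}$; $\mathcal S_2^1=(\{\psi>0\}\cap\mathcal S_2\setminus\mathcal S_2^2)\cup\{R_1<\rho\le R_2,\ \psi=0\}$; $\mathcal S_2^3=(\{\psi<0\}\cap\mathcal S_2\setminus\mathcal S_2^4)\cup\{-R_2\le\rho<-R_1,\ \psi=0\}$. **Control law.** Write $\tau=\frac{\kappa\cos\psi}{1-\kappa\rho}$, $\vartheta=k_1\rho+k_2\psi+k_3\sin\psi$ and $\mathrm{Sat}(x,p,q)=\max\{p,\min\{x,q\}\}$. *In $\mathcal S_1$:* put $v=\mathrm{Sat}\big(\frac{1-\kappa\rho}{\cos\psi}\chi(\zeta),v_{\min},v_{\max}\big)$ and $\omega=\mathrm{Sat}\big(v[-\frac{k_1\vartheta}{k_2}+\tau]-\alpha\,\mathrm{sign}\,\vartheta,-\omega_{\max},\omega_{\max}\big)$;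 keep $\omega$, and replace $v$ as follows, with $b=a\sin\psi-R_1\tau$: - if $\rho>0,\psi\ge0,\vartheta>0$ and $vb+R_1\omega+R_1\alpha>0$: by $-b^{-1}R_1(\omega+\alpha)$; - if $\rho\le0,\psi\ge0,\vartheta\ge0$ and $\omega-v\tau+\alpha>0$: by $(\omega+\alpha)/\tau$; - if $\rho<0,\psi\le0,\vartheta<0$ and $vb+R_1\omega-R_1\alpha<0$: by $-b^{-1}R_1(\omega-\alpha)$; - if $\rho\ge0,\psi\le0,\vartheta\le0$ and $\omega-v\tau-\alpha<0$: by $(\omega-\alpha)/\tau$; - if $\rho<0,\psi>0,\vartheta<0$ and $\omega-v\tau-\alpha<0$: by $(\omega-\alpha)/\tau$; - if $\rho>0,\psi<0,\vartheta>0$ and $\omega-v\tau+\alpha>0$: by $(\omega+\alpha)/\tau$. *In $\mathcal S_2^4$:* $(v,\omega)=(v_{\max},-\omega_{\max})$ if $\psi\ge-a+\epsilon_0$; otherwise $(v_{\max},\max\{-\omega_{\max},v_{\max}\tau\})$ if $v_{\max}\tau\le\omega_{\max}$ and $(\omega_{\max}/\tau,\omega_{\max})$ if not. *In $\mathcal S_2^2$:*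 $(v_{\max},\omega_{\max})$ if $\psi\le a-\epsilon_0$; otherwise $(v_{\max},\min\{\omega_{\max},v_{\max}\tau\})$ if $v_{\max}\tau\ge-\omega_{\max}$ and $(-\omega_{\max}/\tau,-\omega_{\max})$ if not. *In $\mathcal S_2^1$:* $(v_{\min},-\omega_{\max})$. *In $\mathcal S_2^3$:* $(v_{\min},\omega_{\max})$. Closed-loop trajectories are understood in the sense of Filippov with respect to $(\rho_i,\psi_i)$, with $\kappa(p_i(t))$ and $\zeta_i(t)$ as measured signals: the states are absolutely continuous, the equations above hold for almost every $t$, and $(v_i,\omega_i)(t)$ lies in the Filippov regularization at $\phi_i(t)$ of the control law on $\mathcal S$ (outside $\mathcal S$, should a trajectory leave it, that at the nearest point of $\overline{\mathcal S}$ is used). **Theorem.** Suppose $R_2<\frac1{\kappa_0}-\frac{v_{\min}}{\omega_{\max}}$ and, for each $i$, one of the following holds: 1. $\phi_i(t_0)\in\mathcal S_1$; 2. $\phi_i(t_0)\in\mathcal S_2^2\cup\mathcal S_2^4$; 3. $\phi_i(t_0)\in\mathcal S_2^1$, and the solution with $(\tilde\rho,\tilde\psi)(t_0)=\phi_i(t_0)$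 of $\dot{\tilde\rho}=v_{\min}\sin\tilde\psi$, $\dot{\tilde\psi}=-\omega_{\max}-\frac{\kappa_0v_{\min}\cos\tilde\psi}{1-\kappa_0\tilde\rho}$ for $\frac\pi2\le\tilde\psi<\pi$, $\dot{\tilde\psi}=-\omega_{\max}+\frac{\kappa_0v_{\min}\cos\tilde\psi}{1+\kappa_0\tilde\rho}$ for $0\le\tilde\psi<\frac\pi2$, meets the $\tilde\rho$-axis at a point $(R^*,0)$ with $R^*\le R_2$; 4. $\phi_i(t_0)\in\mathcal S_2^3$, and the solution with $(\tilde\rho,\tilde\psi)(t_0)=\phi_i(t_0)$ of $\dot{\tilde\rho}=v_{\min}\sin\tilde\psi$, $\dot{\tilde\psi}=\omega_{\max}+\frac{\kappa_0v_{\min}\cos\tilde\psi}{1+\kappa_0\tilde\rho}$ for $-\pi\le\tilde\psi<-\frac\pi2$, $\dot{\tilde\psi}=\omega_{\max}-\frac{\kappa_0v_{\min}\cos\tilde\psi}{1-\kappa_0\tilde\rho}$ for $-\frac\pi2\le\tilde\psi\le0$, meets the $\tilde\rho$-axis at a point $(-R^*,0)$ with $R^*\le R_2$. Then, for every closed-loop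 trajectory on an interval $[t_0,T)$, $t_0<T\le\infty$, all $\phi_i$ stay in $\mathcal S$ and the speed constraints hold for almost every $t$; and if $T=\infty$, then $\lim_{t\to\infty}\phi_i(t)=0$ and $\lim_{t\to\infty}\zeta_i(t)=L$ for all $i$. -/

import Mathlib

open Real Set Filter Topology MeasureTheory

namespace UAV

noncomputable section

/-! ### Parameters -/

/-- The constants of the problem: speed limits, curvature bound, shape of the sets, gains of the
control law, desired arc distance, and the speed profile `χ`. -/
structure Params where
  (vmin vmax ωmax : ℝ)
  κ₀ : ℝ
  (a R₁ R₂ vm c α : ℝ)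
  (k₁ k₂ k₃ ε₀ : ℝ)
  (L δ₁ δ₂ lam : ℝ)
  χ : ℝ → ℝ

/-- The constraints under which the parameters are selected. -/
structure Params.Valid (P : Params) : Prop where
  vmin_pos : 0 < P.vmin
  ωmax_pos : 0 < P.ωmax
  /-- the curvature bound is compatible with flight at maximal forward speed -/
  curvature_speed : P.κ₀ ≤ P.ωmax / P.vmax
  -- the coordination set
  a_pos : 0 < P.a
  a_lt : P.a < π / 2
  R₁_pos : 0 < P.R₁
  R₁_lt : P.R₁ < 1 / P.κ₀
  vm_gt : P.vmin < P.vm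
  vm_le : P.vm ≤ P.vmax
  α_pos : 0 < P.α
  c_pos : 0 < P.c
  select₁ : √((P.a / P.R₁) ^ 2 + P.κ₀ ^ 2) + P.α / P.vm ≤ P.ωmax / P.vm
  select₂ : P.κ₀ / (1 - P.κ₀ * P.R₁) + P.α / P.vm ≤ P.ωmax / P.vm
  select₃ : 1 / (1 - P.κ₀ * P.R₁) * P.vmin + P.c ≤ cos P.a / (1 + P.κ₀ * P.R₁) * P.vm
  -- the gains
  k₁_pos : 0 < P.k₁
  k₂_ge : 1 ≤ P.k₂
  k₃_ge : 1 ≤ P.k₃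
  gain_le : P.a ≤ P.R₁ * P.k₁
  gain_lt : P.R₁ * P.k₁ < P.a * P.k₂
  -- the speed profile
  δ₁_lt : P.δ₁ < P.L
  δ₂_pos : 0 < P.δ₂
  δ₂_le : P.δ₂ ≤ P.δ₁
  lam_pos : 0 < P.lam
  lam_lt : P.lam < 1
  χ_cont : ContinuousOn P.χ (Ici 0)
  χ_low : ∀ ζ ∈ Ico 0 (P.L - P.δ₁), P.χ ζ = 1 / (1 - P.κ₀ * P.R₁) * P.vmin
  χ_L : P.χ P.L = P.lam / (1 - P.κ₀ * P.R₁) * P.vmin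
    + (1 - P.lam) * cos P.a / (1 + P.κ₀ * P.R₁) * P.vm
  χ_mono : MonotoneOn P.χ (Ici 0)
  χ_strict : StrictMonoOn P.χ (Icc (P.L - P.δ₂) (P.L + P.δ₂))
  -- the outer region and the switching threshold
  R₁_lt_R₂ : P.R₁ < P.R₂
  ε₀_pos : 0 < P.ε₀
  ε₀_lt : P.ε₀ < P.a

/-! ### Regions of the error plane; a point `φ` is the pair `(ρ, ψ)` -/

section Regions

variable (P : Params)

/-- The universe `𝒮`. -/
def S : Set (ℝ × ℝ) := {φ | φ.1 ∈ Icc (-P.R₂) P.R₂ ∧ φ.2 ∈ Ico (-π) π}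

/-- The coordination set `𝒮₁`. -/
def S₁ : Set (ℝ × ℝ) :=
  {φ | |φ.1| ≤ P.R₁ ∧ |φ.2| ≤ P.a ∧ |P.a * φ.1 + P.R₁ * φ.2| ≤ P.a * P.R₁}

/-- `𝒮₂ = 𝒮 \ 𝒮₁`. -/
def S₂ : Set (ℝ × ℝ) := S P \ S₁ P

/-- `𝒮₂²`. -/
def S₂₂ : Set (ℝ × ℝ) := {φ | φ.1 ∈ Ico (-P.R₂) (-P.R₁) ∧ φ.2 ∈ Ioc 0 P.a}

/-- `𝒮₂⁴`. -/
def S₂₄ : Set (ℝ × ℝ) := {φ | φ.1 ∈ Ioc P.R₁ P.R₂ ∧ φ.2 ∈ Ico (-P.a) 0}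

/-- `𝒮₂¹`. -/
def S₂₁ : Set (ℝ × ℝ) :=
  (({φ | 0 < φ.2} ∩ S₂ P) \ S₂₂ P) ∪ {φ | φ.1 ∈ Ioc P.R₁ P.R₂ ∧ φ.2 = 0}

/-- `𝒮₂³`. -/
def S₂₃ : Set (ℝ × ℝ) :=
  (({φ | φ.2 < 0} ∩ S₂ P) \ S₂₄ P) ∪ {φ | φ.1 ∈ Ico (-P.R₂) (-P.R₁) ∧ φ.2 = 0}

/-- `ϑ = k₁ ρ + k₂ ψ + k₃ sin ψ`. -/
def ϑ (φ : ℝ × ℝ) : ℝ := P.k₁ * φ.1 + P.k₂ * φ.2 + P.k₃ * sin φ.2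

/-- `𝒮₁¹`, …, `𝒮₁⁶`. -/
def S₁₁ : Set (ℝ × ℝ) := {φ | φ ∈ S₁ P ∧ 0 < φ.1 ∧ 0 ≤ φ.2 ∧ 0 < ϑ P φ}
def S₁₂ : Set (ℝ × ℝ) := {φ | φ ∈ S₁ P ∧ φ.1 ≤ 0 ∧ 0 ≤ φ.2 ∧ 0 ≤ ϑ P φ}
def S₁₃ : Set (ℝ × ℝ) := {φ | φ ∈ S₁ P ∧ φ.1 < 0 ∧ φ.2 ≤ 0 ∧ ϑ P φ < 0}
def S₁₄ : Set (ℝ × ℝ) := {φ | φ ∈ S₁ P ∧ 0 ≤ φ.1 ∧ φ.2 ≤ 0 ∧ ϑ P φ ≤ 0}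
def S₁₅ : Set (ℝ × ℝ) := {φ | φ ∈ S₁ P ∧ φ.1 < 0 ∧ 0 < φ.2 ∧ ϑ P φ < 0}
def S₁₆ : Set (ℝ × ℝ) := {φ | φ ∈ S₁ P ∧ 0 < φ.1 ∧ φ.2 < 0 ∧ 0 < ϑ P φ}

end Regions

/-! ### Control laws; `κ` is the curvature at the projection and `ζ` the arc distance -/

/-- Saturation of `x` to `[lo, hi]`. -/
def sat (x lo hi : ℝ) : ℝ := if x ≤ lo then lo else if x ≤ hi then x else hi

section Control

variable (P : Params)

/-- `κ cos ψ / (1 - κ ρ)`. -/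
def turn (κ : ℝ) (φ : ℝ × ℝ) : ℝ := κ * cos φ.2 / (1 - κ * φ.1)

/-- First value of the forward speed in the coordination law. -/
def coordSpeed (κ ζ : ℝ) (φ : ℝ × ℝ) : ℝ :=
  sat ((1 - κ * φ.1) / cos φ.2 * P.χ ζ) P.vmin P.vmax

/-- Angular speed in the coordination law. -/
def coordTurn (κ ζ : ℝ) (φ : ℝ × ℝ) : ℝ :=
  sat (coordSpeed P κ ζ φ * (-(P.k₁ * ϑ P φ / P.k₂) + turn κ φ) - P.α * Real.sign (ϑ P φ))
    (-P.ωmax) P.ωmax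

open Classical in
/-- The procedure that re-sets the forward speed `v`. The six sets are pairwise disjoint, except
that the origin lies in both `𝒮₁²` and `𝒮₁⁴`. -/
def resetSpeed (κ : ℝ) (φ : ℝ × ℝ) (v ω : ℝ) : ℝ :=
  if φ ∈ S₁₁ P ∧ ¬ (v * (P.a * sin φ.2 - P.R₁ * turn κ φ) + P.R₁ * ω + P.R₁ * P.α ≤ 0) then
    -((P.a * sin φ.2 - P.R₁ * turn κ φ)⁻¹ * (P.R₁ * (ω + P.α)))
  else if φ ∈ S₁₂ P ∧ ¬ (ω - v * turn κ φ + P.α ≤ 0) then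
    (1 - κ * φ.1) / (κ * cos φ.2) * (ω + P.α)
  else if φ ∈ S₁₃ P ∧ ¬ (v * (P.a * sin φ.2 - P.R₁ * turn κ φ) + P.R₁ * ω - P.R₁ * P.α ≥ 0) then
    -((P.a * sin φ.2 - P.R₁ * turn κ φ)⁻¹ * (P.R₁ * (ω - P.α)))
  else if φ ∈ S₁₄ P ∧ ¬ (ω - v * turn κ φ - P.α ≥ 0) then
    (1 - κ * φ.1) / (κ * cos φ.2) * (ω - P.α)
  else if φ ∈ S₁₅ P ∧ ω - v * turn κ φ - P.α < 0 then
    (1 - κ * φ.1) / (κ * cos φ.2) * (ω - P.α)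
  else if φ ∈ S₁₆ P ∧ ω - v * turn κ φ + P.α > 0 then
    (1 - κ * φ.1) / (κ * cos φ.2) * (ω + P.α)
  else v

/-- The coordinated control law in `𝒮₁`, returning `(v, ω)`. -/
def coordControl (κ ζ : ℝ) (φ : ℝ × ℝ) : ℝ × ℝ :=
  (resetSpeed P κ φ (coordSpeed P κ ζ φ) (coordTurn P κ ζ φ), coordTurn P κ ζ φ)

/-- The near time optimal law in `𝒮₂⁴`: near `ψ = -a` it minimizes `v sin ψ` subject to
`ω - v κ cos ψ / (1 - κ ρ) ≥ 0` and the speed constraints. -/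
def law₂₄ (κ : ℝ) (φ : ℝ × ℝ) : ℝ × ℝ :=
  if -P.a + P.ε₀ ≤ φ.2 then (P.vmax, -P.ωmax)
  else if 0 ≤ P.ωmax - P.vmax * turn κ φ then
    (P.vmax, max (-P.ωmax) (P.vmax * turn κ φ))
  else (P.ωmax * (1 - κ * φ.1) / (κ * cos φ.2), P.ωmax)

/-- The near time optimal law in `𝒮₂²`: near `ψ = a` it maximizes `v sin ψ` subject to
`ω - v κ cos ψ / (1 - κ ρ) ≤ 0` and the speed constraints. -/
def law₂₂ (κ : ℝ) (φ : ℝ × ℝ) : ℝ × ℝ :=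
  if φ.2 ≤ P.a - P.ε₀ then (P.vmax, P.ωmax)
  else if -P.ωmax - P.vmax * turn κ φ ≤ 0 then
    (P.vmax, min P.ωmax (P.vmax * turn κ φ))
  else (-P.ωmax * (1 - κ * φ.1) / (κ * cos φ.2), -P.ωmax)

open Classical in
/-- The hybrid feedback `(v, ω)` on `𝒮`. (The last value is never used: `𝒮` is covered.) -/
def feedback (κ ζ : ℝ) (φ : ℝ × ℝ) : ℝ × ℝ :=
  if φ ∈ S₁ P then coordControl P κ ζ φ
  else if φ ∈ S₂₂ P then law₂₂ P κ φ
  else if φ ∈ S₂₄ P then law₂₄ P κ φ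
  else if φ ∈ S₂₁ P then (P.vmin, -P.ωmax)
  else if φ ∈ S₂₃ P then (P.vmin, P.ωmax)
  else 0

/-- Filippov regularization at `x` of a (discontinuous) map `u` that is defined on `D`. -/
def filippov (D : Set (ℝ × ℝ)) (u : ℝ × ℝ → ℝ × ℝ) (x : ℝ × ℝ) : Set (ℝ × ℝ) :=
  ⋂ (δ : ℝ) (_ : 0 < δ) (N : Set (ℝ × ℝ)) (_ : volume N = 0),
    closure (convexHull ℝ (u '' ((Metric.ball x δ ∩ D) \ N)))

/-- The nearest point of the closure of `𝒮`; it is `φ` itself if `φ ∈ 𝒮`. -/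
def retract (φ : ℝ × ℝ) : ℝ × ℝ :=
  (max (-P.R₂) (min P.R₂ φ.1), max (-π) (min π φ.2))

end Control

/-! ### The path and the arc distances -/

/-- Signed curvature of a plane curve that is parametrized by arc length. -/
def curvature (γ : ℝ → EuclideanSpace ℝ (Fin 2)) (s : ℝ) : ℝ :=
  deriv γ s 0 * deriv (deriv γ) s 1 - deriv γ s 1 * deriv (deriv γ) s 0

/-- A path is either unbounded in both directions or closed, of length `ℓ`. -/
inductive PathType where
  | line
  | loop (ℓ : ℝ)

/-- The arc-length parametrized `C²` path `γ` is of the given type. On a closed path, the desired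
arc distance `L` between neighbors is the length divided by the number `n` of UAVs (the arc
distances add up to the length). -/
def IsPath (n : ℕ) (L : ℝ) (γ : ℝ → EuclideanSpace ℝ (Fin 2)) (Γ : PathType) : Prop :=
  ContDiff ℝ 2 γ ∧ (∀ s, ‖deriv γ s‖ = 1) ∧
    match Γ with
    | .line => True
    | .loop ℓ => 0 < ℓ ∧ Function.Periodic γ ℓ ∧ (2 ≤ n → n * L = ℓ)

section Arc

variable {n : ℕ} (Γ : PathType)

/-- UAV `j` is in front of UAV `i`, where `s k` is the arc-length parameter of the projection of
UAV `k`; UAVs with the same projection are ordered by their labels. -/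
def InFront (s : Fin n → ℝ) (i j : Fin n) : Prop :=
  match Γ with
  | .line => s i < s j ∨ (s i = s j ∧ i < j)
  | .loop _ => i ≠ j

/-- The length along the path from the projection of UAV `i` forward to that of UAV `j`. On a closed
path it is `s j - s i` modulo `ℓ`, taken in `[0, ℓ)` if `i < j` and in `(0, ℓ]` if `j < i`. -/
def arcDist (s : Fin n → ℝ) (i j : Fin n) : ℝ :=
  match Γ with
  | .line => s j - s i
  | .loop ℓ =>
    if i < j then ℓ * Int.fract ((s j - s i) / ℓ) else ℓ - ℓ * Int.fract ((s i - s j) / ℓ)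

/-- UAV `j` is the pre-neighbor of UAV `i`: both are within `R₀` of the path and `j` is the first
such UAV in front of `i`. -/
def IsPreNeighbor (R₀ : ℝ) (s ρ : Fin n → ℝ) (i j : Fin n) : Prop :=
  |ρ i| < R₀ ∧ |ρ j| < R₀ ∧ InFront Γ s i j ∧
    ∀ k, |ρ k| < R₀ → InFront Γ s i k →
      arcDist Γ s i j < arcDist Γ s i k ∨ (arcDist Γ s i j = arcDist Γ s i k ∧ j ≤ k)

open Classical in
/-- The arc distance `ζ i` to the pre-neighbor, set to `L` if there is no pre-neighbor. -/
def preDist (R₀ L : ℝ) (s ρ : Fin n → ℝ) (i : Fin n) : ℝ :=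
  if h : ∃ j, IsPreNeighbor Γ R₀ s ρ i j then arcDist Γ s i h.choose else L

end Arc

/-! ### Closed-loop trajectories -/

/-- State of the fleet as functions of time: arc-length parameter `s` of the projection, errors
`ρ`, `ψ`, and the applied controls `v`, `ω`. -/
structure Fleet (n : ℕ) where
  (s ρ ψ v ω : Fin n → ℝ → ℝ)

/-- The path following error of UAV `i`. -/
def Fleet.φ {n : ℕ} (F : Fleet n) (i : Fin n) (t : ℝ) : ℝ × ℝ := (F.ρ i t, F.ψ i t)

/-- The arc distance of UAV `i` to its pre-neighbor. -/
def Fleet.ζ {n : ℕ} (F : Fleet n) (P : Params) (Γ : PathType) (i : Fin n) (t : ℝ) : ℝ :=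
  preDist Γ (1 / P.κ₀) P.L (fun j => F.s j t) (fun j => F.ρ j t) i

/-- `F` is a closed-loop trajectory on `[t₀, T)`, in the sense of Filippov: the states are
absolutely continuous on compact subintervals, they satisfy the error equations almost everywhere,
and the controls belong to the Filippov regularization, in the variables `(ρ, ψ)`, of the hybrid
feedback. The feedback is defined on `𝒮` only; a trajectory that left `𝒮` would keep using the
feedback at the nearest point. -/
structure Fleet.IsTrajectory {n : ℕ} (F : Fleet n) (P : Params)
    (γ : ℝ → EuclideanSpace ℝ (Fin 2)) (Γ : PathType) (t₀ : ℝ) (T : EReal) : Prop where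
  ac : ∀ t₁ : ℝ, t₀ ≤ t₁ → (t₁ : EReal) < T → ∀ i,
    AbsolutelyContinuousOnInterval (F.s i) t₀ t₁ ∧
    AbsolutelyContinuousOnInterval (F.ρ i) t₀ t₁ ∧
    AbsolutelyContinuousOnInterval (F.ψ i) t₀ t₁
  dynamics : ∀ᵐ t : ℝ, t₀ ≤ t → (t : EReal) < T → ∀ i,
    HasDerivAt (F.s i)
      (F.v i t * cos (F.ψ i t) / (1 - curvature γ (F.s i t) * F.ρ i t)) t ∧
    HasDerivAt (F.ρ i) (F.v i t * sin (F.ψ i t)) t ∧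
    HasDerivAt (F.ψ i) (F.ω i t - curvature γ (F.s i t) * F.v i t * cos (F.ψ i t)
      / (1 - curvature γ (F.s i t) * F.ρ i t)) t
  control : ∀ᵐ t : ℝ, t₀ ≤ t → (t : EReal) < T → ∀ i,
    (F.v i t, F.ω i t) ∈
      filippov (S P) (feedback P (curvature γ (F.s i t)) (F.ζ P Γ i t)) (retract P (F.φ i t))

/-! ### Admissible initial errors -/

section Initial

variable (P : Params)

/-- The comparison trajectory from `φ₀` for `𝒮₂¹` stays in `0 ≤ ψ < π` until it meets the `ρ`-axis,
which happens at a point `(R, 0)` with `R ≤ R₂`. -/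
def Crosses₁ (φ₀ : ℝ × ℝ) : Prop :=
  ∃ (τ : ℝ) (r p : ℝ → ℝ), 0 ≤ τ ∧ r 0 = φ₀.1 ∧ p 0 = φ₀.2 ∧
    (∀ t ∈ Icc 0 τ, p t ∈ Ico 0 π ∧
      HasDerivWithinAt r (P.vmin * sin (p t)) (Icc 0 τ) t ∧
      HasDerivWithinAt p
        (if π / 2 ≤ p t then -P.ωmax - P.κ₀ * P.vmin * cos (p t) / (1 - P.κ₀ * r t)
          else -P.ωmax + P.κ₀ * P.vmin * cos (p t) / (1 + P.κ₀ * r t)) (Icc 0 τ) t) ∧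
    p τ = 0 ∧ r τ ≤ P.R₂

/-- The comparison trajectory from `φ₀` for `𝒮₂³` stays in `-π ≤ ψ ≤ 0` until it meets the
`ρ`-axis, which happens at a point `(-R, 0)` with `R ≤ R₂`. -/
def Crosses₃ (φ₀ : ℝ × ℝ) : Prop :=
  ∃ (τ : ℝ) (r p : ℝ → ℝ), 0 ≤ τ ∧ r 0 = φ₀.1 ∧ p 0 = φ₀.2 ∧
    (∀ t ∈ Icc 0 τ, p t ∈ Icc (-π) 0 ∧
      HasDerivWithinAt r (P.vmin * sin (p t)) (Icc 0 τ) t ∧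
      HasDerivWithinAt p
        (if p t < -(π / 2) then P.ωmax + P.κ₀ * P.vmin * cos (p t) / (1 + P.κ₀ * r t)
          else P.ωmax - P.κ₀ * P.vmin * cos (p t) / (1 - P.κ₀ * r t)) (Icc 0 τ) t) ∧
    p τ = 0 ∧ -(r τ) ≤ P.R₂

/-- The four cases for an initial error. -/
def Admissible (φ₀ : ℝ × ℝ) : Prop :=
  φ₀ ∈ S₁ P ∨ φ₀ ∈ S₂₂ P ∪ S₂₄ P ∨ (φ₀ ∈ S₂₁ P ∧ Crosses₁ P φ₀) ∨ (φ₀ ∈ S₂₃ P ∧ Crosses₃ P φ₀)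

end Initial

end

end UAV

/-! The proof combines three mechanisms: invariance of the region, convergence of the path following
errors, and consensus of the arc distances. The law is discontinuous, so all estimates are
inequalities for the Filippov set at a point: `filippov_mem` and `filippov_le` carry a convex
constraint over from the values of the law off a null set, and `le_max_of_ae_hasDerivAt` turns an
almost everywhere bound on derivatives into a barrier. Reflection in the path is a symmetry of the
law (`feedback_neg`), so only one half of each estimate has to be proved.

Invariance. The graph of `roof` and its mirror image bound a funnel around the path. Above the roof
the vehicle turns right at minimal speed, and the excess over the roof shrinks at the fixed rate
`fall` (`sub_roof_le`). Below the roof, `ρ` cannot pass `R₂`, because the heading is nonpositive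
beyond `R₁`. What remains is the excursion of `ρ` above the roof. On a path of constant curvature
`±κ₀`, the distance between the centre of the path circle and the centre of the turning circle is
conserved; this gives `integral₁` and `integral₂`. For `|κ| < κ₀` they are monotone in the useful
direction, one for `ψ ≥ π / 2` and the other for `ψ ≤ π / 2`, so the true trajectory does not go
further out than the comparison solution (`fst_le_of_roof_lt`, `safe_of_crossing`). A bootstrap in
`abs_fst_le` removes the a priori bound on `|ρ|`.

Convergence. After a bounded time the error is in `inner`. There `lyap`, the gauge of a hexagon,
decreases at a fixed rate while it exceeds a level `h` (`rate_upper`, `rate_right`, `rate_diag`).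
For `ε = 0` the hexagon is `𝒮₁` itself, but then the gauge need not decrease: the law may hold the
heading constant, and `ρ` is stationary at `ψ = 0`. Tilting the sides by a small slope `ε` repairs
both. The slope depends on `h`, so each target neighbourhood of the origin has its own gauge.

Consensus. Eventually all errors are interior to `𝒮₁`, and the ground speed lies between `min (χ ζ)
cap` and `χ ζ` (`filippov_path_speed_mem`). A vehicle less than `L - δ₁` behind another moves at the
lowest ground speed, so the gap does not shrink and the cyclic order is eventually frozen
(`exists_chain`). The sum of the primitives of the deviation `dev` over the chain is then a Lyapunov
function: by summation by parts its derivative is at most minus half the sum of squared increments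
of `dev`, and speeds above the cap only help (`sum_mul_sub_le_of_cycle`). Some distance is at least
`L` and some is at most `L`, so small increments force all deviations to be small
(`tendsto_of_cycle`). -/

namespace UAV

/-! ### Absolutely continuous functions and barriers -/

open AbsolutelyContinuousOnInterval in
theorem absolutelyContinuousOnInterval_of_le {F f g : ℝ → ℝ} {a b K : ℝ}
    (hf : AbsolutelyContinuousOnInterval f a b) (hg : AbsolutelyContinuousOnInterval g a b)
    (h : ∀ s ∈ uIcc a b, ∀ t ∈ uIcc a b, |F s - F t| ≤ K * (|f s - f t| + |g s - g t|)) :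
    AbsolutelyContinuousOnInterval F a b := by
  have key : Tendsto (fun E : ℕ × (ℕ → ℝ × ℝ) => K *
      (∑ i ∈ Finset.range E.1, dist (f (E.2 i).1) (f (E.2 i).2)
        + ∑ i ∈ Finset.range E.1, dist (g (E.2 i).1) (g (E.2 i).2)))
      (totalLengthFilter ⊓ 𝓟 (disjWithin a b)) (𝓝 0) := by
    simpa using (Tendsto.add hf hg).const_mul K
  refine squeeze_zero' (Eventually.of_forall fun E => Finset.sum_nonneg fun i _ => dist_nonneg)
    ?_ key
  refine mem_inf_of_right ?_
  intro E hE
  simp only [mem_ofPred_eq]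
  rw [← Finset.sum_add_distrib, Finset.mul_sum]
  refine Finset.sum_le_sum fun i hi => ?_
  have := hE.1 i hi
  simpa [Real.dist_eq] using h _ this.1 _ this.2

theorem absolutelyContinuousOnInterval_cos {f : ℝ → ℝ} {a b : ℝ}
    (hf : AbsolutelyContinuousOnInterval f a b) :
    AbsolutelyContinuousOnInterval (fun t => cos (f t)) a b := by
  refine absolutelyContinuousOnInterval_of_le (K := 1) hf hf fun s _ t _ => ?_
  have h : LipschitzWith 1 Real.cos := by
    refine lipschitzWith_of_nnnorm_deriv_le Real.differentiable_cos fun x => ?_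
    rw [← NNReal.coe_le_coe]
    simpa using Real.abs_sin_le_one x
  have := h.dist_le_mul (f s) (f t)
  simp only [Real.dist_eq, NNReal.coe_one] at this
  have := abs_nonneg (f s - f t)
  linarith

theorem absolutelyContinuousOnInterval_max {f g : ℝ → ℝ} {a b : ℝ}
    (hf : AbsolutelyContinuousOnInterval f a b) (hg : AbsolutelyContinuousOnInterval g a b) :
    AbsolutelyContinuousOnInterval (fun t => max (f t) (g t)) a b := by
  refine absolutelyContinuousOnInterval_of_le (K := 1) hf hg fun s _ t _ => ?_
  have := abs_max_sub_max_le_max (f s) (g s) (f t) (g t)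
  rw [one_mul]
  exact this.trans (max_le_add_of_nonneg (abs_nonneg _) (abs_nonneg _))

theorem absolutelyContinuousOnInterval_min {f g : ℝ → ℝ} {a b : ℝ}
    (hf : AbsolutelyContinuousOnInterval f a b) (hg : AbsolutelyContinuousOnInterval g a b) :
    AbsolutelyContinuousOnInterval (fun t => min (f t) (g t)) a b := by
  refine absolutelyContinuousOnInterval_of_le (K := 1) hf hg fun s _ t _ => ?_
  have := abs_min_sub_min_le_max (f s) (g s) (f t) (g t)
  rw [one_mul]
  exact this.trans (max_le_add_of_nonneg (abs_nonneg _) (abs_nonneg _))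

theorem absolutelyContinuousOnInterval_const (c a b : ℝ) :
    AbsolutelyContinuousOnInterval (fun _ => c) a b :=
  ((LipschitzWith.const c).lipschitzOnWith (s := uIcc a b)).absolutelyContinuousOnInterval

/-- The fundamental theorem of calculus for absolutely continuous functions. The bound is asked only
of derivatives that exist, so maxima and minima of smooth branches can be used without proving
differentiability. -/
theorem sub_le_of_ae_hasDerivAt_le {f : ℝ → ℝ} {a b d : ℝ} (hab : a ≤ b)
    (hf : AbsolutelyContinuousOnInterval f a b)
    (h : ∀ᵐ t : ℝ, t ∈ Ioo a b → ∀ f', HasDerivAt f f' t → f' ≤ d) :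
    f b - f a ≤ d * (b - a) := by
  rw [← hf.integral_deriv_eq_sub]
  have h2 : ∫ t in a..b, deriv f t ≤ ∫ _t in a..b, d := by
    refine intervalIntegral.integral_mono_ae_restrict hab hf.intervalIntegrable_deriv
      intervalIntegrable_const ?_
    have h1 : ∀ᵐ t : ℝ, t ≠ a := by simp [ae_iff]
    have h2 : ∀ᵐ t : ℝ, t ≠ b := by simp [ae_iff]
    rw [EventuallyLE, ae_restrict_iff' measurableSet_Icc]
    filter_upwards [h, h1, h2, hf.ae_differentiableAt] with t ht h1 h2 hd hm
    exact ht ⟨lt_of_le_of_ne hm.1 (Ne.symm h1), lt_of_le_of_ne hm.2 h2⟩ _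
      (hd (by rwa [uIcc_of_le hab])).hasDerivAt
  rw [intervalIntegral.integral_const, smul_eq_mul] at h2
  linarith [mul_comm d (b - a)]

theorem AbsolutelyContinuousOnInterval.mono_Icc {f : ℝ → ℝ} {a b c d : ℝ}
    (hf : AbsolutelyContinuousOnInterval f a b) (hac : a ≤ c) (hcd : c ≤ d) (hdb : d ≤ b) :
    AbsolutelyContinuousOnInterval f c d := by
  refine hf.mono ?_
  rw [uIcc_of_le hcd, uIcc_of_le (hac.trans (hcd.trans hdb))]
  exact Icc_subset_Icc hac hdb

/-- An absolutely continuous function that decreases at rate `d` as long as it exceeds `h`. -/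
theorem le_max_of_ae_hasDerivAt {f : ℝ → ℝ} {a b h d : ℝ} (hd : 0 ≤ d)
    (hf : AbsolutelyContinuousOnInterval f a b)
    (H : ∀ᵐ t : ℝ, t ∈ Icc a b → h < f t → ∀ f', HasDerivAt f f' t → f' ≤ -d)
    {t : ℝ} (ht : t ∈ Icc a b) : f t ≤ max h (f a - d * (t - a)) := by
  have hab : a ≤ b := ht.1.trans ht.2
  have hc : ContinuousOn f (Icc a b) := by simpa [uIcc_of_le hab] using hf.continuousOn
  by_cases hall : ∀ s ∈ Icc a t, h < f s
  · refine le_max_of_le_right ?_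
    have := sub_le_of_ae_hasDerivAt_le (d := -d) ht.1
      (AbsolutelyContinuousOnInterval.mono_Icc hf le_rfl ht.1 ht.2) (by
        filter_upwards [H] with s hs hm
        exact hs ⟨hm.1.le, hm.2.le.trans ht.2⟩ (hall s ⟨hm.1.le, hm.2.le⟩))
    linarith
  · push Not at hall
    obtain ⟨s₀, hs₀, hfs₀⟩ := hall
    refine le_max_of_le_left ?_
    -- After the last time at which `f` is at most `h`, the derivative bound applies and `f` cannot
    -- rise.
    let A : Set ℝ := Icc a t ∩ f ⁻¹' Iic h
    have hAc : IsClosed A :=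
      (hc.mono (Icc_subset_Icc_right ht.2)).preimage_isClosed_of_isClosed isClosed_Icc isClosed_Iic
    have hAne : A.Nonempty := ⟨s₀, hs₀, hfs₀⟩
    have hAb : BddAbove A := ⟨t, fun x hx => hx.1.2⟩
    have hm := hAc.csSup_mem hAne hAb
    set s := sSup A
    have hst : s ≤ t := hm.1.2
    have hgt : ∀ x ∈ Ioo s t, h < f x := by
      intro x hx
      by_contra hxx
      have : x ≤ s := le_csSup hAb ⟨⟨hm.1.1.trans hx.1.le, hx.2.le⟩, not_lt.mp hxx⟩
      linarith [hx.1]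
    have := sub_le_of_ae_hasDerivAt_le (d := 0) hst
      (AbsolutelyContinuousOnInterval.mono_Icc hf hm.1.1 hst ht.2) (by
        filter_upwards [H] with x hx hxm f' hf'
        have := hx ⟨hm.1.1.trans hxm.1.le, hxm.2.le.trans ht.2⟩ (hgt x hxm) f' hf'
        linarith)
    have h2 : f s ≤ h := hm.2
    linarith

/-- The derivative of an upper envelope is that of any active branch. -/
theorem hasDerivAt_eq_of_le {F g : ℝ → ℝ} {F' g' t : ℝ} (hF : HasDerivAt F F' t)
    (hg : HasDerivAt g g' t) (hle : ∀ s, g s ≤ F s) (heq : g t = F t) : F' = g' := by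
  have hmin : IsLocalMin (F - g) t := by
    refine Eventually.of_forall fun s => ?_
    simp only [Pi.sub_apply]
    linarith [hle s]
  have := hmin.hasDerivAt_eq_zero (hF.sub hg)
  linarith

/-- The derivative of a selection of finitely many differentiable branches is that of some active
branch. -/
theorem exists_hasDerivAt_eq_of_selection {ι : Type*} [Finite ι] {F : ℝ → ℝ} {g : ι → ℝ → ℝ}
    {F' t : ℝ} {g' : ι → ℝ} (hF : HasDerivAt F F' t) (hg : ∀ i, HasDerivAt (g i) (g' i) t)
    (hsel : ∀ s, ∃ i, F s = g i s) : ∃ i, F t = g i t ∧ F' = g' i := by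
  -- Pigeonhole: one of the finitely many branches agrees with `F` at points accumulating at `t`. A
  -- difference with nonzero derivative would have no such zeros.
  have : ∃ i, ∃ᶠ s in 𝓝[≠] t, F s = g i s := by
    by_contra hcon
    simp only [not_exists, not_frequently] at hcon
    obtain ⟨s, hs⟩ := (eventually_all.mpr hcon).exists
    obtain ⟨i, hi⟩ := hsel s
    exact hs i hi
  obtain ⟨i, hi⟩ := this
  refine ⟨i, ?_, ?_⟩
  · have hcont : Tendsto (fun s => F s - g i s) (𝓝[≠] t) (𝓝 (F t - g i t)) :=
      ((hF.sub (hg i)).continuousAt.tendsto).mono_left nhdsWithin_le_nhds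
    by_contra hne
    have : ∀ᶠ s in 𝓝[≠] t, F s - g i s ≠ 0 := hcont.eventually_ne (sub_ne_zero.mpr hne)
    obtain ⟨s, h1, h2⟩ := (hi.and_eventually this).exists
    exact h2 (by rw [h1, sub_self])
  · by_contra hne
    have := (hF.sub (hg i)).eventually_ne (c := 0) (sub_ne_zero.mpr hne)
    obtain ⟨s, h1, h2⟩ := (hi.and_eventually this).exists
    exact h2 (by simp [h1])

end UAV

namespace UAV

/-! ### Consequences of the parameter constraints -/

section Params

variable {P : Params}

theorem Params.Valid.κ₀_pos (hP : P.Valid) : 0 < P.κ₀ := by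
  by_contra h
  -- Positivity of `κ₀` is hidden in `0 < R₁ < 1 / κ₀`; the convention `1 / 0 = 0` disposes of `κ₀ =
  -- 0`.
  have := one_div_nonpos.mpr (not_lt.mp h)
  linarith [hP.R₁_pos, hP.R₁_lt]

theorem Params.Valid.κ₀_mul_R₁_lt (hP : P.Valid) : P.κ₀ * P.R₁ < 1 := by
  have := hP.R₁_lt
  rw [lt_div_iff₀ hP.κ₀_pos] at this
  linarith

theorem Params.Valid.vm_pos (hP : P.Valid) : 0 < P.vm := hP.vmin_pos.trans hP.vm_gt

theorem Params.Valid.vmax_pos (hP : P.Valid) : 0 < P.vmax := hP.vm_pos.trans_le hP.vm_le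

theorem Params.Valid.vmin_lt_vmax (hP : P.Valid) : P.vmin < P.vmax := hP.vm_gt.trans_le hP.vm_le

theorem Params.Valid.κ₀_mul_vmax_le (hP : P.Valid) : P.κ₀ * P.vmax ≤ P.ωmax :=
  (le_div_iff₀ hP.vmax_pos).mp hP.curvature_speed

theorem Params.Valid.R₂_pos (hP : P.Valid) : 0 < P.R₂ := hP.R₁_pos.trans hP.R₁_lt_R₂

theorem Params.Valid.vm_mul_sqrt_le (hP : P.Valid) :
    P.vm * √(P.a ^ 2 + (P.R₁ * P.κ₀) ^ 2) ≤ P.R₁ * (P.ωmax - P.α) := by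
  have h := hP.select₁
  have hR := hP.R₁_pos
  have e : √(P.a ^ 2 + (P.R₁ * P.κ₀) ^ 2) = P.R₁ * √((P.a / P.R₁) ^ 2 + P.κ₀ ^ 2) := by
    rw [← Real.sqrt_sq hR.le, ← Real.sqrt_mul (sq_nonneg _), Real.sqrt_sq hR.le]
    congr 1
    field_simp
  rw [← le_sub_iff_add_le, ← sub_div, le_div_iff₀ hP.vm_pos] at h
  rw [e]
  nlinarith

theorem Params.Valid.vm_mul_κ₀_le (hP : P.Valid) :
    P.vm * (P.κ₀ / (1 - P.κ₀ * P.R₁)) ≤ P.ωmax - P.α := by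
  have h := hP.select₂
  rw [← le_sub_iff_add_le, ← sub_div, le_div_iff₀ hP.vm_pos] at h
  linarith

theorem Params.Valid.α_lt (hP : P.Valid) : P.α < P.ωmax := by
  have h := hP.vm_mul_κ₀_le
  have : 0 < P.vm * (P.κ₀ / (1 - P.κ₀ * P.R₁)) :=
    mul_pos hP.vm_pos (div_pos hP.κ₀_pos (by linarith [hP.κ₀_mul_R₁_lt]))
  linarith

/-- The smallest ground speed. -/
noncomputable def Params.low (P : Params) : ℝ := 1 / (1 - P.κ₀ * P.R₁) * P.vmin

/-- A ground speed that can always be reached in the coordination set. -/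
noncomputable def Params.cap (P : Params) : ℝ := cos P.a / (1 + P.κ₀ * P.R₁) * P.vm

theorem Params.Valid.low_lt_cap (hP : P.Valid) : P.low < P.cap := by
  have h1 : P.low + P.c ≤ P.cap := hP.select₃
  linarith [hP.c_pos]

theorem Params.Valid.low_pos (hP : P.Valid) : 0 < P.low :=
  mul_pos (one_div_pos.mpr (by linarith [hP.κ₀_mul_R₁_lt])) hP.vmin_pos

theorem Params.Valid.χ_L_eq (hP : P.Valid) :
    P.χ P.L = P.lam * P.low + (1 - P.lam) * P.cap := by
  rw [hP.χ_L, Params.low, Params.cap]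
  ring

theorem Params.Valid.χ_L_lt_cap (hP : P.Valid) : P.χ P.L < P.cap := by
  rw [hP.χ_L_eq]
  nlinarith [hP.low_lt_cap, hP.lam_pos]

theorem Params.Valid.low_lt_χ_L (hP : P.Valid) : P.low < P.χ P.L := by
  rw [hP.χ_L_eq]
  nlinarith [hP.low_lt_cap, hP.lam_lt]

theorem Params.Valid.L_pos (hP : P.Valid) : 0 < P.L := by
  linarith [hP.δ₁_lt, hP.δ₂_pos, hP.δ₂_le]

theorem Params.Valid.low_le_χ (hP : P.Valid) {ζ : ℝ} (hζ : 0 ≤ ζ) : P.low ≤ P.χ ζ := by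
  have h0 : P.χ 0 = P.low := hP.χ_low 0 ⟨le_rfl, by linarith [hP.δ₁_lt]⟩
  rw [← h0]
  exact hP.χ_mono (mem_Ici.mpr le_rfl) (mem_Ici.mpr hζ) hζ

theorem Params.Valid.vmin_lt_vm_mul (hP : P.Valid) : P.vmin < (1 - P.κ₀ * P.R₁) * P.vm := by
  have h1 := hP.low_lt_cap
  have h2 : 0 < 1 - P.κ₀ * P.R₁ := by linarith [hP.κ₀_mul_R₁_lt]
  have h3 : P.cap ≤ P.vm := by
    have : cos P.a / (1 + P.κ₀ * P.R₁) ≤ 1 := by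
      rw [div_le_one (by nlinarith [hP.κ₀_pos, hP.R₁_pos])]
      nlinarith [hP.κ₀_pos, hP.R₁_pos, cos_le_one P.a]
    unfold Params.cap
    nlinarith [hP.vm_pos]
  have h4 : P.low * (1 - P.κ₀ * P.R₁) = P.vmin := by
    unfold Params.low
    field_simp
  nlinarith

end Params

/-! ### Bounds for the turning rate of the path -/

section Turn

variable {κ κ₀ ρ ψ R : ℝ}

theorem abs_mul_le_of_abs_le (hκ : |κ| ≤ κ₀) (hρ : |ρ| ≤ R) : |κ * ρ| ≤ κ₀ * R := by
  rw [abs_mul]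
  exact mul_le_mul hκ hρ (abs_nonneg _) ((abs_nonneg _).trans hκ)

theorem abs_mul_le_of_abs_lt (hκ : |κ| < κ₀) (hρ : |ρ| ≤ R) : |κ * ρ| ≤ κ₀ * R :=
  abs_mul_le_of_abs_le hκ.le hρ

theorem one_sub_mul_pos_of_le (hκ : |κ| ≤ κ₀) (hρ : |ρ| ≤ R) (hR : κ₀ * R < 1) :
    0 < 1 - κ * ρ := by
  have := (abs_le.mp (abs_mul_le_of_abs_le hκ hρ)).2
  linarith

theorem one_sub_mul_pos (hκ : |κ| < κ₀) (hρ : |ρ| ≤ R) (hR : κ₀ * R < 1) : 0 < 1 - κ * ρ :=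
  one_sub_mul_pos_of_le hκ.le hρ hR

theorem abs_turn_le_of_le (hκ : |κ| ≤ κ₀) (hρ : |ρ| ≤ R) (hR : κ₀ * R < 1) :
    |turn κ (ρ, ψ)| ≤ κ₀ / (1 - κ₀ * R) := by
  have h1 := (abs_le.mp (abs_mul_le_of_abs_le hκ hρ)).2
  have h0 := one_sub_mul_pos_of_le hκ hρ hR
  simp only [turn]
  rw [abs_div, abs_mul, abs_of_pos h0]
  have hk0 : 0 ≤ κ₀ := (abs_nonneg _).trans hκ
  refine div_le_div₀ hk0 ?_ (by linarith) (by linarith)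
  calc |κ| * |cos ψ| ≤ κ₀ * 1 := mul_le_mul hκ (abs_cos_le_one ψ) (abs_nonneg _) hk0
    _ = κ₀ := mul_one _

theorem abs_turn_le (hκ : |κ| < κ₀) (hρ : |ρ| ≤ R) (hR : κ₀ * R < 1) :
    |turn κ (ρ, ψ)| ≤ κ₀ / (1 - κ₀ * R) :=
  abs_turn_le_of_le hκ.le hρ hR

/-- On the left of the path no factor `1 / (1 - κ₀ R)` is lost: for `κ ≥ 0` the quantity is
nonpositive, and for `κ < 0` the denominator is at least `1`. -/
theorem neg_turn_le (hκ : |κ| < κ₀) (hρ : 0 ≤ ρ) (h0 : 0 < 1 - κ * ρ) (hc : 0 ≤ cos ψ) :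
    -turn κ (ρ, ψ) ≤ κ₀ * cos ψ := by
  simp only [turn]
  have hk0 : 0 ≤ κ₀ := (abs_nonneg _).trans hκ.le
  have h1 := (abs_lt.mp hκ).1
  rw [← neg_div, div_le_iff₀ h0]
  rcases le_or_gt 0 κ with h | h
  · have : 0 ≤ κ * cos ψ := mul_nonneg h hc
    have : 0 ≤ κ₀ * cos ψ * (1 - κ * ρ) := by positivity
    linarith
  · have h3 : κ * ρ ≤ 0 := mul_nonpos_of_nonpos_of_nonneg h.le hρ
    have : κ₀ * cos ψ * 1 ≤ κ₀ * cos ψ * (1 - κ * ρ) :=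
      mul_le_mul_of_nonneg_left (by linarith) (by positivity)
    nlinarith

theorem add_mul_cos_le_sqrt (p q ψ : ℝ) : p * sin ψ + q * cos ψ ≤ √(p ^ 2 + q ^ 2) := by
  apply Real.le_sqrt_of_sq_le
  have := sin_sq_add_cos_sq ψ
  nlinarith [sq_nonneg (p * cos ψ - q * sin ψ)]

end Turn

/-! ### The control law in the coordination set -/

section Coordination

variable {P : Params} {κ ζ : ℝ} {y : ℝ × ℝ}

theorem sat_eq {x lo hi : ℝ} (h : lo ≤ hi) : sat x lo hi = max lo (min x hi) := by
  unfold sat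
  grind

theorem sat_mem {x lo hi : ℝ} (h : lo ≤ hi) : sat x lo hi ∈ Icc lo hi := by
  rw [sat_eq h]
  exact ⟨le_max_left _ _, max_le h (min_le_right _ _)⟩

theorem sat_neg {x b : ℝ} (hb : 0 ≤ b) : sat (-x) (-b) b = -sat x (-b) b := by
  rw [sat_eq (by linarith), sat_eq (by linarith)]
  grind

theorem coordSpeed_mem (hP : P.Valid) : coordSpeed P κ ζ y ∈ Icc P.vmin P.vmax :=
  sat_mem hP.vmin_lt_vmax.le

theorem coordTurn_mem (hP : P.Valid) : coordTurn P κ ζ y ∈ Icc (-P.ωmax) P.ωmax :=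
  sat_mem (by linarith [hP.ωmax_pos])

/-- For `ϑ > 0`, clipping from above only lowers the angular speed, so the unsaturated bound can
fail only when the lower limit is active. -/
theorem coordTurn_le_or (hP : P.Valid) (hϑ : 0 < ϑ P y) :
    coordTurn P κ ζ y = -P.ωmax ∨ coordTurn P κ ζ y ≤
      coordSpeed P κ ζ y * (-(P.k₁ * ϑ P y / P.k₂) + turn κ y) - P.α := by
  have hω := hP.ωmax_pos
  unfold coordTurn
  rw [sat_eq (by linarith), Real.sign_of_pos hϑ, mul_one]
  grind

theorem resetSpeed_S₁₁ {v ω : ℝ} (h : y ∈ S₁₁ P) : resetSpeed P κ y v ω =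
    if v * (P.a * sin y.2 - P.R₁ * turn κ y) + P.R₁ * ω + P.R₁ * P.α ≤ 0 then v
    else -((P.a * sin y.2 - P.R₁ * turn κ y)⁻¹ * (P.R₁ * (ω + P.α))) := by
  have h' := h
  obtain ⟨-, h1, h2, h3⟩ := h'
  have n2 : y ∉ S₁₂ P := fun h => by linarith [h.2.1]
  have n3 : y ∉ S₁₃ P := fun h => by linarith [h.2.1]
  have n4 : y ∉ S₁₄ P := fun h => by linarith [h.2.2.2]
  have n5 : y ∉ S₁₅ P := fun h => by linarith [h.2.1]
  have n6 : y ∉ S₁₆ P := fun h => by linarith [h.2.2.1]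
  simp only [resetSpeed, h, n2, n3, n4, n5, n6, false_and, if_false, true_and, ite_not]

/-- The condition `ϑ ≠ 0` excludes the origin, the only point shared with `𝒮₁⁴`. -/
theorem resetSpeed_S₁₂ {v ω : ℝ} (h : y ∈ S₁₂ P) (hϑ : ϑ P y ≠ 0) : resetSpeed P κ y v ω =
    if ω - v * turn κ y + P.α ≤ 0 then v
    else (1 - κ * y.1) / (κ * cos y.2) * (ω + P.α) := by
  have h' := h
  obtain ⟨-, h1, h2, h3⟩ := h'
  have h3' := lt_of_le_of_ne h3 hϑ.symm
  have n1 : y ∉ S₁₁ P := fun h => by linarith [h.2.1]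
  have n3 : y ∉ S₁₃ P := fun h => by linarith [h.2.2.2]
  have n4 : y ∉ S₁₄ P := fun h => by linarith [h.2.2.2]
  have n5 : y ∉ S₁₅ P := fun h => by linarith [h.2.2.2]
  have n6 : y ∉ S₁₆ P := fun h => by linarith [h.2.1]
  simp only [resetSpeed, h, n1, n3, n4, n5, n6, false_and, if_false, true_and, ite_not]

theorem resetSpeed_S₁₃ {v ω : ℝ} (h : y ∈ S₁₃ P) : resetSpeed P κ y v ω =
    if v * (P.a * sin y.2 - P.R₁ * turn κ y) + P.R₁ * ω - P.R₁ * P.α ≥ 0 then v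
    else -((P.a * sin y.2 - P.R₁ * turn κ y)⁻¹ * (P.R₁ * (ω - P.α))) := by
  have h' := h
  obtain ⟨-, h1, h2, h3⟩ := h'
  have n1 : y ∉ S₁₁ P := fun h => by linarith [h.2.1]
  have n2 : y ∉ S₁₂ P := fun h => by linarith [h.2.2.2]
  have n4 : y ∉ S₁₄ P := fun h => by linarith [h.2.1]
  have n5 : y ∉ S₁₅ P := fun h => by linarith [h.2.2.1]
  have n6 : y ∉ S₁₆ P := fun h => by linarith [h.2.1]
  simp only [resetSpeed, h, n1, n2, n4, n5, n6, false_and, if_false, true_and, ite_not]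

theorem resetSpeed_S₁₄ {v ω : ℝ} (h : y ∈ S₁₄ P) (hϑ : ϑ P y ≠ 0) : resetSpeed P κ y v ω =
    if ω - v * turn κ y - P.α ≥ 0 then v
    else (1 - κ * y.1) / (κ * cos y.2) * (ω - P.α) := by
  have h' := h
  obtain ⟨-, h1, h2, h3⟩ := h'
  have h3' := lt_of_le_of_ne h3 hϑ
  have n1 : y ∉ S₁₁ P := fun h => by linarith [h.2.2.2]
  have n2 : y ∉ S₁₂ P := fun h => by linarith [h.2.2.2]
  have n3 : y ∉ S₁₃ P := fun h => by linarith [h.2.1]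
  have n5 : y ∉ S₁₅ P := fun h => by linarith [h.2.1]
  have n6 : y ∉ S₁₆ P := fun h => by linarith [h.2.2.2]
  simp only [resetSpeed, h, n1, n2, n3, n5, n6, false_and, if_false, true_and, ite_not]

theorem resetSpeed_S₁₅ {v ω : ℝ} (h : y ∈ S₁₅ P) : resetSpeed P κ y v ω =
    if ω - v * turn κ y - P.α < 0 then (1 - κ * y.1) / (κ * cos y.2) * (ω - P.α) else v := by
  have h' := h
  obtain ⟨-, h1, h2, h3⟩ := h'
  have n1 : y ∉ S₁₁ P := fun h => by linarith [h.2.1]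
  have n2 : y ∉ S₁₂ P := fun h => by linarith [h.2.2.2]
  have n3 : y ∉ S₁₃ P := fun h => by linarith [h.2.2.1]
  have n4 : y ∉ S₁₄ P := fun h => by linarith [h.2.1]
  have n6 : y ∉ S₁₆ P := fun h => by linarith [h.2.1]
  simp only [resetSpeed, h, n1, n2, n3, n4, n6, false_and, if_false, true_and]

theorem resetSpeed_S₁₆ {v ω : ℝ} (h : y ∈ S₁₆ P) : resetSpeed P κ y v ω =
    if ω - v * turn κ y + P.α > 0 then (1 - κ * y.1) / (κ * cos y.2) * (ω + P.α) else v := by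
  have h' := h
  obtain ⟨-, h1, h2, h3⟩ := h'
  have n1 : y ∉ S₁₁ P := fun h => by linarith [h.2.2.1]
  have n2 : y ∉ S₁₂ P := fun h => by linarith [h.2.1]
  have n3 : y ∉ S₁₃ P := fun h => by linarith [h.2.1]
  have n4 : y ∉ S₁₄ P := fun h => by linarith [h.2.2.2]
  have n5 : y ∉ S₁₅ P := fun h => by linarith [h.2.1]
  simp only [resetSpeed, h, n1, n2, n3, n4, n5, false_and, if_false, true_and]

/-- A reset speed that makes the heading error decrease at rate `α`. -/
theorem reset_turn_bounds (hP : P.Valid) (hκ : |κ| < P.κ₀) (hy : y ∈ S₁ P) {v ω : ℝ}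
    (hω : ω = -P.ωmax) (h : 0 < ω - v * turn κ y + P.α) (hv : 0 < v) :
    (1 - κ * y.1) / (κ * cos y.2) * (ω + P.α) ∈ Icc P.vm v ∧
      ω - (1 - κ * y.1) / (κ * cos y.2) * (ω + P.α) * turn κ y ≤ -P.α := by
  have hb : |turn κ y| ≤ P.κ₀ / (1 - P.κ₀ * P.R₁) := abs_turn_le hκ hy.1 hP.κ₀_mul_R₁_lt
  have hα := hP.α_lt
  have hτ : turn κ y < 0 := by
    by_contra hcon
    have := mul_nonneg hv.le (not_lt.mp hcon)
    linarith
  have e : (1 - κ * y.1) / (κ * cos y.2) = (turn κ y)⁻¹ := by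
    rw [turn, inv_div]
  rw [e, hω]
  rw [abs_of_neg hτ] at hb
  have hvm := hP.vm_mul_κ₀_le
  have e2 : (turn κ y)⁻¹ * (-P.ωmax + P.α) * turn κ y = -P.ωmax + P.α := by
    have := hτ.ne
    field_simp
  refine ⟨⟨?_, ?_⟩, by rw [e2]; linarith⟩
  · rw [inv_mul_eq_div, le_div_iff_of_neg hτ]
    nlinarith [mul_le_mul_of_nonneg_left hb hP.vm_pos.le]
  · rw [inv_mul_eq_div, div_le_iff_of_neg hτ]
    linarith

theorem S₁.cos_pos (hP : P.Valid) (hy : y ∈ S₁ P) : 0 < cos y.2 := by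
  have h := abs_le.mp hy.2.1
  exact cos_pos_of_mem_Ioo ⟨by linarith [hP.a_lt], by linarith [hP.a_lt]⟩

/-- The coordination law where `ϑ > 0`. -/
theorem coordControl_of_pos (hP : P.Valid) (hκ : |κ| < P.κ₀) (hy : y ∈ S₁ P)
    (hϑ : 0 < ϑ P y) {u : ℝ × ℝ} (hu : u = coordControl P κ ζ y) :
    min P.vm (coordSpeed P κ ζ y) ≤ u.1 ∧ u.1 ≤ coordSpeed P κ ζ y ∧
    u.2 ∈ Icc (-P.ωmax) P.ωmax ∧ u.2 - u.1 * turn κ y ≤ -P.α ∧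
    (0 < y.1 → 0 ≤ y.2 →
      u.1 * (P.a * sin y.2 - P.R₁ * turn κ y) + P.R₁ * u.2 ≤ -(P.R₁ * P.α)) := by
  subst hu
  simp only [coordControl]
  have hcs := coordSpeed_mem (κ := κ) (ζ := ζ) (y := y) hP
  have hct := coordTurn_mem (κ := κ) (ζ := ζ) (y := y) hP
  have hor := coordTurn_le_or (κ := κ) (ζ := ζ) hP hϑ
  set cs := coordSpeed P κ ζ y
  set ct := coordTurn P κ ζ y
  set τ := turn κ y with hτ
  have hv : 0 < cs := hP.vmin_pos.trans_le hcs.1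
  have hk2 : 0 < P.k₂ := by linarith [hP.k₂_ge]
  have hR := hP.R₁_pos
  have hq : 0 < P.k₁ * ϑ P y / P.k₂ := div_pos (mul_pos hP.k₁_pos hϑ) hk2
  -- The unsaturated law already turns the heading at rate at most `-α`, so a reset is triggered
  -- only when `ω = -ωmax`.
  have hor' : ct = -P.ωmax ∨ ct - cs * τ + P.α ≤ 0 := by
    rcases hor with h | h
    · exact Or.inl h
    · right
      nlinarith [mul_pos hv hq]
  rcases le_or_gt y.1 0 with h1 | h1
  · -- `ψ` is positive here
    have h2 : 0 ≤ y.2 := by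
      by_contra hcon
      have hc := abs_le.mp hy.2.1
      have : sin y.2 < 0 := sin_neg_of_neg_of_neg_pi_lt (by linarith)
        (by linarith [hP.a_lt, pi_pos])
      have e : ϑ P y = P.k₁ * y.1 + P.k₂ * y.2 + P.k₃ * sin y.2 := rfl
      nlinarith [hP.k₁_pos, hP.k₃_ge]
    rw [resetSpeed_S₁₂ ⟨hy, h1, h2, hϑ.le⟩ hϑ.ne']
    split_ifs with hc
    · exact ⟨min_le_right _ _, le_rfl, hct, by linarith, fun h => by linarith⟩
    · obtain ⟨⟨h3, h4⟩, h5⟩ :=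
        reset_turn_bounds hP hκ hy (hor'.resolve_right hc) (not_le.mp hc) hv
      exact ⟨(min_le_left _ _).trans h3, h4, hct, h5, fun h => by linarith⟩
  · rcases lt_or_ge y.2 0 with h2 | h2
    · rw [resetSpeed_S₁₆ ⟨hy, h1, h2, hϑ⟩]
      split_ifs with hc
      · obtain ⟨⟨h3, h4⟩, h5⟩ :=
          reset_turn_bounds hP hκ hy (hor'.resolve_right (not_le.mpr hc)) hc hv
        exact ⟨(min_le_left _ _).trans h3, h4, hct, h5, fun _ h => by linarith⟩
      · exact ⟨min_le_right _ _, le_rfl, hct, by linarith, fun _ h => by linarith⟩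
    · rw [resetSpeed_S₁₁ ⟨hy, h1, h2, hϑ⟩, ← hτ]
      have hc := abs_le.mp hy.2.1
      have hs : 0 ≤ sin y.2 := sin_nonneg_of_nonneg_of_le_pi h2 (by linarith [hP.a_lt, pi_pos])
      have hsl : sin y.2 ≤ y.2 := sin_le h2
      set b := P.a * sin y.2 - P.R₁ * τ with hb
      -- As `a sin ψ ≥ 0`, decay of `a ρ + R₁ ψ` at rate `R₁ α` entails decay of `ψ` at rate `α`.
      have fin : ∀ v, 0 < v → v * b + P.R₁ * ct ≤ -(P.R₁ * P.α) → ct - v * τ ≤ -P.α := by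
        intro v hv h
        have h1 : P.R₁ * (ct - v * τ) ≤ P.R₁ * -P.α := by
          have : 0 ≤ v * (P.a * sin y.2) := mul_nonneg hv.le (mul_nonneg hP.a_pos.le hs)
          rw [hb] at h
          nlinarith
        exact le_of_mul_le_mul_left h1 hR
      have hor2 : ct = -P.ωmax ∨ cs * b + P.R₁ * ct + P.R₁ * P.α ≤ 0 := by
        rcases hor with h | h
        · exact Or.inl h
        · right
          -- The gain condition `a ≤ R₁ k₁` enters here, together with `k₂ sin ψ ≤ k₂ ψ ≤ ϑ`.
          have e1 : P.a * sin y.2 ≤ P.R₁ * (P.k₁ * ϑ P y / P.k₂) := by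
            have e : ϑ P y = P.k₁ * y.1 + P.k₂ * y.2 + P.k₃ * sin y.2 := rfl
            have e2 : P.k₂ * sin y.2 ≤ ϑ P y := by
              rw [e]
              have : 0 < P.k₁ * y.1 := mul_pos hP.k₁_pos h1
              have : 0 ≤ P.k₃ * sin y.2 := mul_nonneg (by linarith [hP.k₃_ge]) hs
              nlinarith
            rw [← mul_div_assoc, le_div_iff₀ hk2, ← mul_assoc]
            calc P.a * sin y.2 * P.k₂ = P.a * (P.k₂ * sin y.2) := by ring
              _ ≤ P.a * ϑ P y := mul_le_mul_of_nonneg_left e2 hP.a_pos.le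
              _ ≤ P.R₁ * P.k₁ * ϑ P y := mul_le_mul_of_nonneg_right hP.gain_le hϑ.le
          have e3 := mul_le_mul_of_nonneg_left h hR.le
          have e4 := mul_le_mul_of_nonneg_left e1 hv.le
          rw [hb]
          nlinarith
      split_ifs with hcond
      · exact ⟨min_le_right _ _, le_rfl, hct, fin _ hv (by linarith), fun _ _ => by linarith⟩
      · have hct' := hor2.resolve_right hcond
        -- By Cauchy–Schwarz the coefficient `b` is so small that the reset speed is at least `v_m`;
        -- this is the purpose of the first selection constraint.
        have hbs : b ≤ √(P.a ^ 2 + (P.R₁ * P.κ₀) ^ 2) := by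
          refine le_trans ?_ (add_mul_cos_le_sqrt _ _ y.2)
          have := neg_turn_le (ψ := y.2) hκ h1.le
            (one_sub_mul_pos hκ hy.1 hP.κ₀_mul_R₁_lt) (S₁.cos_pos hP hy).le
          rw [hb, hτ]
          have := mul_le_mul_of_nonneg_left this hR.le
          have e : turn κ (y.1, y.2) = turn κ y := rfl
          rw [e] at this
          linarith
        have hα := mul_pos hR (sub_pos.mpr hP.α_lt)
        rw [hct'] at hcond ⊢
        have hbp : 0 < b := by
          by_contra hcon
          have := mul_nonpos_of_nonneg_of_nonpos hv.le (not_lt.mp hcon)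
          apply hcond
          linarith
        have e : -(b⁻¹ * (P.R₁ * (-P.ωmax + P.α))) = P.R₁ * (P.ωmax - P.α) / b := by
          field_simp
          ring
        rw [e]
        have hvm := hP.vm_mul_sqrt_le
        have g1 : P.vm ≤ P.R₁ * (P.ωmax - P.α) / b := by
          rw [le_div_iff₀ hbp]
          exact (mul_le_mul_of_nonneg_left hbs hP.vm_pos.le).trans hvm
        have g2 : P.R₁ * (P.ωmax - P.α) / b * b = P.R₁ * (P.ωmax - P.α) := by
          field_simp
        have g3 : P.R₁ * (P.ωmax - P.α) / b * b + P.R₁ * -P.ωmax ≤ -(P.R₁ * P.α) := by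
          rw [g2]; linarith
        refine ⟨(min_le_left _ _).trans g1, ?_, ⟨le_rfl, by linarith [hP.ωmax_pos]⟩, ?_,
          fun _ _ => g3⟩
        · rw [div_le_iff₀ hbp]
          push Not at hcond
          linarith
        · have := fin _ (hP.vm_pos.trans_le g1) (by rw [hct']; exact g3)
          rwa [hct'] at this

end Coordination

end UAV

namespace UAV

/-! ### Symmetry of the control law -/

section Symmetry

variable {P : Params} {κ ζ : ℝ} {y : ℝ × ℝ}

theorem turn_neg : turn (-κ) (-y) = -turn κ y := by
  simp only [turn, Prod.fst_neg, Prod.snd_neg, cos_neg, mul_neg, neg_mul, neg_neg, neg_div]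

theorem ϑ_neg : ϑ P (-y) = -ϑ P y := by
  simp only [ϑ, Prod.fst_neg, Prod.snd_neg, sin_neg]
  ring

theorem neg_mem_S₁ : -y ∈ S₁ P ↔ y ∈ S₁ P := by
  have : P.a * -y.1 + P.R₁ * -y.2 = -(P.a * y.1 + P.R₁ * y.2) := by ring
  simp only [S₁, mem_ofPred_eq, Prod.fst_neg, Prod.snd_neg, abs_neg, this]

theorem neg_mem_S₂₂ : -y ∈ S₂₂ P ↔ y ∈ S₂₄ P := by
  simp only [S₂₂, S₂₄, mem_ofPred_eq, Prod.fst_neg, Prod.snd_neg, mem_Ico, mem_Ioc]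
  constructor <;> rintro ⟨⟨h1, h2⟩, h3, h4⟩ <;> refine ⟨⟨?_, ?_⟩, ?_, ?_⟩ <;> linarith

theorem neg_mem_S₂₄ : -y ∈ S₂₄ P ↔ y ∈ S₂₂ P := by
  rw [← neg_mem_S₂₂, neg_neg]

theorem neg_mem_S (hy : |y.2| < π) : -y ∈ S P ↔ y ∈ S P := by
  have := abs_lt.mp hy
  simp only [S, mem_ofPred_eq, Prod.fst_neg, Prod.snd_neg, mem_Icc, mem_Ico]
  constructor <;> rintro ⟨⟨h1, h2⟩, h3, h4⟩ <;> refine ⟨⟨?_, ?_⟩, ?_, ?_⟩ <;> linarith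

theorem neg_mem_S₂₁ (hy : |y.2| < π) : -y ∈ S₂₁ P ↔ y ∈ S₂₃ P := by
  simp only [S₂₁, S₂₃, S₂, mem_union, Set.mem_sdiff, mem_inter_iff, mem_ofPred_eq, neg_mem_S hy,
    neg_mem_S₁, neg_mem_S₂₂, Prod.fst_neg, Prod.snd_neg, Left.neg_pos_iff, neg_eq_zero, mem_Ioc,
    mem_Ico]
  refine or_congr Iff.rfl (and_congr_left fun _ => ?_)
  constructor <;> rintro ⟨h1, h2⟩ <;> constructor <;> linarith

theorem neg_mem_S₂₃ (hy : |y.2| < π) : -y ∈ S₂₃ P ↔ y ∈ S₂₁ P := by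
  rw [← neg_mem_S₂₁ (by simpa using hy), neg_neg]

theorem coordSpeed_neg : coordSpeed P (-κ) ζ (-y) = coordSpeed P κ ζ y := by
  simp only [coordSpeed, Prod.fst_neg, Prod.snd_neg, cos_neg, neg_mul_neg]

theorem coordTurn_neg (hP : P.Valid) : coordTurn P (-κ) ζ (-y) = -coordTurn P κ ζ y := by
  simp only [coordTurn, coordSpeed_neg, turn_neg, ϑ_neg, Real.sign_neg]
  rw [← sat_neg hP.ωmax_pos.le]
  congr 1
  ring

theorem neg_mem_S₁₁ : -y ∈ S₁₁ P ↔ y ∈ S₁₃ P := by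
  simp only [S₁₁, S₁₃, mem_ofPred_eq, neg_mem_S₁, ϑ_neg, Prod.fst_neg, Prod.snd_neg,
    Left.neg_pos_iff, Left.nonneg_neg_iff]

theorem neg_mem_S₁₂ : -y ∈ S₁₂ P ↔ y ∈ S₁₄ P := by
  simp only [S₁₂, S₁₄, mem_ofPred_eq, neg_mem_S₁, ϑ_neg, Prod.fst_neg, Prod.snd_neg,
    Left.neg_nonpos_iff, Left.nonneg_neg_iff]

theorem neg_mem_S₁₅ : -y ∈ S₁₅ P ↔ y ∈ S₁₆ P := by
  simp only [S₁₅, S₁₆, mem_ofPred_eq, neg_mem_S₁, ϑ_neg, Prod.fst_neg, Prod.snd_neg,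
    Left.neg_neg_iff, Left.neg_pos_iff]

theorem resetSpeed_neg_of_pos (hy : y ∈ S₁ P) (hϑ : 0 < ϑ P y) (hP : P.Valid) (v ω : ℝ) :
    resetSpeed P (-κ) (-y) v (-ω) = resetSpeed P κ y v ω := by
  have ed : (1 - -κ * (-y).1) / (-κ * cos (-y).2) = -((1 - κ * y.1) / (κ * cos y.2)) := by
    simp only [Prod.fst_neg, Prod.snd_neg, cos_neg, mul_neg, neg_neg, neg_mul, div_neg]
  have eb : P.a * sin (-y).2 - P.R₁ * turn (-κ) (-y)
      = -(P.a * sin y.2 - P.R₁ * turn κ y) := by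
    rw [turn_neg, Prod.snd_neg, sin_neg]
    ring
  rcases le_or_gt y.1 0 with h1 | h1
  · have h2 : 0 ≤ y.2 := by
      by_contra hcon
      have hc := abs_le.mp hy.2.1
      have : sin y.2 < 0 := sin_neg_of_neg_of_neg_pi_lt (by linarith)
        (by linarith [hP.a_lt, pi_pos])
      have e : ϑ P y = P.k₁ * y.1 + P.k₂ * y.2 + P.k₃ * sin y.2 := rfl
      nlinarith [hP.k₁_pos, hP.k₃_ge, hP.k₂_ge]
    have hm : y ∈ S₁₂ P := ⟨hy, h1, h2, hϑ.le⟩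
    have hm' : -y ∈ S₁₄ P := by rw [← neg_mem_S₁₂, neg_neg]; exact hm
    rw [resetSpeed_S₁₂ hm hϑ.ne', resetSpeed_S₁₄ hm' (by rw [ϑ_neg]; linarith), turn_neg, ed]
    have : (-ω - v * -turn κ y - P.α ≥ 0) ↔ (ω - v * turn κ y + P.α ≤ 0) := by
      constructor <;> intro h <;> linarith
    simp only [this]
    congr 1
    ring
  · rcases lt_or_ge y.2 0 with h2 | h2
    · have hm : y ∈ S₁₆ P := ⟨hy, h1, h2, hϑ⟩
      rw [resetSpeed_S₁₆ hm, resetSpeed_S₁₅ (neg_mem_S₁₅.mpr hm), turn_neg, ed]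
      have : (-ω - v * -turn κ y - P.α < 0) ↔ (ω - v * turn κ y + P.α > 0) := by
        constructor <;> intro h <;> linarith
      simp only [this]
      congr 1
      ring
    · have hm : y ∈ S₁₁ P := ⟨hy, h1, h2, hϑ⟩
      have hm' : -y ∈ S₁₃ P := by rw [← neg_mem_S₁₁, neg_neg]; exact hm
      rw [resetSpeed_S₁₁ hm, resetSpeed_S₁₃ hm', eb]
      have : (v * -(P.a * sin y.2 - P.R₁ * turn κ y) + P.R₁ * -ω - P.R₁ * P.α ≥ 0) ↔
          (v * (P.a * sin y.2 - P.R₁ * turn κ y) + P.R₁ * ω + P.R₁ * P.α ≤ 0) := by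
        constructor <;> intro h <;> linarith
      simp only [this]
      congr 1
      rw [inv_neg]
      ring

theorem coordControl_neg (hP : P.Valid) (hy : y ∈ S₁ P) (hϑ : ϑ P y ≠ 0) :
    coordControl P (-κ) ζ (-y) = ((coordControl P κ ζ y).1, -(coordControl P κ ζ y).2) := by
  simp only [coordControl, coordSpeed_neg, coordTurn_neg hP]
  congr 1
  rcases lt_or_gt_of_ne hϑ with h | h
  · have := resetSpeed_neg_of_pos (κ := -κ) (y := -y) (neg_mem_S₁.mpr hy)
      (by rw [ϑ_neg]; linarith) hP (coordSpeed P κ ζ y) (-coordTurn P κ ζ y)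
    simp only [neg_neg] at this
    exact this.symm
  · exact resetSpeed_neg_of_pos hy h hP _ _

theorem law₂₂_neg : law₂₂ P (-κ) (-y) = ((law₂₄ P κ y).1, -(law₂₄ P κ y).2) := by
  have h1 : ((-y).2 ≤ P.a - P.ε₀) ↔ (-P.a + P.ε₀ ≤ y.2) := by
    rw [Prod.snd_neg]
    constructor <;> intro h <;> linarith
  have h2 : (-P.ωmax - P.vmax * turn (-κ) (-y) ≤ 0) ↔ (0 ≤ P.ωmax - P.vmax * turn κ y) := by
    rw [turn_neg]
    constructor <;> intro h <;> linarith
  simp only [law₂₂, law₂₄, h1, h2]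
  split_ifs
  · simp
  · simp only [turn_neg, mul_neg, Prod.mk.injEq, true_and]
    grind
  · simp only [Prod.fst_neg, Prod.snd_neg, cos_neg, mul_neg, neg_neg, neg_mul, neg_div_neg_eq]

theorem law₂₄_neg : law₂₄ P (-κ) (-y) = ((law₂₂ P κ y).1, -(law₂₂ P κ y).2) := by
  have := law₂₂_neg (P := P) (κ := -κ) (y := -y)
  simp only [neg_neg] at this
  rw [this]
  simp

theorem S₂₂_disjoint_S₂₄ (h : y ∈ S₂₂ P) : y ∉ S₂₄ P := fun h' => by
  have := h.2.1
  have := h'.2.2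
  linarith

theorem S₂₁_disjoint_S₂₃ (hP : P.Valid) (h : y ∈ S₂₁ P) : y ∉ S₂₃ P := by
  have := hP.R₁_pos
  rintro (⟨⟨h1, -⟩, -⟩ | ⟨h1, h2⟩) <;> rcases h with ⟨⟨h3, -⟩, -⟩ | ⟨h3, h4⟩ <;>
    simp only [mem_ofPred_eq, mem_Ico, mem_Ioc] at * <;> linarith

/-- Reflection in the path reverses the signs of `κ`, `ρ`, `ψ` and the turn and keeps the forward
speed. The half-open range of `ψ` breaks the symmetry at `-π`, and the reset rule is compared only
where `ϑ ≠ 0`; the points left out form a null set. -/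
theorem feedback_neg (hP : P.Valid) (hψ : |y.2| < π) (hϑ : ϑ P y ≠ 0) :
    feedback P (-κ) ζ (-y) = ((feedback P κ ζ y).1, -(feedback P κ ζ y).2) := by
  by_cases h1 : y ∈ S₁ P
  · simp only [feedback, h1, neg_mem_S₁.mpr h1, if_true]
    exact coordControl_neg hP h1 hϑ
  have m1 := mt neg_mem_S₁.mp h1
  by_cases h2 : y ∈ S₂₂ P
  · have m2 := mt neg_mem_S₂₂.mp (S₂₂_disjoint_S₂₄ h2)
    simp only [feedback, h1, h2, m1, m2, neg_mem_S₂₄.mpr h2, if_true, if_false]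
    exact law₂₄_neg
  have m4 := mt neg_mem_S₂₄.mp h2
  by_cases h4 : y ∈ S₂₄ P
  · simp only [feedback, h1, h2, h4, m1, neg_mem_S₂₂.mpr h4, if_true, if_false]
    exact law₂₂_neg
  have m2 := mt neg_mem_S₂₂.mp h4
  by_cases h5 : y ∈ S₂₁ P
  · have m5 := mt (neg_mem_S₂₁ hψ).mp (S₂₁_disjoint_S₂₃ hP h5)
    have m6 := (neg_mem_S₂₃ hψ).mpr h5
    simp [feedback, h1, h2, h4, h5, m1, m2, m4, m5, m6]
  have m6 := mt (neg_mem_S₂₃ hψ).mp h5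
  by_cases h6 : y ∈ S₂₃ P
  · have m5 := (neg_mem_S₂₁ hψ).mpr h6
    simp [feedback, h1, h2, h4, h5, h6, m1, m2, m4, m5]
  · have m5 := mt (neg_mem_S₂₁ hψ).mp h6
    simp [feedback, h1, h2, h4, h5, h6, m1, m2, m4, m5, m6]
    rfl

end Symmetry

/-! ### The control law, region by region -/

section Feedback

variable {P : Params} {κ ζ : ℝ} {y : ℝ × ℝ}

/-- The points at which the control law is not considered. -/
def exceptional (P : Params) : Set (ℝ × ℝ) := {y | ϑ P y = 0 ∨ |y.2| = π ∨ y.2 = 0}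

theorem abs_lt_pi_of_mem (hy : y ∈ S P) (hye : y ∉ exceptional P) : |y.2| < π :=
  lt_of_le_of_ne (abs_le.mpr ⟨hy.2.1, hy.2.2.le⟩) fun h => hye (Or.inr (Or.inl h))

/-- Fubini, with `ψ` moved to the first place: except for three values of `ψ`, the slice is given by
`ϑ = 0`, an affine equation in `ρ` with slope `k₁ > 0`. -/
theorem volume_exceptional (hP : P.Valid) : volume (exceptional P) = 0 := by
  have hm : MeasurableSet (exceptional P) := by
    apply MeasurableSet.union
    · have : Measurable (ϑ P) := by unfold ϑ; fun_prop
      exact this (measurableSet_singleton 0)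
    · apply MeasurableSet.union
      · have : Measurable fun y : ℝ × ℝ => |y.2| := by fun_prop
        exact this (measurableSet_singleton π)
      · exact measurable_snd (measurableSet_singleton 0)
  rw [Measure.volume_eq_prod, ← (Measure.measurePreserving_swap (μ := (volume : Measure ℝ))
    (ν := (volume : Measure ℝ))).measure_preimage hm.nullMeasurableSet,
    Measure.measure_prod_null (measurable_swap hm)]
  have h1 : ∀ᵐ ψ : ℝ, |ψ| ≠ π := by
    have h1 : ∀ᵐ t : ℝ, t ≠ π := by simp [ae_iff]
    have h2 : ∀ᵐ t : ℝ, t ≠ -π := by simp [ae_iff]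
    filter_upwards [h1, h2] with t h1 h2 h
    rcases (abs_eq pi_pos.le).mp h with h | h
    · exact h1 h
    · exact h2 h
  have h0 : ∀ᵐ ψ : ℝ, ψ ≠ 0 := by simp [ae_iff]
  filter_upwards [h1, h0] with ψ hψ hψ0
  refine measure_mono_null (t := {-(P.k₂ * ψ + P.k₃ * sin ψ) / P.k₁}) ?_ (by simp)
  rintro ρ (h | h | h)
  · have h' : P.k₁ * ρ + P.k₂ * ψ + P.k₃ * sin ψ = 0 := h
    have := hP.k₁_pos
    rw [mem_singleton_iff, eq_div_iff this.ne']
    linarith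
  · exact absurd h hψ
  · exact absurd h hψ0

/-- The upper boundary of the region in which the error is steered towards the path. -/
noncomputable def roof (P : Params) (ρ : ℝ) : ℝ := max 0 (min P.a (P.a * (1 - ρ / P.R₁)))

theorem roof_nonneg {ρ : ℝ} : 0 ≤ roof P ρ := le_max_left _ _

theorem roof_le (hP : P.Valid) {ρ : ℝ} : roof P ρ ≤ P.a := max_le hP.a_pos.le (min_le_left _ _)

theorem roof_of_nonpos (hP : P.Valid) {ρ : ℝ} (h : ρ ≤ 0) : roof P ρ = P.a := by
  have h1 : ρ / P.R₁ ≤ 0 := div_nonpos_of_nonpos_of_nonneg h hP.R₁_pos.le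
  have := hP.a_pos
  rw [roof, min_eq_left (by nlinarith), max_eq_right this.le]

theorem roof_of_ge (hP : P.Valid) {ρ : ℝ} (h : P.R₁ ≤ ρ) : roof P ρ = 0 := by
  have h1 : 1 ≤ ρ / P.R₁ := (one_le_div hP.R₁_pos).mpr h
  have := hP.a_pos
  rw [roof, max_eq_left]
  exact (min_le_right _ _).trans (by nlinarith)

theorem le_roof_iff_of_mem (hP : P.Valid) {ρ ψ : ℝ} (h0 : 0 ≤ ρ) (h1 : ρ ≤ P.R₁) :
    ψ ≤ roof P ρ ↔ P.a * ρ + P.R₁ * ψ ≤ P.a * P.R₁ := by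
  have hR := hP.R₁_pos
  have ha := hP.a_pos
  have h2 : 0 ≤ ρ / P.R₁ := by positivity
  have h3 : ρ / P.R₁ ≤ 1 := (div_le_one hR).mpr h1
  rw [roof, min_eq_right (by nlinarith), max_eq_right (mul_nonneg ha.le (by linarith)),
    show P.a * (1 - ρ / P.R₁) = (P.a * P.R₁ - P.a * ρ) / P.R₁ by field_simp, le_div_iff₀ hR]
  constructor <;> intro h <;> linarith

theorem mem_S₁_of_le_roof (hP : P.Valid) (hρ : |y.1| ≤ P.R₁) (h : y.2 ≤ roof P y.1)
    (h' : -y.2 ≤ roof P (-y.1)) : y ∈ S₁ P := by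
  have hR := hP.R₁_pos
  have ha := hP.a_pos
  have hb := abs_le.mp hρ
  have h1 := h.trans (roof_le hP)
  have h2 := h'.trans (roof_le hP)
  refine ⟨hρ, abs_le.mpr ⟨by linarith, h1⟩, abs_le.mpr ?_⟩
  rcases le_total 0 y.1 with h0 | h0
  · rw [le_roof_iff_of_mem hP h0 hb.2] at h
    exact ⟨by nlinarith, h⟩
  · rw [le_roof_iff_of_mem hP (by linarith) (by linarith)] at h'
    exact ⟨by linarith, by nlinarith⟩

theorem le_roof_of_mem_S₁ (hP : P.Valid) (h : y ∈ S₁ P) : y.2 ≤ roof P y.1 := by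
  rcases le_total y.1 0 with h0 | h0
  · rw [roof_of_nonpos hP h0]
    exact (abs_le.mp h.2.1).2
  · rw [le_roof_iff_of_mem hP h0 (abs_le.mp h.1).2]
    exact (abs_le.mp h.2.2).2

theorem mem_S₂₁_of_roof_lt (hP : P.Valid) (hy : y ∈ S P) (h : roof P y.1 < y.2) :
    y ∉ S₁ P ∧ y ∉ S₂₂ P ∧ y ∉ S₂₄ P ∧ y ∈ S₂₁ P := by
  have h0 : 0 < y.2 := roof_nonneg.trans_lt h
  have n1 : y ∉ S₁ P := fun h1 => absurd (le_roof_of_mem_S₁ hP h1) (not_le.mpr h)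
  have n2 : y ∉ S₂₂ P := by
    intro h2
    rw [roof_of_nonpos hP (by linarith [h2.1.2, hP.R₁_pos])] at h
    linarith [h2.2.2]
  have n4 : y ∉ S₂₄ P := fun h4 => by linarith [h4.2.2]
  exact ⟨n1, n2, n4, Or.inl ⟨⟨h0, hy, n1⟩, n2⟩⟩

theorem feedback_of_roof_lt (hP : P.Valid) (hy : y ∈ S P) (h : roof P y.1 < y.2) :
    feedback P κ ζ y = (P.vmin, -P.ωmax) := by
  obtain ⟨n1, n2, n4, h5⟩ := mem_S₂₁_of_roof_lt hP hy h
  simp [feedback, n1, n2, n4, h5]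

theorem feedback_of_mem_S₁ (h : y ∈ S₁ P) : feedback P κ ζ y = coordControl P κ ζ y := by
  simp [feedback, h]

theorem feedback_of_mem_S₂₂ (h : y ∈ S₂₂ P) : feedback P κ ζ y = law₂₂ P κ y := by
  have n1 : y ∉ S₁ P := fun h1 => by linarith [(abs_le.mp h1.1).1, h.1.2]
  simp [feedback, n1, h]

/-- Every regular point of the region is in one of these cases. -/
theorem cases_of_mem_S (hP : P.Valid) (hy : y ∈ S P) (hye : y ∉ exceptional P) :
    y ∈ S₁ P ∨ y ∈ S₂₂ P ∨ y ∈ S₂₄ P ∨ roof P y.1 < y.2 ∨ roof P (-y.1) < -y.2 := by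
  by_contra hcon
  push Not at hcon
  obtain ⟨n1, n2, n4, h1, h2⟩ := hcon
  have hb : P.R₁ < |y.1| := by
    by_contra hb
    exact n1 (mem_S₁_of_le_roof hP (not_lt.mp hb) h1 h2)
  have ha1 := h1.trans (roof_le hP)
  have ha2 := h2.trans (roof_le hP)
  have hS := hy.1
  rcases lt_trichotomy y.2 0 with h | h | h
  · rcases lt_abs.mp hb with hb | hb
    · exact n4 ⟨⟨hb, hS.2⟩, by linarith, h⟩
    · rw [roof_of_ge hP hb.le] at h2
      linarith
  · exact hye (Or.inr (Or.inr h))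
  · rcases lt_abs.mp hb with hb | hb
    · rw [roof_of_ge hP hb.le] at h1
      linarith
    · exact n2 ⟨⟨hS.1, by linarith⟩, h, by linarith⟩

theorem feedback_eq_neg (hP : P.Valid) (hy : y ∈ S P) (hye : y ∉ exceptional P) :
    feedback P κ ζ y = ((feedback P (-κ) ζ (-y)).1, -(feedback P (-κ) ζ (-y)).2) := by
  rw [feedback_neg hP (abs_lt_pi_of_mem hy hye) fun h => hye (Or.inl h)]
  simp

/-- The rate at which the heading is corrected in the outer regions. -/
noncomputable def Params.steer (P : Params) : ℝ := P.ωmax - P.vmax * (P.κ₀ / (1 + P.κ₀ * P.R₁))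

theorem Params.Valid.steer_pos (hP : P.Valid) : 0 < P.steer := by
  have h1 : 0 < P.κ₀ * P.R₁ := mul_pos hP.κ₀_pos hP.R₁_pos
  have h2 : P.κ₀ / (1 + P.κ₀ * P.R₁) < P.κ₀ := by
    rw [div_lt_iff₀ (by linarith)]
    nlinarith [hP.κ₀_pos]
  have := mul_lt_mul_of_pos_left h2 hP.vmax_pos
  unfold Params.steer
  linarith [hP.κ₀_mul_vmax_le]

/-- The reason for the bound on `R₂`: at minimal speed the steering authority exceeds the rotation
of the tangent at the projection, even at distance `R` on the inner side of the sharpest bend. -/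
theorem Params.κ₀_mul_R₂_lt (hP : P.Valid) {R : ℝ} (hR : R < 1 / P.κ₀ - P.vmin / P.ωmax) :
    P.κ₀ * R < 1 ∧ P.vmin * (P.κ₀ / (1 - P.κ₀ * R)) < P.ωmax := by
  have hκ := hP.κ₀_pos
  have hω := hP.ωmax_pos
  have h1 : P.κ₀ * R < P.κ₀ * (1 / P.κ₀ - P.vmin / P.ωmax) := mul_lt_mul_of_pos_left hR hκ
  have h2 : P.κ₀ * (1 / P.κ₀ - P.vmin / P.ωmax) = 1 - P.κ₀ * P.vmin / P.ωmax := by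
    field_simp
  rw [h2] at h1
  have h3 : 0 < P.κ₀ * P.vmin / P.ωmax := div_pos (mul_pos hκ hP.vmin_pos) hω
  refine ⟨by linarith, ?_⟩
  rw [← mul_div_assoc, div_lt_iff₀ (by linarith)]
  have h4 : P.κ₀ * P.vmin / P.ωmax < 1 - P.κ₀ * R := by linarith
  rw [div_lt_iff₀ hω] at h4
  linarith

/-- The law in `𝒮₂²`. -/
theorem feedback_S₂₂ (hP : P.Valid) (hR₂ : P.R₂ < 1 / P.κ₀ - P.vmin / P.ωmax)
    (hκ : |κ| < P.κ₀) (hy : y ∈ S₂₂ P) {u : ℝ × ℝ} (hu : u = feedback P κ ζ y) :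
    u.1 ∈ Icc P.vmin P.vmax ∧ u.2 ∈ Icc (-P.ωmax) P.ωmax ∧
    (y.2 ≤ P.a - P.ε₀ → P.steer ≤ u.2 - u.1 * turn κ y) ∧
    (P.a - P.ε₀ < y.2 → u.2 - u.1 * turn κ y = 0) := by
  rw [feedback_of_mem_S₂₂ hy] at hu
  obtain ⟨hR, hv⟩ := Params.κ₀_mul_R₂_lt hP hR₂
  have hω := hP.ωmax_pos
  have hvv := hP.vmin_lt_vmax
  have hvm := hP.vmax_pos
  have hρ : |y.1| ≤ P.R₂ := abs_le.mpr ⟨hy.1.1, by linarith [hy.1.2, hP.R₁_pos, hP.R₂_pos]⟩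
  have h0 := one_sub_mul_pos hκ hρ hR
  have hc : 0 < cos y.2 :=
    cos_pos_of_mem_Ioo ⟨by linarith [hy.2.1, pi_pos], by linarith [hy.2.2, hP.a_lt]⟩
  -- For `κ > 0` and `ρ < -R₁` the denominator is at least `1 + κ R₁`, and `κ / (1 + κ R₁)`
  -- increases with `κ`; for `κ ≤ 0` the left side is nonpositive.
  have hτ : turn κ y ≤ P.κ₀ / (1 + P.κ₀ * P.R₁) := by
    have hRp := mul_pos hP.κ₀_pos hP.R₁_pos
    rw [turn, div_le_div_iff₀ h0 (by linarith)]
    rcases le_or_gt κ 0 with hk | hk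
    · have := mul_nonpos_of_nonpos_of_nonneg hk hc.le
      nlinarith [hP.κ₀_pos]
    · have e1 : κ * cos y.2 ≤ κ := by nlinarith [cos_le_one y.2]
      have e2 : κ < P.κ₀ := (abs_lt.mp hκ).2
      have e3 : κ * P.R₁ ≤ κ * -y.1 := mul_le_mul_of_nonneg_left (by linarith [hy.1.2]) hk.le
      nlinarith [hP.κ₀_pos]
  -- Consequently the minimum with `ωmax` in the law is never active.
  have hτv : P.vmax * turn κ y < P.ωmax := by
    have := hP.steer_pos
    have := mul_le_mul_of_nonneg_left hτ hvm.le
    unfold Params.steer at *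
    linarith
  have hτb : |turn κ y| ≤ P.κ₀ / (1 - P.κ₀ * P.R₂) := abs_turn_le hκ hρ hR
  subst hu
  unfold law₂₂
  split_ifs with h1 h2
  · refine ⟨⟨hvv.le, le_rfl⟩, ⟨by linarith, le_rfl⟩, fun _ => ?_, fun h => absurd h1 (not_le.mpr h)⟩
    have := mul_le_mul_of_nonneg_left hτ hvm.le
    unfold Params.steer
    linarith
  · simp only [min_eq_right hτv.le]
    exact ⟨⟨hvv.le, le_rfl⟩, ⟨by linarith, hτv.le⟩, fun h => absurd h h1, fun _ => by ring⟩
  -- Here the speed is `ωmax / |turn κ y|`: at least `v_min` by the bound on `R₂`, and at most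
  -- `v_max` by the case hypothesis.
  · push Not at h2
    have hτn : turn κ y < 0 := by
      by_contra hcon
      have := mul_nonneg hvm.le (not_lt.mp hcon)
      linarith
    have e : -P.ωmax * (1 - κ * y.1) / (κ * cos y.2) = -P.ωmax / turn κ y := by
      rw [turn, div_div_eq_mul_div]
    have hne := hτn.ne
    rw [abs_of_neg hτn] at hτb
    simp only [e]
    refine ⟨⟨?_, ?_⟩, ⟨le_rfl, by linarith⟩, fun h => absurd h h1, fun _ => ?_⟩
    · rw [le_div_iff_of_neg hτn]
      nlinarith [mul_le_mul_of_nonneg_left hτb hP.vmin_pos.le]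
    · rw [div_le_iff_of_neg hτn]
      linarith
    · field_simp
      ring

/-- The law in `𝒮₂⁴`. -/
theorem feedback_S₂₄ (hP : P.Valid) (hR₂ : P.R₂ < 1 / P.κ₀ - P.vmin / P.ωmax)
    (hκ : |κ| < P.κ₀) (hyS : y ∈ S P) (hye : y ∉ exceptional P) (hy : y ∈ S₂₄ P)
    {u : ℝ × ℝ} (hu : u = feedback P κ ζ y) :
    u.1 ∈ Icc P.vmin P.vmax ∧ u.2 ∈ Icc (-P.ωmax) P.ωmax ∧
    (-P.a + P.ε₀ ≤ y.2 → u.2 - u.1 * turn κ y ≤ -P.steer) ∧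
    (y.2 < -P.a + P.ε₀ → u.2 - u.1 * turn κ y = 0) := by
  rw [feedback_eq_neg hP hyS hye] at hu
  obtain ⟨h1, h2, h3, h4⟩ := feedback_S₂₂ (ζ := ζ) (κ := -κ) (y := -y) hP hR₂ (by rwa [abs_neg])
    (neg_mem_S₂₂.mpr hy) rfl
  rw [turn_neg, Prod.snd_neg] at h3 h4
  subst hu
  exact ⟨h1, ⟨by linarith [h2.2], by linarith [h2.1]⟩, fun h => by linarith [h3 (by linarith)],
    fun h => by linarith [h4 (by linarith)]⟩

theorem feedback_of_lt_floor (hP : P.Valid) (hyS : y ∈ S P) (hye : y ∉ exceptional P)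
    (h : roof P (-y.1) < -y.2) : feedback P κ ζ y = (P.vmin, P.ωmax) := by
  rw [feedback_eq_neg hP hyS hye, feedback_of_roof_lt hP
    ((neg_mem_S (abs_lt_pi_of_mem hyS hye)).mpr hyS) h]
  simp

/-- The law in the coordination set, where `ϑ > 0`. -/
theorem feedback_S₁_of_pos (hP : P.Valid) (hκ : |κ| < P.κ₀) (hy : y ∈ S₁ P) (hϑ : 0 < ϑ P y)
    {u : ℝ × ℝ} (hu : u = feedback P κ ζ y) :
    min P.vm (coordSpeed P κ ζ y) ≤ u.1 ∧ u.1 ≤ coordSpeed P κ ζ y ∧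
    u.2 ∈ Icc (-P.ωmax) P.ωmax ∧ u.2 - u.1 * turn κ y ≤ -P.α ∧
    (0 < y.1 → 0 ≤ y.2 →
      u.1 * (P.a * sin y.2 - P.R₁ * turn κ y) + P.R₁ * u.2 ≤ -(P.R₁ * P.α)) :=
  coordControl_of_pos hP hκ hy hϑ (by rw [hu, feedback_of_mem_S₁ hy])

/-- The speeds in the coordination set. -/
theorem feedback_S₁_speed (hP : P.Valid) (hκ : |κ| < P.κ₀) (hyS : y ∈ S P)
    (hye : y ∉ exceptional P) (hy : y ∈ S₁ P) {u : ℝ × ℝ} (hu : u = feedback P κ ζ y) :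
    min P.vm (coordSpeed P κ ζ y) ≤ u.1 ∧ u.1 ≤ coordSpeed P κ ζ y ∧
    u.2 ∈ Icc (-P.ωmax) P.ωmax := by
  rcases lt_or_gt_of_ne (fun h => hye (Or.inl h) : ϑ P y ≠ 0) with h | h
  · rw [feedback_eq_neg hP hyS hye] at hu
    obtain ⟨h1, h2, h3, -⟩ := feedback_S₁_of_pos (ζ := ζ) (κ := -κ) (y := -y) hP
      (by rwa [abs_neg]) (neg_mem_S₁.mpr hy) (by rw [ϑ_neg]; linarith) rfl
    rw [coordSpeed_neg] at h1 h2
    subst hu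
    exact ⟨h1, h2, by linarith [h3.2], by linarith [h3.1]⟩
  · obtain ⟨h1, h2, h3, -⟩ := feedback_S₁_of_pos (ζ := ζ) hP hκ hy h hu
    exact ⟨h1, h2, h3⟩

/-- The control law respects the speed constraints. -/
theorem feedback_mem (hP : P.Valid) (hR₂ : P.R₂ < 1 / P.κ₀ - P.vmin / P.ωmax)
    (hκ : |κ| < P.κ₀) (hyS : y ∈ S P) (hye : y ∉ exceptional P) :
    feedback P κ ζ y ∈ Icc P.vmin P.vmax ×ˢ Icc (-P.ωmax) P.ωmax := by
  have hω := hP.ωmax_pos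
  rcases cases_of_mem_S hP hyS hye with h | h | h | h | h
  · obtain ⟨h1, h2, h3⟩ := feedback_S₁_speed (ζ := ζ) hP hκ hyS hye h rfl
    have hc := coordSpeed_mem (κ := κ) (ζ := ζ) (y := y) hP
    exact ⟨⟨(le_min hP.vm_gt.le hc.1).trans h1, h2.trans hc.2⟩, h3⟩
  · obtain ⟨h1, h2, -⟩ := feedback_S₂₂ (ζ := ζ) hP hR₂ hκ h rfl
    exact ⟨h1, h2⟩
  · obtain ⟨h1, h2, -⟩ := feedback_S₂₄ (ζ := ζ) hP hR₂ hκ hyS hye h rfl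
    exact ⟨h1, h2⟩
  · rw [feedback_of_roof_lt hP hyS h]
    exact ⟨⟨le_rfl, hP.vmin_lt_vmax.le⟩, le_rfl, by simp only; linarith⟩
  · rw [feedback_of_lt_floor hP hyS hye h]
    exact ⟨⟨le_rfl, hP.vmin_lt_vmax.le⟩, by simp only; linarith, le_rfl⟩

end Feedback

end UAV

namespace UAV

/-! ### Filippov regularization -/

section Filippov

variable {D : Set (ℝ × ℝ)} {u : ℝ × ℝ → ℝ × ℝ} {x w : ℝ × ℝ} {N : Set (ℝ × ℝ)}

/-- A small ball and the given null set are one admissible choice in the intersection, and a closed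
convex set absorbs both the hull and the closure. -/
theorem filippov_mem {K : Set (ℝ × ℝ)} (hK : IsClosed K) (hKc : Convex ℝ K) (hN : volume N = 0)
    (h : ∀ᶠ y in 𝓝 x, y ∈ D → y ∉ N → u y ∈ K) (hw : w ∈ filippov D u x) : w ∈ K := by
  obtain ⟨δ, hδ, hb⟩ := Metric.eventually_nhds_iff_ball.mp h
  simp only [filippov, mem_iInter] at hw
  refine closure_minimal (convexHull_min ?_ hKc) hK (hw δ hδ N hN)
  rintro _ ⟨y, ⟨⟨h1, h2⟩, h3⟩, rfl⟩
  exact hb y h1 h2 h3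

/-- The coefficients may vary with the point: freezing them at `x` costs an error that continuity
and the boundedness of `u` make smaller than any `η`. -/
theorem filippov_le {A B C : ℝ × ℝ → ℝ} {M : ℝ} (hA : ContinuousAt A x) (hB : ContinuousAt B x)
    (hC : ContinuousAt C x) (hN : volume N = 0)
    (hM : ∀ y ∈ D, y ∉ N → |(u y).1| ≤ M ∧ |(u y).2| ≤ M)
    (h : ∀ᶠ y in 𝓝 x, y ∈ D → y ∉ N → A y * (u y).1 + B y * (u y).2 ≤ C y)
    (hw : w ∈ filippov D u x) : A x * w.1 + B x * w.2 ≤ C x := by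
  refine le_of_forall_pos_le_add fun η hη => ?_
  let K : Set (ℝ × ℝ) := {p | A x * p.1 + B x * p.2 ≤ C x + η}
  have hK : IsClosed K := isClosed_le (by fun_prop) (by fun_prop)
  have hKc : Convex ℝ K := by
    intro p hp q hq s t hs ht hst
    have hp' : A x * p.1 + B x * p.2 ≤ C x + η := hp
    have hq' : A x * q.1 + B x * q.2 ≤ C x + η := hq
    change A x * (s • p + t • q).1 + B x * (s • p + t • q).2 ≤ C x + η
    simp only [Prod.fst_add, Prod.snd_add, Prod.smul_fst, Prod.smul_snd, smul_eq_mul]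
    have e : C x + η = s * (C x + η) + t * (C x + η) := by rw [← add_mul, hst, one_mul]
    rw [e]
    linarith [mul_le_mul_of_nonneg_left hp' hs, mul_le_mul_of_nonneg_left hq' ht]
  refine filippov_mem (N := N) (K := K) hK hKc hN ?_ hw
  have hcont : ContinuousAt (fun y => |A x - A y| * M + |B x - B y| * M + (C y - C x)) x := by
    fun_prop
  have hlt : ∀ᶠ y in 𝓝 x, |A x - A y| * M + |B x - B y| * M + (C y - C x) < η :=
    hcont.eventually_lt continuousAt_const (by simpa using hη)
  filter_upwards [h, hlt] with y hy hlt hyD hyN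
  have h1 := hy hyD hyN
  obtain ⟨m1, m2⟩ := hM y hyD hyN
  change A x * (u y).1 + B x * (u y).2 ≤ C x + η
  have e1 : (A x - A y) * (u y).1 ≤ |A x - A y| * M := by
    refine (le_abs_self _).trans ?_
    rw [abs_mul]
    exact mul_le_mul_of_nonneg_left m1 (abs_nonneg _)
  have e2 : (B x - B y) * (u y).2 ≤ |B x - B y| * M := by
    refine (le_abs_self _).trans ?_
    rw [abs_mul]
    exact mul_le_mul_of_nonneg_left m2 (abs_nonneg _)
  linarith

variable {P : Params} {κ ζ : ℝ}

/-- The reflection maps balls to balls and null sets to null sets and acts linearly on the controls,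
so it commutes with the regularization. -/
theorem filippov_feedback_neg (hP : P.Valid)
    (hw : w ∈ filippov (S P) (feedback P κ ζ) x) :
    (w.1, -w.2) ∈ filippov (S P) (feedback P (-κ) ζ) (-x) := by
  simp only [filippov, mem_iInter]
  intro δ hδ N hN
  let σ : ℝ × ℝ →L[ℝ] ℝ × ℝ :=
    (ContinuousLinearMap.fst ℝ ℝ ℝ).prod (-ContinuousLinearMap.snd ℝ ℝ ℝ)
  set K := closure (convexHull ℝ (feedback P (-κ) ζ '' ((Metric.ball (-x) δ ∩ S P) \ N)))
  have hKc : Convex ℝ K := (convex_convexHull ℝ _).closure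
  have hneg : volume ((fun y : ℝ × ℝ => -y) ⁻¹' N) = 0 := by
    have := Measure.measurePreserving_neg (volume : Measure (ℝ × ℝ))
    exact this.quasiMeasurePreserving.preimage_null hN
  have key : w ∈ σ ⁻¹' K := by
    refine filippov_mem (N := (fun y : ℝ × ℝ => -y) ⁻¹' N ∪ exceptional P)
      (isClosed_closure.preimage σ.continuous) (hKc.is_linear_preimage σ.isBoundedLinearMap.1)
      (measure_union_null hneg (volume_exceptional hP)) ?_ hw
    filter_upwards [Metric.ball_mem_nhds x hδ] with y hy hyS hyN
    simp only [mem_union, not_or, mem_preimage] at hyN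
    apply subset_closure
    apply subset_convexHull
    have hlt := abs_lt_pi_of_mem hyS hyN.2
    refine ⟨-y, ⟨⟨?_, (neg_mem_S hlt).mpr hyS⟩, hyN.1⟩, ?_⟩
    · rw [Metric.mem_ball, dist_neg_neg]
      exact hy
    · rw [feedback_neg hP hlt fun h => hyN.2 (Or.inl h)]
      rfl
  exact key

theorem retract_neg (hP : P.Valid) (φ : ℝ × ℝ) : retract P (-φ) = -retract P φ := by
  have h1 := hP.R₂_pos
  have h2 := pi_pos
  have aux : ∀ b z : ℝ, 0 < b → max (-b) (min b (-z)) = -max (-b) (min b z) := by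
    intro b z hb
    grind
  simp only [retract, Prod.fst_neg, Prod.snd_neg, aux _ _ h1, aux _ _ h2, Prod.neg_mk]

theorem retract_fst (φ : ℝ × ℝ) : (retract P φ).1 = max (-P.R₂) (min P.R₂ φ.1) := rfl

theorem retract_snd (φ : ℝ × ℝ) : (retract P φ).2 = max (-π) (min π φ.2) := rfl

theorem retract_of_mem {φ : ℝ × ℝ} (h1 : |φ.1| ≤ P.R₂) (h2 : |φ.2| ≤ π) : retract P φ = φ := by
  have h1 := abs_le.mp h1
  have h2 := abs_le.mp h2
  ext
  · rw [retract_fst, min_eq_right h1.2, max_eq_right h1.1]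
  · rw [retract_snd, min_eq_right h2.2, max_eq_right h2.1]

theorem continuous_roof : Continuous (roof P) := by
  unfold roof
  fun_prop

theorem filippov_feedback_mem (hP : P.Valid) (hR₂ : P.R₂ < 1 / P.κ₀ - P.vmin / P.ωmax)
    (hκ : |κ| < P.κ₀) (hw : w ∈ filippov (S P) (feedback P κ ζ) x) :
    w.1 ∈ Icc P.vmin P.vmax ∧ w.2 ∈ Icc (-P.ωmax) P.ωmax := by
  have : w ∈ Icc P.vmin P.vmax ×ˢ Icc (-P.ωmax) P.ωmax :=
    filippov_mem (isClosed_Icc.prod isClosed_Icc) ((convex_Icc _ _).prod (convex_Icc _ _))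
      (volume_exceptional hP)
      (Eventually.of_forall fun y hy hye => feedback_mem hP hR₂ hκ hy hye) hw
  exact this

theorem filippov_feedback_of_roof_lt (hP : P.Valid) (hx : roof P x.1 < x.2)
    (hw : w ∈ filippov (S P) (feedback P κ ζ) x) : w = (P.vmin, -P.ωmax) := by
  refine filippov_mem (K := {(P.vmin, -P.ωmax)}) (N := ∅) isClosed_singleton
    (convex_singleton _) measure_empty ?_ hw
  have h1 : ContinuousAt (fun y : ℝ × ℝ => roof P y.1) x :=
    (continuous_roof.comp continuous_fst).continuousAt
  filter_upwards [h1.eventually_lt continuous_snd.continuousAt hx] with y hy hyS _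
  exact feedback_of_roof_lt hP hyS hy

/-- The roof is constant beyond `±R₂`. Hence estimates above the roof are available before it is
known that trajectories stay in `𝒮`. -/
theorem roof_retract (hP : P.Valid) {φ : ℝ × ℝ} : roof P (retract P φ).1 = roof P φ.1 := by
  have h1 := hP.R₁_lt_R₂
  have h2 := hP.R₂_pos
  rw [retract_fst]
  rcases le_total φ.1 (-P.R₂) with h | h
  · rw [min_eq_right (by linarith), max_eq_left h, roof_of_nonpos hP (by linarith),
      roof_of_nonpos hP (by linarith)]
  · rcases le_total φ.1 P.R₂ with h' | h'
    · rw [min_eq_right h', max_eq_right h]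
    · rw [min_eq_left h', max_eq_right (by linarith), roof_of_ge hP h1.le,
        roof_of_ge hP (by linarith)]

theorem roof_lt_retract (hP : P.Valid) {φ : ℝ × ℝ} (h : roof P φ.1 < φ.2) :
    roof P (retract P φ).1 < (retract P φ).2 := by
  rw [roof_retract hP, retract_snd]
  exact lt_max_of_lt_right (lt_min ((roof_le hP).trans_lt
    (by linarith [hP.a_lt, pi_pos])) h)

theorem filippov_bounded (hP : P.Valid) (hR₂ : P.R₂ < 1 / P.κ₀ - P.vmin / P.ωmax)
    (hκ : |κ| < P.κ₀) (y : ℝ × ℝ) (hyS : y ∈ S P) (hye : y ∉ exceptional P) :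
    |(feedback P κ ζ y).1| ≤ max P.vmax P.ωmax ∧ |(feedback P κ ζ y).2| ≤ max P.vmax P.ωmax := by
  obtain ⟨h1, h2⟩ := feedback_mem (ζ := ζ) hP hR₂ hκ hyS hye
  refine ⟨le_max_of_le_left (abs_le.mpr ⟨?_, h1.2⟩), le_max_of_le_right (abs_le.mpr h2)⟩
  linarith [h1.1, hP.vmin_pos, hP.vmax_pos]

end Filippov

/-! ### Trajectories of a single error -/

/-- The path following error of one vehicle on the time interval `[a, b]`, for given signals
`κ` and `ζ`. -/
structure IsErrorTrajectory (P : Params) (ρ ψ κ ζ v ω : ℝ → ℝ) (a b : ℝ) : Prop where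
  ac_fst : AbsolutelyContinuousOnInterval ρ a b
  ac_snd : AbsolutelyContinuousOnInterval ψ a b
  curv : ∀ t, |κ t| < P.κ₀
  ae_mem : ∀ᵐ t : ℝ, t ∈ Icc a b → HasDerivAt ρ (v t * sin (ψ t)) t ∧
    HasDerivAt ψ (ω t - v t * turn (κ t) (ρ t, ψ t)) t ∧
    (v t, ω t) ∈ filippov (S P) (feedback P (κ t) (ζ t)) (retract P (ρ t, ψ t))

namespace IsErrorTrajectory

variable {P : Params} {ρ ψ κ ζ v ω : ℝ → ℝ} {a b : ℝ}

theorem neg (hP : P.Valid) (h : IsErrorTrajectory P ρ ψ κ ζ v ω a b) :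
    IsErrorTrajectory P (-ρ) (-ψ) (-κ) ζ v (-ω) a b where
  ac_fst := h.ac_fst.neg
  ac_snd := h.ac_snd.neg
  curv t := by rw [Pi.neg_apply, abs_neg]; exact h.curv t
  ae_mem := by
    filter_upwards [h.ae_mem] with t ht hm
    obtain ⟨h1, h2, h3⟩ := ht hm
    have e : ((-ρ) t, (-ψ) t) = -(ρ t, ψ t) := rfl
    refine ⟨?_, ?_, ?_⟩
    · convert! h1.neg using 1
      simp only [Pi.neg_apply, sin_neg, mul_neg]
    · convert! h2.neg using 1
      rw [e, Pi.neg_apply κ, turn_neg, Pi.neg_apply]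
      ring
    · rw [e, retract_neg hP]
      exact filippov_feedback_neg hP h3

theorem mono {c d : ℝ} (h : IsErrorTrajectory P ρ ψ κ ζ v ω a b) (hac : a ≤ c) (hcd : c ≤ d)
    (hdb : d ≤ b) : IsErrorTrajectory P ρ ψ κ ζ v ω c d where
  ac_fst := AbsolutelyContinuousOnInterval.mono_Icc h.ac_fst hac hcd hdb
  ac_snd := AbsolutelyContinuousOnInterval.mono_Icc h.ac_snd hac hcd hdb
  curv := h.curv
  ae_mem := by
    filter_upwards [h.ae_mem] with t ht hm
    exact ht ⟨hac.trans hm.1, hm.2.trans hdb⟩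

end IsErrorTrajectory

end UAV

namespace UAV

/-! ### Forward invariance -/

theorem abs_turn_le_abs_cos {κ κ₀ ρ ψ R : ℝ} (hκ : |κ| < κ₀) (hρ : |ρ| ≤ R) (hR : κ₀ * R < 1) :
    |turn κ (ρ, ψ)| ≤ κ₀ * |cos ψ| / (1 - κ₀ * R) := by
  have h1 := (abs_le.mp (abs_mul_le_of_abs_lt hκ hρ)).2
  have h0 := one_sub_mul_pos hκ hρ hR
  simp only [turn]
  rw [abs_div, abs_mul, abs_of_pos h0]
  have hk0 : 0 ≤ κ₀ := (abs_nonneg _).trans hκ.le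
  exact div_le_div₀ (by positivity) (mul_le_mul_of_nonneg_right hκ.le (abs_nonneg _))
    (by linarith) (by linarith)

/-- This makes a right turn at minimal speed lower `a ρ + R₁ ψ` at rate at least `R₁ α`. The factor
`1 / (1 - κ₀ R₁)` from the turn bound is absorbed by `v_min / (1 - κ₀ R₁) ≤ v_m`; then
Cauchy–Schwarz and the first selection constraint apply. -/
theorem Params.Valid.diag_rate {P : Params} (hP : P.Valid) {κ ρ ψ : ℝ} (hκ : |κ| < P.κ₀)
    (hρ : |ρ| ≤ P.R₁) :
    P.vmin * (P.a * sin ψ - P.R₁ * turn κ (ρ, ψ)) ≤ P.R₁ * (P.ωmax - P.α) := by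
  have hR := hP.R₁_pos
  have hq : 0 < 1 - P.κ₀ * P.R₁ := by linarith [hP.κ₀_mul_R₁_lt]
  have h1 := abs_turn_le_abs_cos (ψ := ψ) hκ hρ hP.κ₀_mul_R₁_lt
  have h2 : P.a * |sin ψ| + P.R₁ * P.κ₀ * |cos ψ| ≤ √(P.a ^ 2 + (P.R₁ * P.κ₀) ^ 2) := by
    apply Real.le_sqrt_of_sq_le
    have := sin_sq_add_cos_sq ψ
    rw [← sq_abs (sin ψ), ← sq_abs (cos ψ)] at this
    nlinarith [sq_nonneg (P.a * |cos ψ| - P.R₁ * P.κ₀ * |sin ψ|)]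
  have h3 : P.a * sin ψ - P.R₁ * turn κ (ρ, ψ) ≤
      (P.a * |sin ψ| + P.R₁ * P.κ₀ * |cos ψ|) / (1 - P.κ₀ * P.R₁) := by
    have e1 : -turn κ (ρ, ψ) ≤ P.κ₀ * |cos ψ| / (1 - P.κ₀ * P.R₁) := (neg_le_abs _).trans h1
    have e2 : P.a * sin ψ ≤ P.a * |sin ψ| / (1 - P.κ₀ * P.R₁) := by
      rw [le_div_iff₀ hq]
      have : P.a * sin ψ ≤ P.a * |sin ψ| := mul_le_mul_of_nonneg_left (le_abs_self _) hP.a_pos.le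
      have h0 : 0 ≤ P.a * |sin ψ| := mul_nonneg hP.a_pos.le (abs_nonneg _)
      have hk : 0 < P.κ₀ * P.R₁ := mul_pos hP.κ₀_pos hR
      rcases le_total 0 (sin ψ) with h | h
      · nlinarith [mul_nonneg hP.a_pos.le h]
      · have : P.a * sin ψ * (1 - P.κ₀ * P.R₁) ≤ 0 :=
          mul_nonpos_of_nonpos_of_nonneg (mul_nonpos_of_nonneg_of_nonpos hP.a_pos.le h) hq.le
        linarith
    have e3 := mul_le_mul_of_nonneg_left e1 hR.le
    have e4 : (P.a * |sin ψ| + P.R₁ * P.κ₀ * |cos ψ|) / (1 - P.κ₀ * P.R₁)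
      = P.a * |sin ψ| / (1 - P.κ₀ * P.R₁) + P.R₁ * (P.κ₀ * |cos ψ| / (1 - P.κ₀ * P.R₁)) := by
      field_simp
    rw [e4]
    linarith
  have h5 : 0 ≤ P.a * |sin ψ| + P.R₁ * P.κ₀ * |cos ψ| := by
    have := hP.a_pos
    have := hP.κ₀_pos
    positivity
  calc P.vmin * (P.a * sin ψ - P.R₁ * turn κ (ρ, ψ))
      ≤ P.vmin * ((P.a * |sin ψ| + P.R₁ * P.κ₀ * |cos ψ|) / (1 - P.κ₀ * P.R₁)) :=
        mul_le_mul_of_nonneg_left h3 hP.vmin_pos.le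
    _ = P.vmin / (1 - P.κ₀ * P.R₁) * (P.a * |sin ψ| + P.R₁ * P.κ₀ * |cos ψ|) := by ring
    _ ≤ P.vm * (P.a * |sin ψ| + P.R₁ * P.κ₀ * |cos ψ|) := by
        refine mul_le_mul_of_nonneg_right ?_ h5
        rw [div_le_iff₀ hq]
        linarith [hP.vmin_lt_vm_mul]
    _ ≤ P.vm * √(P.a ^ 2 + (P.R₁ * P.κ₀) ^ 2) := mul_le_mul_of_nonneg_left h2 hP.vm_pos.le
    _ ≤ _ := hP.vm_mul_sqrt_le

/-- The rate at which errors approach the roof from above. -/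
noncomputable def Params.fall (P : Params) (R : ℝ) : ℝ :=
  min P.α (P.ωmax - P.vmin * (P.κ₀ / (1 - P.κ₀ * R)))

namespace IsErrorTrajectory

variable {P : Params} {ρ ψ κ ζ v ω : ℝ → ℝ} {a b R : ℝ}

theorem ae_speed (h : IsErrorTrajectory P ρ ψ κ ζ v ω a b) (hP : P.Valid)
    (hR₂ : P.R₂ < 1 / P.κ₀ - P.vmin / P.ωmax) :
    ∀ᵐ t : ℝ, t ∈ Icc a b → v t ∈ Icc P.vmin P.vmax ∧ ω t ∈ Icc (-P.ωmax) P.ωmax := by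
  filter_upwards [h.ae_mem] with t ht hm
  exact filippov_feedback_mem hP hR₂ (h.curv t) (ht hm).2.2

/-- Above the roof, the motion is a turn to the right at minimal speed. -/
theorem ae_of_roof_lt (h : IsErrorTrajectory P ρ ψ κ ζ v ω a b) (hP : P.Valid) :
    ∀ᵐ t : ℝ, t ∈ Icc a b → roof P (ρ t) < ψ t → HasDerivAt ρ (P.vmin * sin (ψ t)) t ∧
      HasDerivAt ψ (-P.ωmax - P.vmin * turn (κ t) (ρ t, ψ t)) t := by
  filter_upwards [h.ae_mem] with t ht hm hr
  obtain ⟨h1, h2, h3⟩ := ht hm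
  have := filippov_feedback_of_roof_lt hP (roof_lt_retract hP (φ := (ρ t, ψ t)) hr) h3
  have e1 : v t = P.vmin := congrArg Prod.fst this
  have e2 : ω t = -P.ωmax := congrArg Prod.snd this
  rw [e1] at h1 h2
  rw [e2] at h2
  exact ⟨h1, h2⟩

theorem neg_turn_bound (hP : P.Valid) (hR : R < 1 / P.κ₀ - P.vmin / P.ωmax) {k x y : ℝ}
    (hk : |k| < P.κ₀) (hx : |x| ≤ R) :
    -P.ωmax - P.vmin * turn k (x, y) ≤ -P.fall R := by
  have h1 := neg_le_abs (turn k (x, y)) |>.trans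
    (abs_turn_le hk hx (Params.κ₀_mul_R₂_lt hP hR).1)
  have h2 := mul_le_mul_of_nonneg_left h1 hP.vmin_pos.le
  have h3 : P.fall R ≤ P.ωmax - P.vmin * (P.κ₀ / (1 - P.κ₀ * R)) := min_le_right _ _
  linarith

theorem fall_pos (hP : P.Valid) (hR : R < 1 / P.κ₀ - P.vmin / P.ωmax) : 0 < P.fall R :=
  lt_min hP.α_pos (by linarith [(Params.κ₀_mul_R₂_lt hP hR).2])

/-- The roof never exceeds `a`, so the heading falls whenever it is above `a`. -/
theorem snd_le (h : IsErrorTrajectory P ρ ψ κ ζ v ω a b) (hP : P.Valid)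
    (hR : R < 1 / P.κ₀ - P.vmin / P.ωmax) (hρ : ∀ t ∈ Icc a b, |ρ t| ≤ R) {t : ℝ}
    (ht : t ∈ Icc a b) : ψ t ≤ max P.a (ψ a) := by
  have key := le_max_of_ae_hasDerivAt (h := P.a) (d := 0) le_rfl h.ac_snd ?_ ht
  · simpa using key
  · filter_upwards [h.ae_of_roof_lt hP] with s hs hm hlt f' hf'
    have h2 := (hs hm ((roof_le hP).trans_lt hlt)).2
    rw [hf'.unique h2]
    have := neg_turn_bound (y := ψ s) hP hR (h.curv s) (hρ s hm)
    linarith [fall_pos hP hR]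

theorem ac_roof (h : IsErrorTrajectory P ρ ψ κ ζ v ω a b) :
    AbsolutelyContinuousOnInterval (fun t => ψ t - roof P (ρ t)) a b := by
  have h1 : AbsolutelyContinuousOnInterval (fun t => P.a * (1 - ρ t / P.R₁)) a b := by
    have e : (fun t => P.a * (1 - ρ t / P.R₁)) = fun t => P.a * (1 - P.R₁⁻¹ * ρ t) := by
      ext t; ring
    rw [e]
    exact ((absolutelyContinuousOnInterval_const 1 a b).sub
      (h.ac_fst.const_mul P.R₁⁻¹)).const_mul P.a
  exact h.ac_snd.sub (absolutelyContinuousOnInterval_max (absolutelyContinuousOnInterval_const 0 _ _)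
    (absolutelyContinuousOnInterval_min (absolutelyContinuousOnInterval_const _ _ _) h1))

/-- Each linear branch of the roof is approached from above at rate `fall`: the flat ones by the
turning bound, the oblique one by `diag_rate`. So the roof is reached in bounded time and never
crossed upwards. -/
theorem sub_roof_le (h : IsErrorTrajectory P ρ ψ κ ζ v ω a b) (hP : P.Valid)
    (hR : R < 1 / P.κ₀ - P.vmin / P.ωmax) (hρ : ∀ t ∈ Icc a b, |ρ t| ≤ R) {t : ℝ}
    (ht : t ∈ Icc a b) :
    ψ t - roof P (ρ t) ≤ max 0 (ψ a - roof P (ρ a) - P.fall R * (t - a)) := by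
  refine le_max_of_ae_hasDerivAt (f := fun t => ψ t - roof P (ρ t)) (fall_pos hP hR).le
    h.ac_roof ?_ ht
  filter_upwards [h.ae_of_roof_lt hP] with s hs hm hlt f' hf'
  have hlt' : roof P (ρ s) < ψ s := by linarith
  obtain ⟨h1, h2⟩ := hs hm hlt'
  have hb := neg_turn_bound (y := ψ s) hP hR (h.curv s) (hρ s hm)
  have hR1 := hP.R₁_pos
  have ha := hP.a_pos
  let g : Fin 3 → ℝ → ℝ := ![ψ, fun s => ψ s - P.a, fun s => ψ s - P.a * (1 - ρ s / P.R₁)]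
  let g' : Fin 3 → ℝ := ![-P.ωmax - P.vmin * turn (κ s) (ρ s, ψ s),
    -P.ωmax - P.vmin * turn (κ s) (ρ s, ψ s),
    -P.ωmax - P.vmin * turn (κ s) (ρ s, ψ s) - P.a * (0 - P.vmin * sin (ψ s) / P.R₁)]
  have hg : ∀ i, HasDerivAt (g i) (g' i) s := by
    intro i
    fin_cases i
    · exact h2
    · exact h2.sub_const _
    · exact h2.sub ((((hasDerivAt_const s (1 : ℝ)).sub (h1.div_const P.R₁))).const_mul P.a)
  obtain ⟨i, hi, hi'⟩ := exists_hasDerivAt_eq_of_selection hf' hg (by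
    intro x
    simp only [roof]
    rcases max_choice 0 (min P.a (P.a * (1 - ρ x / P.R₁))) with e | e
    · exact ⟨0, by rw [e]; simp [g]⟩
    · rcases min_choice P.a (P.a * (1 - ρ x / P.R₁)) with e' | e'
      · exact ⟨1, by rw [e, e']; simp [g]⟩
      · exact ⟨2, by rw [e, e']; simp [g]⟩)
  rw [hi']
  fin_cases i
  · exact hb
  · exact hb
  -- Since the roof takes values in `[0, a]`, an active oblique branch forces `0 ≤ ρ ≤ R₁`, where
  -- `diag_rate` is available.
  · have e : roof P (ρ s) = P.a * (1 - ρ s / P.R₁) := by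
      have : ψ s - roof P (ρ s) = ψ s - P.a * (1 - ρ s / P.R₁) := hi
      linarith
    have e1 : 0 ≤ ρ s / P.R₁ := by
      have := roof_le hP (ρ := ρ s)
      nlinarith
    have e2 : ρ s / P.R₁ ≤ 1 := by
      have := roof_nonneg (P := P) (ρ := ρ s)
      nlinarith
    have e3 : 0 ≤ ρ s := by
      rw [le_div_iff₀ hR1] at e1
      linarith
    have e4 : ρ s ≤ P.R₁ := by
      rw [div_le_one hR1] at e2
      exact e2
    have hd := hP.diag_rate (ψ := ψ s) (h.curv s) (abs_le.mpr ⟨by linarith, e4⟩)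
    have hf : P.fall R ≤ P.α := min_le_left _ _
    change -P.ωmax - P.vmin * turn (κ s) (ρ s, ψ s) - P.a * (0 - P.vmin * sin (ψ s) / P.R₁)
      ≤ -P.fall R
    have e5 : -P.ωmax - P.vmin * turn (κ s) (ρ s, ψ s) - P.a * (0 - P.vmin * sin (ψ s) / P.R₁)
      = (P.vmin * (P.a * sin (ψ s) - P.R₁ * turn (κ s) (ρ s, ψ s))) / P.R₁ - P.ωmax := by
      field_simp
      ring
    rw [e5]
    have : P.vmin * (P.a * sin (ψ s) - P.R₁ * turn (κ s) (ρ s, ψ s)) / P.R₁ ≤ P.ωmax - P.α := by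
      rw [div_le_iff₀ hR1]
      linarith
    linarith

/-- Below the roof, the distance to the path is not enlarged beyond `R₂`. -/
theorem fst_le_of_le_roof (h : IsErrorTrajectory P ρ ψ κ ζ v ω a b) (hP : P.Valid)
    (hR₂ : P.R₂ < 1 / P.κ₀ - P.vmin / P.ωmax)
    (hw : ∀ t ∈ Icc a b, ψ t ≤ roof P (ρ t)) (hψ : ∀ t ∈ Icc a b, -π ≤ ψ t)
    (h0 : ρ a ≤ P.R₂) {t : ℝ} (ht : t ∈ Icc a b) : ρ t ≤ P.R₂ := by
  have key := le_max_of_ae_hasDerivAt (h := P.R₂) (d := 0) le_rfl h.ac_fst ?_ ht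
  · simpa [h0] using key
  · filter_upwards [h.ae_mem, h.ae_speed hP hR₂] with s hs hv hm hlt f' hf'
    rw [hf'.unique (hs hm).1]
    have h1 := hw s hm
    rw [roof_of_ge hP (by linarith [hP.R₁_lt_R₂])] at h1
    have h2 := sin_nonpos_of_nonpos_of_neg_pi_le h1 (hψ s hm)
    have h3 := (hv hm).1.1
    nlinarith [hP.vmin_pos]

end IsErrorTrajectory

end UAV

namespace UAV

/-! ### First integrals of the comparison systems -/

/-- A first integral of the right turn at minimal speed along a path of curvature `κ₀`. -/
noncomputable def integral₁ (P : Params) (ρ ψ : ℝ) : ℝ :=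
  (1 / P.κ₀ - ρ) ^ 2 + 2 * (P.vmin / P.ωmax) * ((1 / P.κ₀ - ρ) * cos ψ)

/-- A first integral of the right turn at minimal speed along a path of curvature `-κ₀`. -/
noncomputable def integral₂ (P : Params) (ρ ψ : ℝ) : ℝ :=
  (1 / P.κ₀ + ρ) ^ 2 - 2 * (P.vmin / P.ωmax) * ((1 / P.κ₀ + ρ) * cos ψ)

/-- The errors from which a right turn at minimal speed does not lead beyond `R₂`. -/
def Safe (P : Params) (ρ ψ : ℝ) : Prop :=
  (ψ ≤ π / 2 ∧ integral₂ P ρ ψ ≤ integral₂ P P.R₂ 0) ∨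
  (π / 2 ≤ ψ ∧ ∃ m ∈ Icc (-P.R₂) P.R₂, integral₁ P m (π / 2) ≤ integral₁ P ρ ψ ∧
    integral₂ P m (π / 2) ≤ integral₂ P P.R₂ 0)

section Integrals

variable {P : Params} {r p : ℝ → ℝ} {s : Set ℝ} {t k : ℝ}

/-- For `k = κ₀` the path is a circle of radius `1 / κ₀` and the vehicle moves on a circle of radius
`v_min / ωmax`. By the law of cosines `integral₁` is the squared distance of the two centres minus
the squared turning radius, hence constant. For other `k` the factor `k / κ₀ - 1` controls the sign.
-/
theorem hasDerivWithinAt_integral₁ (hP : P.Valid) (hk : 1 - k * r t ≠ 0)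
    (hr : HasDerivWithinAt r (P.vmin * sin (p t)) s t)
    (hp : HasDerivWithinAt p (-P.ωmax - P.vmin * turn k (r t, p t)) s t) :
    HasDerivWithinAt (fun t => integral₁ P (r t) (p t))
      (2 * (P.vmin / P.ωmax) * P.vmin * sin (p t) * cos (p t) * ((k / P.κ₀ - 1) / (1 - k * r t)))
      s t := by
  have hω := hP.ωmax_pos.ne'
  have hκ := hP.κ₀_pos.ne'
  have h1 : HasDerivWithinAt (fun t => 1 / P.κ₀ - r t) (0 - P.vmin * sin (p t)) s t :=
    (hasDerivWithinAt_const _ _ _).sub hr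
  have h2 := (h1.pow 2).add ((h1.mul hp.cos).const_mul (2 * (P.vmin / P.ωmax)))
  refine h2.congr_deriv ?_
  simp only [turn, Nat.cast_ofNat, Nat.add_one_sub_one, pow_one]
  generalize r t = x at hk ⊢
  obtain ⟨q, hq⟩ : ∃ q, q = 1 - k * x := ⟨_, rfl⟩
  rw [← hq] at hk ⊢
  field_simp
  rw [hq]
  ring

theorem hasDerivWithinAt_integral₂ (hP : P.Valid) (hk : 1 - k * r t ≠ 0)
    (hr : HasDerivWithinAt r (P.vmin * sin (p t)) s t)
    (hp : HasDerivWithinAt p (-P.ωmax - P.vmin * turn k (r t, p t)) s t) :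
    HasDerivWithinAt (fun t => integral₂ P (r t) (p t))
      (-(2 * (P.vmin / P.ωmax) * P.vmin * sin (p t) * cos (p t) *
        ((k / P.κ₀ + 1) / (1 - k * r t)))) s t := by
  have hω := hP.ωmax_pos.ne'
  have hκ := hP.κ₀_pos.ne'
  have h1 : HasDerivWithinAt (fun t => 1 / P.κ₀ + r t) (0 + P.vmin * sin (p t)) s t :=
    (hasDerivWithinAt_const _ _ _).add hr
  have h2 := (h1.pow 2).sub ((h1.mul hp.cos).const_mul (2 * (P.vmin / P.ωmax)))
  refine h2.congr_deriv ?_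
  simp only [turn, Nat.cast_ofNat, Nat.add_one_sub_one, pow_one]
  generalize r t = x at hk ⊢
  obtain ⟨q, hq⟩ : ∃ q, q = 1 - k * x := ⟨_, rfl⟩
  rw [← hq] at hk ⊢
  field_simp
  rw [hq]
  ring

theorem radius_lt {R ρ : ℝ} (hR : R < 1 / P.κ₀ - P.vmin / P.ωmax)
    (h : |ρ| ≤ R) : P.vmin / P.ωmax < 1 / P.κ₀ + ρ ∧ P.vmin / P.ωmax < 1 / P.κ₀ - ρ := by
  have := abs_le.mp h
  constructor <;> linarith

theorem radius_pos (hP : P.Valid) : 0 < P.vmin / P.ωmax := div_pos hP.vmin_pos hP.ωmax_pos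

/-- Replacing `cos ψ` by `1` only lowers the integral, and `t ^ 2 - 2 c t` increases for `t ≥ c`,
where `c = v_min / ωmax`. -/
theorem le_R₂_of_integral₂_le (hP : P.Valid) (hR₂ : P.R₂ < 1 / P.κ₀ - P.vmin / P.ωmax)
    {R ρ ψ : ℝ} (hR : R < 1 / P.κ₀ - P.vmin / P.ωmax) (hρ : |ρ| ≤ R)
    (h : integral₂ P ρ ψ ≤ integral₂ P P.R₂ 0) : ρ ≤ P.R₂ := by
  have h1 := (radius_lt hR hρ).1
  have h2 := (radius_lt hR₂ (abs_of_pos hP.R₂_pos).le).1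
  have h3 := radius_pos hP
  simp only [integral₂, cos_zero, mul_one] at h
  set c := P.vmin / P.ωmax
  set D := 1 / P.κ₀ + ρ with hD
  set E := 1 / P.κ₀ + P.R₂ with hE
  have h4 : D * cos ψ ≤ D := by nlinarith [cos_le_one ψ]
  have h5 : (D - E) * (D + E - 2 * c) ≤ 0 := by nlinarith
  have h6 : D ≤ E := by
    by_contra hcon
    have : 0 < (D - E) * (D + E - 2 * c) := mul_pos (by linarith) (by linarith)
    linarith
  linarith

theorem le_of_integral₁_le (hP : P.Valid) {R m ρ ψ : ℝ} (hR : R < 1 / P.κ₀ - P.vmin / P.ωmax)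
    (hρ : |ρ| ≤ R) (hm : |m| ≤ P.R₂) (hR₂ : P.R₂ < 1 / P.κ₀ - P.vmin / P.ωmax) (hc : cos ψ ≤ 0)
    (h : integral₁ P m (π / 2) ≤ integral₁ P ρ ψ) : ρ ≤ m := by
  have h1 := (radius_lt hR hρ).2
  have h2 := (radius_lt hR₂ hm).2
  have h3 := radius_pos hP
  simp only [integral₁, cos_pi_div_two, mul_zero, add_zero] at h
  have h4 : (1 / P.κ₀ - ρ) * cos ψ ≤ 0 := mul_nonpos_of_nonneg_of_nonpos (by linarith) hc
  have h5 : (1 / P.κ₀ - m) ^ 2 ≤ (1 / P.κ₀ - ρ) ^ 2 := by nlinarith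
  have h6 := abs_le_of_sq_le_sq' h5 (by linarith)
  linarith [h6.2]

end Integrals

/-! ### Comparison above the roof and the bootstrap for `|ρ|` -/

namespace IsErrorTrajectory

variable {P : Params} {ρ ψ κ ζ v ω : ℝ → ℝ} {a b R : ℝ}

theorem continuousOn_fst (h : IsErrorTrajectory P ρ ψ κ ζ v ω a b) : ContinuousOn ρ (Icc a b) :=
  h.ac_fst.continuousOn.mono Icc_subset_uIcc

theorem continuousOn_snd (h : IsErrorTrajectory P ρ ψ κ ζ v ω a b) : ContinuousOn ψ (Icc a b) :=
  h.ac_snd.continuousOn.mono Icc_subset_uIcc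

theorem ac_integral₁ (h : IsErrorTrajectory P ρ ψ κ ζ v ω a b) :
    AbsolutelyContinuousOnInterval (fun t => integral₁ P (ρ t) (ψ t)) a b := by
  have h1 := (absolutelyContinuousOnInterval_const (1 / P.κ₀) a b).sub h.ac_fst
  have h2 := (h1.mul h1).add
    ((h1.mul (absolutelyContinuousOnInterval_cos h.ac_snd)).const_mul (2 * (P.vmin / P.ωmax)))
  convert! h2 using 1
  ext t
  simp only [integral₁, Pi.add_apply, Pi.mul_apply, Pi.sub_apply]
  ring

theorem ac_integral₂ (h : IsErrorTrajectory P ρ ψ κ ζ v ω a b) :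
    AbsolutelyContinuousOnInterval (fun t => integral₂ P (ρ t) (ψ t)) a b := by
  have h1 := (absolutelyContinuousOnInterval_const (1 / P.κ₀) a b).add h.ac_fst
  have h2 := (h1.mul h1).sub
    ((h1.mul (absolutelyContinuousOnInterval_cos h.ac_snd)).const_mul (2 * (P.vmin / P.ωmax)))
  convert! h2 using 1
  ext t
  simp only [integral₂, Pi.add_apply, Pi.mul_apply, Pi.sub_apply]
  ring

/-- For backward headings `cos ψ ≤ 0`, so a curvature below `κ₀` can only raise this integral:
curvature `κ₀` is the worst case, in which the heading comes back most slowly. For forward headings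
the worst case is `-κ₀`. -/
theorem integral₁_le (h : IsErrorTrajectory P ρ ψ κ ζ v ω a b) (hP : P.Valid)
    (hR : R < 1 / P.κ₀ - P.vmin / P.ωmax) (hρ : ∀ t ∈ Icc a b, |ρ t| ≤ R) (hab : a ≤ b)
    (hw : ∀ t ∈ Ioo a b, roof P (ρ t) < ψ t) (hψ : ∀ t ∈ Icc a b, ψ t ∈ Icc (π / 2) π) :
    integral₁ P (ρ a) (ψ a) ≤ integral₁ P (ρ b) (ψ b) := by
  have key := sub_le_of_ae_hasDerivAt_le (d := 0) hab (h.ac_integral₁).neg ?_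
  · simp only [Pi.neg_apply] at key
    linarith
  · filter_upwards [h.ae_of_roof_lt hP] with t ht hm f' hf'
    have hm' := Ioo_subset_Icc_self hm
    obtain ⟨h1, h2⟩ := ht hm' (hw t hm)
    have h0 := one_sub_mul_pos (h.curv t) (hρ t hm') (Params.κ₀_mul_R₂_lt hP hR).1
    have h3 := hasDerivWithinAt_integral₁ (s := univ) hP h0.ne' h1.hasDerivWithinAt
      h2.hasDerivWithinAt
    rw [hasDerivWithinAt_univ] at h3
    rw [hf'.unique h3.neg]
    have h4 := hψ t hm'
    have s1 : 0 ≤ sin (ψ t) :=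
      sin_nonneg_of_nonneg_of_le_pi (by linarith [h4.1, pi_pos]) h4.2
    have s2 : cos (ψ t) ≤ 0 := cos_nonpos_of_pi_div_two_le_of_le h4.1 (by linarith [h4.2, pi_pos])
    have s3 : (κ t / P.κ₀ - 1) / (1 - κ t * ρ t) ≤ 0 := by
      refine div_nonpos_of_nonpos_of_nonneg ?_ h0.le
      have := (div_lt_one hP.κ₀_pos).mpr ((abs_lt.mp (h.curv t)).2)
      linarith
    have s4 := radius_pos hP
    have s5 := hP.vmin_pos
    have s6 : 0 ≤ 2 * (P.vmin / P.ωmax) * P.vmin * sin (ψ t) := by positivity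
    have := mul_nonneg s6 (mul_nonneg_of_nonpos_of_nonpos s2 s3)
    rw [mul_assoc _ (cos (ψ t))]
    linarith

theorem integral₂_le (h : IsErrorTrajectory P ρ ψ κ ζ v ω a b) (hP : P.Valid)
    (hR : R < 1 / P.κ₀ - P.vmin / P.ωmax) (hρ : ∀ t ∈ Icc a b, |ρ t| ≤ R) (hab : a ≤ b)
    (hw : ∀ t ∈ Ioo a b, roof P (ρ t) < ψ t) (hψ : ∀ t ∈ Icc a b, ψ t ∈ Icc 0 (π / 2)) :
    integral₂ P (ρ b) (ψ b) ≤ integral₂ P (ρ a) (ψ a) := by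
  have key := sub_le_of_ae_hasDerivAt_le (d := 0) hab h.ac_integral₂ ?_
  · linarith
  · filter_upwards [h.ae_of_roof_lt hP] with t ht hm f' hf'
    have hm' := Ioo_subset_Icc_self hm
    obtain ⟨h1, h2⟩ := ht hm' (hw t hm)
    have h0 := one_sub_mul_pos (h.curv t) (hρ t hm') (Params.κ₀_mul_R₂_lt hP hR).1
    have h3 := hasDerivWithinAt_integral₂ (s := univ) hP h0.ne' h1.hasDerivWithinAt
      h2.hasDerivWithinAt
    rw [hasDerivWithinAt_univ] at h3
    rw [hf'.unique h3]
    have h4 := hψ t hm'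
    have s1 : 0 ≤ sin (ψ t) :=
      sin_nonneg_of_nonneg_of_le_pi h4.1 (by linarith [h4.2, pi_pos])
    have s2 : 0 ≤ cos (ψ t) := cos_nonneg_of_mem_Icc ⟨by linarith [h4.1, pi_pos], h4.2⟩
    have s3 : 0 ≤ (κ t / P.κ₀ + 1) / (1 - κ t * ρ t) := by
      refine div_nonneg ?_ h0.le
      have : -1 ≤ κ t / P.κ₀ := by
        rw [le_div_iff₀ hP.κ₀_pos]
        linarith [(abs_lt.mp (h.curv t)).1]
      linarith
    have s4 := radius_pos hP
    have s5 := hP.vmin_pos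
    have : 0 ≤ 2 * (P.vmin / P.ωmax) * P.vmin * sin (ψ t) * cos (ψ t) *
        ((κ t / P.κ₀ + 1) / (1 - κ t * ρ t)) := by positivity
    linarith

theorem snd_antitone (h : IsErrorTrajectory P ρ ψ κ ζ v ω a b) (hP : P.Valid)
    (hR : R < 1 / P.κ₀ - P.vmin / P.ωmax) (hρ : ∀ t ∈ Icc a b, |ρ t| ≤ R)
    (hw : ∀ t ∈ Ioo a b, roof P (ρ t) < ψ t) : AntitoneOn ψ (Icc a b) := by
  intro s hs t ht hst
  have key := sub_le_of_ae_hasDerivAt_le (d := 0) hst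
    (AbsolutelyContinuousOnInterval.mono_Icc h.ac_snd hs.1 hst ht.2) ?_
  · linarith
  · filter_upwards [h.ae_of_roof_lt hP] with x hx hm f' hf'
    have hm' : x ∈ Ioo a b := ⟨hs.1.trans_lt hm.1, hm.2.trans_le ht.2⟩
    rw [hf'.unique (hx (Ioo_subset_Icc_self hm') (hw x hm')).2]
    have := neg_turn_bound (y := ψ x) hP hR (h.curv x) (hρ x (Ioo_subset_Icc_self hm'))
    linarith [fall_pos hP hR]

/-- Above the roof, safe errors do not exceed `R₂`. -/
theorem fst_le_of_roof_lt (h : IsErrorTrajectory P ρ ψ κ ζ v ω a b) (hP : P.Valid)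
    (hR₂ : P.R₂ < 1 / P.κ₀ - P.vmin / P.ωmax)
    (hR : R < 1 / P.κ₀ - P.vmin / P.ωmax) (hρ : ∀ t ∈ Icc a b, |ρ t| ≤ R) (hab : a ≤ b)
    (hw : ∀ t ∈ Ioo a b, roof P (ρ t) < ψ t) (hψa : ψ a ≤ π) (hψb : 0 ≤ ψ b)
    (hsafe : Safe P (ρ a) (ψ a)) : ρ b ≤ P.R₂ := by
  have hanti := h.snd_antitone hP hR hρ hw
  have hbd : ∀ t ∈ Icc a b, ψ t ∈ Icc 0 π := fun t ht =>
    ⟨hψb.trans (hanti ht (right_mem_Icc.mpr hab) ht.2),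
      (hanti (left_mem_Icc.mpr hab) ht ht.1).trans hψa⟩
  rcases hsafe with ⟨h1, h2⟩ | ⟨h1, m, hm, h2, h3⟩
  · refine le_R₂_of_integral₂_le hP hR₂ hR (hρ b (right_mem_Icc.mpr hab)) (ψ := ψ b)
      (le_trans ?_ h2)
    exact h.integral₂_le hP hR hρ hab hw fun t ht =>
      ⟨(hbd t ht).1, (hanti (left_mem_Icc.mpr hab) ht ht.1).trans h1⟩
  · rcases le_total (π / 2) (ψ b) with hb | hb
    · refine le_trans ?_ hm.2
      refine le_of_integral₁_le hP hR (hρ b (right_mem_Icc.mpr hab)) (abs_le.mpr hm) hR₂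
        (cos_nonpos_of_pi_div_two_le_of_le hb
          (by linarith [(hbd b (right_mem_Icc.mpr hab)).2, pi_pos])) (h2.trans ?_)
      exact h.integral₁_le hP hR hρ hab hw fun t ht =>
        ⟨hb.trans (hanti ht (right_mem_Icc.mpr hab) ht.2), (hbd t ht).2⟩
    -- Each integral is monotone only on its own half of the headings: the first bounds `ρ` by `m`
    -- at the instant when `ψ = π / 2`, and the second takes over from there.
    · obtain ⟨c, hc, hψc⟩ := intermediate_value_Icc' hab h.continuousOn_snd ⟨hb, h1⟩
      have e1 := (h.mono le_rfl hc.1 hc.2).integral₁_le hP hR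
        (fun t ht => hρ t ⟨ht.1, ht.2.trans hc.2⟩) hc.1
        (fun t ht => hw t ⟨ht.1, ht.2.trans_le hc.2⟩)
        (fun t ht => ⟨hψc ▸ hanti ⟨ht.1, ht.2.trans hc.2⟩ hc ht.2,
          (hbd t ⟨ht.1, ht.2.trans hc.2⟩).2⟩)
      have e2 : ρ c ≤ m := by
        refine le_of_integral₁_le (ψ := ψ c) hP hR (hρ c hc) (abs_le.mpr hm) hR₂ ?_ (h2.trans e1)
        rw [hψc, cos_pi_div_two]
      have e3 := (h.mono hc.1 hc.2 le_rfl).integral₂_le hP hR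
        (fun t ht => hρ t ⟨hc.1.trans ht.1, ht.2⟩) hc.2
        (fun t ht => hw t ⟨hc.1.trans_lt ht.1, ht.2⟩)
        (fun t ht => ⟨(hbd t ⟨hc.1.trans ht.1, ht.2⟩).1,
          hψc ▸ hanti hc ⟨hc.1.trans ht.1, ht.2⟩ ht.1⟩)
      refine le_R₂_of_integral₂_le hP hR₂ hR (hρ b (right_mem_Icc.mpr hab)) (ψ := ψ b)
        (e3.trans (le_trans ?_ h3))
      rw [hψc]
      have e4 := (radius_lt hR (hρ c hc)).1
      have e5 := radius_pos hP
      simp only [integral₂, cos_pi_div_two, mul_zero, sub_zero]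
      exact pow_le_pow_left₀ (by linarith) (by linarith) 2

/-- From an error that is below the roof or safe, the distance does not exceed `R₂`. -/
theorem fst_le (h : IsErrorTrajectory P ρ ψ κ ζ v ω a b) (hP : P.Valid)
    (hR₂ : P.R₂ < 1 / P.κ₀ - P.vmin / P.ωmax)
    (hR : R < 1 / P.κ₀ - P.vmin / P.ωmax) (hρ : ∀ t ∈ Icc a b, |ρ t| ≤ R) (hab : a ≤ b)
    (hψ : ∀ t ∈ Icc a b, |ψ t| ≤ π) (h0 : ρ a ≤ P.R₂)
    (hsafe : ψ a ≤ roof P (ρ a) ∨ Safe P (ρ a) (ψ a)) : ρ b ≤ P.R₂ := by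
  -- Once below the roof, the error stays below it, since the initial excess is nonpositive; then
  -- `ρ` cannot pass `R₂`.
  have hafter : ∀ c ∈ Icc a b, ψ c ≤ roof P (ρ c) → ρ c ≤ P.R₂ → ρ b ≤ P.R₂ := by
    intro c hc hcr hcρ
    have hc' := h.mono hc.1 hc.2 le_rfl
    have hsub : Icc c b ⊆ Icc a b := Icc_subset_Icc_left hc.1
    refine hc'.fst_le_of_le_roof hP hR₂ (fun t ht => ?_)
      (fun t ht => (abs_le.mp (hψ t (hsub ht))).1) hcρ (right_mem_Icc.mpr hc.2)
    have := hc'.sub_roof_le hP hR (fun t ht => hρ t (hsub ht)) ht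
    have e : ψ c - roof P (ρ c) - P.fall R * (t - c) ≤ 0 := by
      have := mul_nonneg (fall_pos hP hR).le (sub_nonneg.mpr ht.1)
      linarith
    rw [max_eq_left e] at this
    linarith
  rcases hsafe with hs | hs
  · exact hafter a (left_mem_Icc.mpr hab) hs h0
  by_cases hall : ∀ t ∈ Icc a b, roof P (ρ t) < ψ t
  · exact h.fst_le_of_roof_lt hP hR₂ hR hρ hab (fun t ht => hall t (Ioo_subset_Icc_self ht))
      (abs_le.mp (hψ a (left_mem_Icc.mpr hab))).2
      (roof_nonneg.trans (hall b (right_mem_Icc.mpr hab)).le) hs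
  · push Not at hall
    obtain ⟨c₀, hc₀, hc₀r⟩ := hall
    let A : Set ℝ := Icc a b ∩ (fun t => ψ t - roof P (ρ t)) ⁻¹' Iic 0
    have hcont : ContinuousOn (fun t => ψ t - roof P (ρ t)) (Icc a b) :=
      h.continuousOn_snd.sub (continuous_roof.comp_continuousOn h.continuousOn_fst)
    have hAc : IsClosed A := hcont.preimage_isClosed_of_isClosed isClosed_Icc isClosed_Iic
    have hAne : A.Nonempty := ⟨c₀, hc₀, by simpa using hc₀r⟩
    have hAb : BddBelow A := ⟨a, fun x hx => hx.1.1⟩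
    obtain ⟨hc, hcr⟩ := hAc.csInf_mem hAne hAb
    set c := sInf A
    have hcr' : ψ c ≤ roof P (ρ c) := by simpa using hcr
    have hbefore : ∀ t ∈ Ico a c, roof P (ρ t) < ψ t := by
      intro t ht
      by_contra hcon
      have : c ≤ t := csInf_le hAb ⟨⟨ht.1, ht.2.le.trans hc.2⟩, by simpa using hcon⟩
      linarith [ht.2]
    refine hafter c hc hcr' ?_
    rcases hc.1.eq_or_lt with hac | hac
    · rw [← hac]; exact h0
    have hψc : 0 ≤ ψ c := by
      have hcw : Tendsto ψ (𝓝[Ico a c] c) (𝓝 (ψ c)) :=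
        ((h.continuousOn_snd c hc).mono (fun t ht => ⟨ht.1, ht.2.le.trans hc.2⟩)).tendsto
      have : (𝓝[Ico a c] c).NeBot := by
        rw [← mem_closure_iff_nhdsWithin_neBot, closure_Ico hac.ne]
        exact right_mem_Icc.mpr hac.le
      exact ge_of_tendsto hcw (eventually_mem_nhdsWithin.mono fun t ht =>
        roof_nonneg.trans (hbefore t ht).le)
    exact (h.mono le_rfl hc.1 hc.2).fst_le_of_roof_lt hP hR₂ hR
      (fun t ht => hρ t ⟨ht.1, ht.2.trans hc.2⟩) hc.1
      (fun t ht => hbefore t ⟨ht.1.le, ht.2⟩)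
      (abs_le.mp (hψ a (left_mem_Icc.mpr hab))).2 hψc hs

/-- The errors stay in the region on which the control law is defined. -/
theorem abs_fst_le (h : IsErrorTrajectory P ρ ψ κ ζ v ω a b) (hP : P.Valid)
    (hR₂ : P.R₂ < 1 / P.κ₀ - P.vmin / P.ωmax) (hab : a ≤ b)
    (hρ : |ρ a| ≤ P.R₂) (hψ : |ψ a| ≤ π)
    (hup : ψ a ≤ roof P (ρ a) ∨ Safe P (ρ a) (ψ a))
    (hdown : -ψ a ≤ roof P (-ρ a) ∨ Safe P (-ρ a) (-ψ a)) : |ρ b| ≤ P.R₂ := by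
  -- Bootstrap: while `|ρ| ≤ R`, the estimates yield the better bound `R₂ < R`, so by continuity
  -- `|ρ|` never reaches `R`.
  obtain ⟨R, hR1, hR⟩ := exists_between hR₂
  have main : ∀ c ∈ Icc a b, (∀ t ∈ Icc a c, |ρ t| ≤ R) → |ρ c| ≤ P.R₂ := by
    intro c hc hρR
    have h' := h.mono le_rfl hc.1 hc.2
    have hn := h'.neg hP
    have hρR' : ∀ t ∈ Icc a c, |(-ρ) t| ≤ R := fun t ht => by
      rw [Pi.neg_apply, abs_neg]; exact hρR t ht
    have hψa := abs_le.mp hψ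
    have ha := hP.a_lt
    have hpi := pi_pos
    have hψ1 : ∀ t ∈ Icc a c, |ψ t| ≤ π := by
      intro t ht
      have e1 := (h'.snd_le hP hR hρR ht).trans (max_le (by linarith) hψa.2)
      have e2 := (hn.snd_le hP hR hρR' ht).trans (max_le (by linarith)
        (by rw [Pi.neg_apply]; linarith : (-ψ) a ≤ π))
      rw [Pi.neg_apply] at e2
      exact abs_le.mpr ⟨by linarith, e1⟩
    have e1 := h'.fst_le hP hR₂ hR hρR hc.1 hψ1 (abs_le.mp hρ).2 hup
    have e2 := hn.fst_le hP hR₂ hR hρR' hc.1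
      (fun t ht => by rw [Pi.neg_apply, abs_neg]; exact hψ1 t ht)
      (by rw [Pi.neg_apply]; linarith [(abs_le.mp hρ).1]) hdown
    rw [Pi.neg_apply] at e2
    exact abs_le.mpr ⟨by linarith, e1⟩
  by_cases hall : ∀ t ∈ Icc a b, |ρ t| ≤ R
  · exact main b (right_mem_Icc.mpr hab) hall
  exfalso
  push Not at hall
  obtain ⟨t₁, ht₁, hlt⟩ := hall
  have hcont : ContinuousOn (fun t => |ρ t|) (Icc a b) := h.continuousOn_fst.abs
  let A : Set ℝ := Icc a b ∩ (fun t => |ρ t|) ⁻¹' Ici R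
  have hAc : IsClosed A := hcont.preimage_isClosed_of_isClosed isClosed_Icc isClosed_Ici
  have hAb : BddBelow A := ⟨a, fun x hx => hx.1.1⟩
  obtain ⟨hc, hcR⟩ := hAc.csInf_mem ⟨t₁, ht₁, hlt.le⟩ hAb
  set c := sInf A
  have hcR' : R ≤ |ρ c| := hcR
  have hbefore : ∀ t ∈ Ico a c, |ρ t| < R := by
    intro t ht
    by_contra hcon
    have : c ≤ t := csInf_le hAb ⟨⟨ht.1, ht.2.le.trans hc.2⟩, not_lt.mp hcon⟩
    linarith [ht.2]
  have hac : a < c := by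
    rcases hc.1.eq_or_lt with e | e
    · rw [← e] at hcR'
      linarith
    · exact e
  have : |ρ c| ≤ P.R₂ := by
    have hcw : Tendsto (fun t => |ρ t|) (𝓝[Ico a c] c) (𝓝 (|ρ c|)) :=
      ((hcont c hc).mono (fun t ht => ⟨ht.1, ht.2.le.trans hc.2⟩)).tendsto
    have : (𝓝[Ico a c] c).NeBot := by
      rw [← mem_closure_iff_nhdsWithin_neBot, closure_Ico hac.ne]
      exact right_mem_Icc.mpr hac.le
    exact le_of_tendsto hcw (eventually_mem_nhdsWithin.mono fun t ht =>
      main t ⟨ht.1, ht.2.le.trans hc.2⟩ fun x hx => (hbefore x ⟨hx.1, hx.2.trans_lt ht.2⟩).le)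
  linarith

end IsErrorTrajectory

end UAV

namespace UAV

/-! ### Admissible initial errors -/

section Admissible

variable {P : Params}

theorem eq_of_hasDerivWithinAt_zero {f f' : ℝ → ℝ} {a b : ℝ} (hab : a ≤ b)
    (h : ∀ t ∈ Icc a b, HasDerivWithinAt f (f' t) (Icc a b) t) (h0 : ∀ t ∈ Icc a b, f' t = 0) :
    f b = f a := by
  refine constant_of_has_deriv_right_zero (fun t ht => (h t ht).continuousWithinAt)
    (fun t ht => ?_) b (right_mem_Icc.mpr hab)
  have := h t (Ico_subset_Icc_self ht)
  rw [h0 t (Ico_subset_Icc_self ht)] at this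
  exact this.mono_of_mem_nhdsWithin (Icc_mem_nhdsGE_of_mem ht)

/-- Each first integral is constant along the comparison solution on its half of the headings, so
its value can be read off at the end of that half. The position at which `ψ = π / 2` serves as `m`.
-/
theorem safe_of_crossing (hP : P.Valid) (hR₂ : P.R₂ < 1 / P.κ₀ - P.vmin / P.ωmax) {τ : ℝ}
    {r p : ℝ → ℝ} (hτ : 0 ≤ τ)
    (h : ∀ t ∈ Icc 0 τ, p t ∈ Icc 0 π ∧
      HasDerivWithinAt r (P.vmin * sin (p t)) (Icc 0 τ) t ∧
      HasDerivWithinAt p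
        (if π / 2 ≤ p t then -P.ωmax - P.κ₀ * P.vmin * cos (p t) / (1 - P.κ₀ * r t)
          else -P.ωmax + P.κ₀ * P.vmin * cos (p t) / (1 + P.κ₀ * r t)) (Icc 0 τ) t)
    (hp : p τ = 0) (hr : r τ ≤ P.R₂) (hr0 : -P.R₂ ≤ r 0) : Safe P (r 0) (p 0) := by
  have hκ := hP.κ₀_pos
  obtain ⟨hR, hv⟩ := Params.κ₀_mul_R₂_lt hP hR₂
  have hrc : ContinuousOn r (Icc 0 τ) := fun t ht => (h t ht).2.1.continuousWithinAt
  have hpc : ContinuousOn p (Icc 0 τ) := fun t ht => (h t ht).2.2.continuousWithinAt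
  have hmono : MonotoneOn r (Icc 0 τ) := by
    refine monotoneOn_of_hasDerivWithinAt_nonneg (convex_Icc _ _) hrc
      (fun t ht => ((h t (interior_subset ht)).2.1).mono interior_subset) fun t ht => ?_
    have := (h t (interior_subset ht)).1
    exact mul_nonneg hP.vmin_pos.le (sin_nonneg_of_nonneg_of_le_pi this.1 this.2)
  have hrb : ∀ t ∈ Icc 0 τ, |r t| ≤ P.R₂ := fun t ht => abs_le.mpr
    ⟨hr0.trans (hmono (left_mem_Icc.mpr hτ) ht ht.1),
      (hmono ht (right_mem_Icc.mpr hτ) ht.2).trans hr⟩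
  have e1 : ∀ x y : ℝ, -P.ωmax - P.κ₀ * P.vmin * cos y / (1 - P.κ₀ * x)
      = -P.ωmax - P.vmin * turn P.κ₀ (x, y) := fun x y => by
    simp only [turn]; ring
  have e2 : ∀ x y : ℝ, -P.ωmax + P.κ₀ * P.vmin * cos y / (1 + P.κ₀ * x)
      = -P.ωmax - P.vmin * turn (-P.κ₀) (x, y) := fun x y => by
    simp only [turn, neg_mul, neg_div, sub_neg_eq_add]; ring
  have hk : |P.κ₀| ≤ P.κ₀ := (abs_of_pos hκ).le
  have hk' : |-P.κ₀| ≤ P.κ₀ := by rw [abs_neg]; exact hk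
  have d1 : ∀ t ∈ Icc 0 τ, π / 2 ≤ p t →
      HasDerivWithinAt p (-P.ωmax - P.vmin * turn P.κ₀ (r t, p t)) (Icc 0 τ) t := by
    intro t ht hpt
    have := (h t ht).2.2
    rwa [if_pos hpt, e1] at this
  -- At `ψ = π / 2` both right-hand sides agree because the cosine vanishes, so the second equation
  -- holds on the closed half.
  have d2 : ∀ t ∈ Icc 0 τ, p t ≤ π / 2 →
      HasDerivWithinAt p (-P.ωmax - P.vmin * turn (-P.κ₀) (r t, p t)) (Icc 0 τ) t := by
    intro t ht hpt
    rcases hpt.eq_or_lt with heq | hlt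
    · have := d1 t ht heq.ge
      simp only [turn, heq, cos_pi_div_two, mul_zero, zero_div] at this ⊢
      exact this
    · have := (h t ht).2.2
      rwa [if_neg (not_le.mpr hlt), e2] at this
  have hanti : AntitoneOn p (Icc 0 τ) := by
    have hb : ∀ k x y : ℝ, |k| ≤ P.κ₀ → |x| ≤ P.R₂ → -P.ωmax - P.vmin * turn k (x, y) ≤ 0 := by
      intro k x y hk hx
      have h1 := neg_le_abs (turn k (x, y)) |>.trans (abs_turn_le_of_le hk hx hR)
      linarith [mul_le_mul_of_nonneg_left h1 hP.vmin_pos.le]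
    refine antitoneOn_of_hasDerivWithinAt_nonpos (convex_Icc _ _) hpc
      (fun t ht => ((h t (interior_subset ht)).2.2).mono interior_subset) fun t ht => ?_
    rw [e1, e2]
    split_ifs
    · exact hb _ _ _ hk (hrb t (interior_subset ht))
    · exact hb _ _ _ hk' (hrb t (interior_subset ht))
  have c2 : ∀ c ∈ Icc 0 τ, p c ≤ π / 2 →
      integral₂ P (r c) (p c) ≤ integral₂ P P.R₂ 0 := by
    intro c hc hpc2
    have hsub : Icc c τ ⊆ Icc 0 τ := Icc_subset_Icc_left hc.1
    have := eq_of_hasDerivWithinAt_zero hc.2 (f := fun t => integral₂ P (r t) (p t))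
      (fun t ht => hasDerivWithinAt_integral₂ (k := -P.κ₀) (s := Icc c τ) hP
        (one_sub_mul_pos_of_le hk' (hrb t (hsub ht)) hR).ne'
        ((h t (hsub ht)).2.1.mono hsub)
        ((d2 t (hsub ht) ((hanti hc (hsub ht) ht.1).trans hpc2)).mono hsub))
      (fun t ht => by rw [neg_div, div_self hκ.ne']; simp)
    rw [← this, hp]
    have g1 := (radius_lt hR₂ (hrb τ (right_mem_Icc.mpr hτ))).1
    have g2 := (radius_lt hR₂ (abs_of_pos hP.R₂_pos).le).1
    simp only [integral₂, cos_zero, mul_one]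
    nlinarith [mul_nonneg (sub_nonneg.mpr hr)
      (by linarith : 0 ≤ 1 / P.κ₀ + P.R₂ + (1 / P.κ₀ + r τ) - 2 * (P.vmin / P.ωmax))]
  rcases le_total (p 0) (π / 2) with h0 | h0
  · exact Or.inl ⟨h0, c2 0 (left_mem_Icc.mpr hτ) h0⟩
  · obtain ⟨c, hc, hpc'⟩ := intermediate_value_Icc' hτ hpc
      (show π / 2 ∈ Icc (p τ) (p 0) from ⟨by rw [hp]; positivity, h0⟩)
    refine Or.inr ⟨h0, r c, abs_le.mp (hrb c hc), ?_, by
      have := c2 c hc hpc'.le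
      rwa [hpc'] at this⟩
    have hsub : Icc 0 c ⊆ Icc 0 τ := Icc_subset_Icc_right hc.2
    have := eq_of_hasDerivWithinAt_zero hc.1 (f := fun t => integral₁ P (r t) (p t))
      (fun t ht => hasDerivWithinAt_integral₁ (k := P.κ₀) (s := Icc 0 c) hP
        (one_sub_mul_pos_of_le hk (hrb t (hsub ht)) hR).ne'
        ((h t (hsub ht)).2.1.mono hsub)
        ((d1 t (hsub ht) (hpc' ▸ hanti (hsub ht) hc ht.2)).mono hsub))
      (fun t ht => by rw [div_self hκ.ne']; simp)
    rw [← this, hpc']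

theorem safe_of_crosses₁ (hP : P.Valid) (hR₂ : P.R₂ < 1 / P.κ₀ - P.vmin / P.ωmax) {φ : ℝ × ℝ}
    (hφ : -P.R₂ ≤ φ.1) (h : Crosses₁ P φ) : Safe P φ.1 φ.2 := by
  obtain ⟨τ, r, p, hτ, h1, h2, h3, h4, h5⟩ := h
  rw [← h1, ← h2]
  exact safe_of_crossing hP hR₂ hτ
    (fun t ht => ⟨Ico_subset_Icc_self (h3 t ht).1, (h3 t ht).2⟩) h4 h5 (by rwa [h1])

theorem safe_of_crosses₃ (hP : P.Valid) (hR₂ : P.R₂ < 1 / P.κ₀ - P.vmin / P.ωmax) {φ : ℝ × ℝ}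
    (hφ : φ.1 ≤ P.R₂) (h : Crosses₃ P φ) : Safe P (-φ.1) (-φ.2) := by
  obtain ⟨τ, r, p, hτ, h1, h2, h3, h4, h5⟩ := h
  have key := safe_of_crossing (r := fun t => -r t) (p := fun t => -p t) hP hR₂ hτ
    (fun t ht => ?_) (by simp [h4]) h5 (by rw [h1]; linarith)
  · simpa only [h1, h2] using key
  · obtain ⟨g1, g2, g3⟩ := h3 t ht
    refine ⟨⟨by linarith [g1.2], by linarith [g1.1]⟩, ?_, ?_⟩
    · refine g2.neg.congr_deriv ?_
      rw [sin_neg]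
      ring
    · refine g3.neg.congr_deriv ?_
      rw [cos_neg]
      -- Reflection sends the boundary heading `-π / 2` to the other branch, which is harmless
      -- because the cosine vanishes there.
      rcases lt_trichotomy (p t) (-(π / 2)) with hlt | heq | hgt
      · rw [if_pos hlt, if_pos (by linarith)]
        ring
      · rw [if_neg (not_lt.mpr heq.ge), if_pos (by linarith), heq, cos_neg, cos_pi_div_two]
        simp
      · rw [if_neg (not_lt.mpr hgt.le), if_neg (by linarith)]
        ring

/-- What is used of an admissible error. -/
theorem Admissible.bounds (hP : P.Valid) (hR₂ : P.R₂ < 1 / P.κ₀ - P.vmin / P.ωmax) {φ : ℝ × ℝ}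
    (h : Admissible P φ) : |φ.1| ≤ P.R₂ ∧ -π ≤ φ.2 ∧ φ.2 < π ∧
      (φ.2 ≤ roof P φ.1 ∨ Safe P φ.1 φ.2) ∧ (-φ.2 ≤ roof P (-φ.1) ∨ Safe P (-φ.1) (-φ.2)) := by
  have ha := hP.a_lt
  have ha0 := hP.a_pos
  have hpi := pi_pos
  have hR := hP.R₁_pos
  have hR12 := hP.R₁_lt_R₂
  rcases h with h | (h | h) | ⟨h, hc⟩ | ⟨h, hc⟩
  · have h2 := abs_le.mp h.2.1
    refine ⟨h.1.trans hR12.le, by linarith, by linarith, Or.inl (le_roof_of_mem_S₁ hP h), Or.inl ?_⟩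
    exact le_roof_of_mem_S₁ (y := -φ) hP (neg_mem_S₁.mpr h)
  · obtain ⟨⟨h1, h2⟩, h3, h4⟩ := h
    refine ⟨abs_le.mpr ⟨h1, by linarith⟩, by linarith, by linarith, Or.inl ?_, Or.inl ?_⟩
    · rw [roof_of_nonpos hP (by linarith)]
      exact h4
    · exact le_trans (by linarith) roof_nonneg
  · obtain ⟨⟨h1, h2⟩, h3, h4⟩ := h
    refine ⟨abs_le.mpr ⟨by linarith, h2⟩, by linarith, by linarith, Or.inl ?_, Or.inl ?_⟩
    · exact le_trans (by linarith) roof_nonneg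
    · rw [roof_of_nonpos hP (by linarith)]
      linarith
  · have hb : |φ.1| ≤ P.R₂ ∧ -π ≤ φ.2 ∧ φ.2 < π ∧ 0 ≤ φ.2 := by
      rcases h with ⟨⟨h1, h2, -⟩, -⟩ | ⟨⟨h1, h2⟩, h3⟩
      · exact ⟨abs_le.mpr h2.1, h2.2.1, h2.2.2, le_of_lt h1⟩
      · exact ⟨abs_le.mpr ⟨by linarith, h2⟩, by linarith, by linarith, h3.ge⟩
    exact ⟨hb.1, hb.2.1, hb.2.2.1, Or.inr (safe_of_crosses₁ hP hR₂ (abs_le.mp hb.1).1 hc),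
      Or.inl (le_trans (by linarith [hb.2.2.2]) roof_nonneg)⟩
  · have hb : |φ.1| ≤ P.R₂ ∧ -π ≤ φ.2 ∧ φ.2 < π ∧ φ.2 ≤ 0 := by
      rcases h with ⟨⟨h1, h2, -⟩, -⟩ | ⟨⟨h1, h2⟩, h3⟩
      · exact ⟨abs_le.mpr h2.1, h2.2.1, h2.2.2, le_of_lt h1⟩
      · exact ⟨abs_le.mpr ⟨h1, by linarith⟩, by linarith, by linarith, h3.le⟩
    exact ⟨hb.1, hb.2.1, hb.2.2.1, Or.inl (le_trans hb.2.2.2 roof_nonneg),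
      Or.inr (safe_of_crosses₃ hP hR₂ (abs_le.mp hb.1).2 hc)⟩

end Admissible

/-- An error trajectory that starts from an admissible error stays in `𝒮`. -/
theorem IsErrorTrajectory.mem_S {P : Params} {ρ ψ κ ζ v ω : ℝ → ℝ} {a b : ℝ}
    (h : IsErrorTrajectory P ρ ψ κ ζ v ω a b) (hP : P.Valid)
    (hR₂ : P.R₂ < 1 / P.κ₀ - P.vmin / P.ωmax) (h0 : Admissible P (ρ a, ψ a)) {t : ℝ}
    (ht : t ∈ Icc a b) : (ρ t, ψ t) ∈ S P := by
  obtain ⟨h1, h2, h3, h4, h5⟩ := h0.bounds hP hR₂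
  simp only at h1 h2 h3 h4 h5
  have hρ : ∀ s ∈ Icc a b, |ρ s| ≤ P.R₂ := fun s hs =>
    (h.mono le_rfl hs.1 hs.2).abs_fst_le hP hR₂ hs.1 h1 (abs_le.mpr ⟨h2, h3.le⟩) h4 h5
  have hn := (h.neg hP).snd_le hP hR₂ (fun s hs => by
    rw [Pi.neg_apply, abs_neg]; exact hρ s hs) ht
  simp only [Pi.neg_apply] at hn
  have ha := hP.a_lt
  have hpi := pi_pos
  refine ⟨abs_le.mp (hρ t ht), ?_, ?_⟩
  · have := hn.trans (max_le (by linarith) (by linarith : -ψ a ≤ π))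
    simp only
    linarith
  · exact (h.snd_le hP hR₂ hρ ht).trans_lt (max_lt (by linarith) h3)

end UAV

namespace UAV

/-! ### A Lyapunov function for the path following error -/

section Lyapunov

variable {P : Params}

/-- Errors below the roof and above its mirror image. -/
def inner (P : Params) : Set (ℝ × ℝ) :=
  {x | |x.1| ≤ P.R₂ ∧ x.2 ≤ roof P x.1 ∧ -x.2 ≤ roof P (-x.1)}

/-- A bound for the rate of change of the heading error. -/
noncomputable def Params.spin (P : Params) : ℝ := P.ωmax + P.vmax * (P.κ₀ / (1 - P.κ₀ * P.R₂))

/-- A bound from below for the heading error away from the path. -/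
noncomputable def Params.tilt (P : Params) (h : ℝ) : ℝ :=
  min (P.k₁ * P.R₁ * h / (P.k₂ + P.k₃)) (P.a - P.ε₀)

/-- Conditions on the slope of the sides of the level sets of the Lyapunov function. -/
structure SmallSlope (P : Params) (h ε : ℝ) : Prop where
  pos : 0 < ε
  le_one : ε ≤ 1
  lt₁ : ε * P.R₁ < P.a
  lt₂ : ε * P.a < P.R₁
  gain : P.k₁ * (P.R₁ + ε * P.a) < P.k₂ * (P.a - ε * P.R₁)
  top : (P.a - P.ε₀) * (P.R₁ + ε * P.a) < P.R₁ * (P.a - ε * P.R₁)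
  spin : ε * P.spin ≤ P.vmin * sin (P.tilt h) / 2

theorem Params.Valid.tilt_pos (hP : P.Valid) {h : ℝ} (hh : 0 < h) : 0 < P.tilt h := by
  have h1 := hP.k₁_pos
  have h2 := hP.k₂_ge
  have h3 := hP.k₃_ge
  have h4 := hP.R₁_pos
  exact lt_min (by positivity) (by linarith [hP.ε₀_lt])

theorem Params.Valid.sin_tilt_pos (hP : P.Valid) {h : ℝ} (hh : 0 < h) : 0 < sin (P.tilt h) := by
  refine sin_pos_of_pos_of_lt_pi (hP.tilt_pos hh) ?_
  have : P.tilt h ≤ P.a - P.ε₀ := min_le_right _ _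
  linarith [hP.a_lt, hP.ε₀_pos, pi_pos]

/-- Apart from `0 < ε`, every condition follows from a strict inequality that holds at `ε = 0` and
persists for small `ε` by continuity. -/
theorem exists_smallSlope (hP : P.Valid) {h : ℝ} (hh : 0 < h) : ∃ ε, SmallSlope P h ε := by
  have hR := hP.R₁_pos
  have ha := hP.a_pos
  have hs := mul_pos hP.vmin_pos (hP.sin_tilt_pos hh)
  have key : ∀ f g : ℝ → ℝ, Continuous f → Continuous g → f 0 < g 0 →
      ∀ᶠ ε in 𝓝[>] (0 : ℝ), f ε < g ε := fun f g hf hg h0 =>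
    nhdsWithin_le_nhds (hf.continuousAt.eventually_lt hg.continuousAt h0)
  have e1 := key (fun ε => ε) (fun _ => 1) (by fun_prop) (by fun_prop) one_pos
  have e2 := key (fun ε => ε * P.R₁) (fun _ => P.a) (by fun_prop) (by fun_prop) (by simpa using ha)
  have e3 := key (fun ε => ε * P.a) (fun _ => P.R₁) (by fun_prop) (by fun_prop) (by simpa using hR)
  have e4 := key (fun ε => P.k₁ * (P.R₁ + ε * P.a)) (fun ε => P.k₂ * (P.a - ε * P.R₁))
    (by fun_prop) (by fun_prop) (by simp only [zero_mul]; linarith [hP.gain_lt])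
  have e5 := key (fun ε => (P.a - P.ε₀) * (P.R₁ + ε * P.a)) (fun ε => P.R₁ * (P.a - ε * P.R₁))
    (by fun_prop) (by fun_prop) (by simp only [zero_mul]; nlinarith [hP.ε₀_pos])
  have e6 := key (fun ε => ε * P.spin) (fun _ => P.vmin * sin (P.tilt h) / 2)
    (by fun_prop) (by fun_prop) (by simp only [zero_mul]; linarith)
  obtain ⟨ε, h0, h1, h2, h3, h4, h5, h6⟩ := (eventually_mem_nhdsWithin.and
    (e1.and (e2.and (e3.and (e4.and (e5.and e6)))))).exists
  exact ⟨ε, h0, h1.le, h2, h3, h4, h5, h6.le⟩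

theorem continuousAt_turn {κ : ℝ} {x : ℝ × ℝ} (h : 1 - κ * x.1 ≠ 0) : ContinuousAt (turn κ) x := by
  unfold turn
  exact ContinuousAt.div (by fun_prop) (by fun_prop) h

theorem snd_rate_le_spin (hP : P.Valid) (hR₂ : P.R₂ < 1 / P.κ₀ - P.vmin / P.ωmax) {κ : ℝ}
    {y u : ℝ × ℝ} (hκ : |κ| < P.κ₀) (hy : |y.1| ≤ P.R₂)
    (hu : u ∈ Icc P.vmin P.vmax ×ˢ Icc (-P.ωmax) P.ωmax) :
    u.2 - u.1 * turn κ y ≤ P.spin := by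
  have h1 : -turn κ y ≤ P.κ₀ / (1 - P.κ₀ * P.R₂) :=
    (neg_le_abs _).trans (abs_turn_le hκ hy (Params.κ₀_mul_R₂_lt hP hR₂).1)
  have h0 : 0 ≤ P.κ₀ / (1 - P.κ₀ * P.R₂) :=
    div_nonneg hP.κ₀_pos.le (by linarith [(Params.κ₀_mul_R₂_lt hP hR₂).1])
  obtain ⟨⟨h2, h3⟩, h4, h5⟩ := hu
  have h6 := hP.vmin_pos
  unfold Params.spin
  have h7 : u.1 * -turn κ y ≤ u.1 * (P.κ₀ / (1 - P.κ₀ * P.R₂)) :=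
    mul_le_mul_of_nonneg_left h1 (by linarith)
  have h8 : u.1 * (P.κ₀ / (1 - P.κ₀ * P.R₂)) ≤ P.vmax * (P.κ₀ / (1 - P.κ₀ * P.R₂)) :=
    mul_le_mul_of_nonneg_right h3 h0
  linarith

variable {κ ζ : ℝ} {x w : ℝ × ℝ} {h ε H : ℝ}

theorem inner.le_a (hP : P.Valid) (hx : x ∈ inner P) : |x.2| ≤ P.a :=
  abs_le.mpr ⟨by linarith [hx.2.2.trans (roof_le hP)], hx.2.1.trans (roof_le hP)⟩

/-- The heading error decreases on the upper side of a level set. -/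
theorem rate_upper (hP : P.Valid) (hR₂ : P.R₂ < 1 / P.κ₀ - P.vmin / P.ωmax) (hκ : |κ| < P.κ₀)
    (hε : SmallSlope P h ε) (hH : 0 < H) (hx : x ∈ inner P)
    (h1 : x.2 - ε * x.1 = P.a * H) (h2 : P.a * x.1 + P.R₁ * x.2 ≤ P.a * P.R₁ * H)
    (h3 : -(x.1 + ε * x.2) ≤ P.R₁ * H) (hw : w ∈ filippov (S P) (feedback P κ ζ) x) :
    (-turn κ x - ε * sin x.2) * w.1 + 1 * w.2 ≤
      -min P.α (min (P.fall P.R₂) (ε * (P.vmin * sin (P.a - P.ε₀)))) := by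
  have hR := hP.R₁_pos
  have ha := hP.a_pos
  have hε0 := hε.pos
  have hεa := hε.lt₁
  have hpi := pi_pos
  have hal := hP.a_lt
  have hxa := abs_le.mp (inner.le_a hP hx)
  -- For `ρ > 0` the oblique side would lie further out than the upper one.
  have hρ : x.1 ≤ 0 := by
    have : (P.a + P.R₁ * ε) * x.1 ≤ 0 := by
      have e : P.a * P.R₁ * H = P.R₁ * (x.2 - ε * x.1) := by rw [h1]; ring
      nlinarith
    by_contra hcon
    have : 0 < (P.a + P.R₁ * ε) * x.1 := mul_pos (by positivity) (by linarith)
    linarith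
  have h4 : -x.1 * (P.a - ε * P.R₁) ≤ (P.R₁ + ε * P.a) * x.2 := by
    have := mul_le_mul_of_nonneg_left h3 ha.le
    have e : P.a * (P.R₁ * H) = P.R₁ * (x.2 - ε * x.1) := by rw [h1]; ring
    rw [e] at this
    nlinarith
  have hψ : 0 < x.2 := by
    by_contra hcon
    have hn := not_lt.mp hcon
    have : ε * x.1 ≤ 0 := mul_nonpos_of_nonneg_of_nonpos hε0.le hρ
    have e1 : (P.R₁ + ε * P.a) * x.2 ≤ 0 := mul_nonpos_of_nonneg_of_nonpos (by positivity) hn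
    have e2 : x.1 = 0 := by
      by_contra hne
      have : 0 < -x.1 * (P.a - ε * P.R₁) :=
        mul_pos (neg_pos.mpr (lt_of_le_of_ne hρ hne)) (by linarith)
      linarith
    rw [e2] at h1
    have := mul_pos ha hH
    linarith
  have hs : 0 < sin x.2 := sin_pos_of_pos_of_lt_pi hψ (by linarith)
  -- The strict gain condition `R₁ k₁ < a k₂`, which survives the tilt, makes `ϑ` positive on this
  -- side.
  have hϑ : 0 < ϑ P x := by
    have e : ϑ P x = P.k₁ * x.1 + P.k₂ * x.2 + P.k₃ * sin x.2 := rfl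
    have h5 : 0 < (P.a - ε * P.R₁) * (P.k₁ * x.1 + P.k₂ * x.2) := by
      have := mul_lt_mul_of_pos_right hε.gain hψ
      have := mul_le_mul_of_nonneg_left h4 hP.k₁_pos.le
      nlinarith
    have h6 : 0 < P.k₁ * x.1 + P.k₂ * x.2 := pos_of_mul_pos_right h5 (by linarith)
    have h7 : 0 < P.k₃ * sin x.2 := mul_pos (by linarith [hP.k₃_ge]) hs
    rw [e]
    linarith
  -- Where the side extends to `ρ ≤ -R₁`, the heading exceeds `a - ε₀` and the law in `𝒮₂²` holds it
  -- constant. The decrease then comes from `ε sin ψ` alone, hence from the tilt.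
  have htop : ∀ᶠ y in 𝓝 x, y.1 < -P.R₁ → P.a - P.ε₀ < y.2 := by
    rcases lt_or_ge (-P.R₁) x.1 with hlt | hge
    · filter_upwards [continuousAt_const.eventually_lt continuous_fst.continuousAt hlt]
        with y hy hy'
      linarith
    · have : P.a - P.ε₀ < x.2 := by
        have e1 : P.R₁ * (P.a - ε * P.R₁) ≤ -x.1 * (P.a - ε * P.R₁) :=
          mul_le_mul_of_nonneg_right (by linarith) (by linarith)
        have e2 := hε.top
        have e3 : (P.a - P.ε₀) * (P.R₁ + ε * P.a) < x.2 * (P.R₁ + ε * P.a) := by linarith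
        exact lt_of_mul_lt_mul_right e3 (by positivity)
      filter_upwards [continuousAt_const.eventually_lt continuous_snd.continuousAt this]
        with y hy _ using hy
  have h0 := one_sub_mul_pos hκ hx.1 (Params.κ₀_mul_R₂_lt hP hR₂).1
  refine filippov_le (A := fun y => -turn κ y - ε * sin y.2) (B := fun _ => 1)
    (C := fun _ => -min P.α (min (P.fall P.R₂) (ε * (P.vmin * sin (P.a - P.ε₀)))))
    (M := max P.vmax P.ωmax) ((continuousAt_turn h0.ne').neg.sub (by fun_prop))
    continuousAt_const continuousAt_const (volume_exceptional hP)
    (filippov_bounded hP hR₂ hκ) ?_ hw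
  have hϑc : Continuous (ϑ P) := by unfold ϑ; fun_prop
  filter_upwards [htop, continuousAt_const.eventually_lt continuous_snd.continuousAt hψ,
    continuousAt_const.eventually_lt hϑc.continuousAt hϑ] with y hyt hy0 hyϑ hyS hye
  have hbox := feedback_mem (ζ := ζ) hP hR₂ hκ hyS hye
  have hv : 0 < (feedback P κ ζ y).1 := hP.vmin_pos.trans_le hbox.1.1
  have hys : 0 < sin y.2 := sin_pos_of_pos_of_lt_pi hy0 hyS.2.2
  have hyε : 0 ≤ ε * (sin y.2 * (feedback P κ ζ y).1) := by positivity
  rcases cases_of_mem_S hP hyS hye with hc | hc | hc | hc | hc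
  · obtain ⟨-, -, -, h5, -⟩ := feedback_S₁_of_pos (ζ := ζ) hP hκ hc hyϑ rfl
    have := min_le_left P.α (min (P.fall P.R₂) (ε * (P.vmin * sin (P.a - P.ε₀))))
    linarith
  · obtain ⟨-, -, -, h5⟩ := feedback_S₂₂ (ζ := ζ) hP hR₂ hκ hc rfl
    have h5 := h5 (hyt hc.1.2)
    have h6 : sin (P.a - P.ε₀) ≤ sin y.2 :=
      sin_le_sin_of_le_of_le_pi_div_two (by linarith [hP.ε₀_lt])
        (by linarith [hc.2.2]) (hyt hc.1.2).le
    have h7 : P.vmin * sin (P.a - P.ε₀) ≤ (feedback P κ ζ y).1 * sin y.2 :=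
      mul_le_mul hbox.1.1 h6 (sin_nonneg_of_nonneg_of_le_pi (by linarith [hP.ε₀_lt])
        (by linarith [hP.ε₀_pos])) hv.le
    have h8 := mul_le_mul_of_nonneg_left h7 hε0.le
    have := (min_le_right P.α (min (P.fall P.R₂) (ε * (P.vmin * sin (P.a - P.ε₀))))).trans
      (min_le_right _ _)
    linarith
  · linarith [hc.2.2]
  · have e := feedback_of_roof_lt (κ := κ) (ζ := ζ) hP hyS hc
    rw [e] at hyε ⊢
    simp only at hyε ⊢
    have h5 := IsErrorTrajectory.neg_turn_bound (y := y.2) hP hR₂ hκ (abs_le.mpr hyS.1)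
    have e2 : turn κ (y.1, y.2) = turn κ y := rfl
    rw [e2] at h5
    have := (min_le_right P.α (min (P.fall P.R₂) (ε * (P.vmin * sin (P.a - P.ε₀))))).trans
      (min_le_left _ _)
    linarith
  · linarith [roof_nonneg (P := P) (ρ := -y.1)]

/-- The distance to the path decreases on the right side of a level set. -/
theorem rate_right (hP : P.Valid) (hR₂ : P.R₂ < 1 / P.κ₀ - P.vmin / P.ωmax) (hκ : |κ| < P.κ₀)
    (hε : SmallSlope P h ε) (hh : 0 < h) (hH : h < H) (hx : x ∈ inner P)
    (h1 : x.1 + ε * x.2 = P.R₁ * H) (h2 : P.a * x.1 + P.R₁ * x.2 ≤ P.a * P.R₁ * H)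
    (hw : w ∈ filippov (S P) (feedback P κ ζ) x) :
    (sin x.2 - ε * turn κ x) * w.1 + ε * w.2 ≤
      -min (ε * min P.α (min (P.fall P.R₂) P.steer)) (P.vmin * sin (P.tilt h) / 2) := by
  have hR := hP.R₁_pos
  have ha := hP.a_pos
  have hε0 := hε.pos
  have hεa := hε.lt₂
  have hpi := pi_pos
  have hal := hP.a_lt
  have hxa := abs_le.mp (inner.le_a hP hx)
  have hβ := hP.tilt_pos hh
  have hβa : P.tilt h ≤ P.a - P.ε₀ := min_le_right _ _
  have hsβ := hP.sin_tilt_pos hh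
  have hψ : x.2 ≤ 0 := by
    by_contra hcon
    have e : P.a * P.R₁ * H = P.a * (x.1 + ε * x.2) := by rw [h1]; ring
    have : 0 < (P.R₁ - ε * P.a) * x.2 := mul_pos (by linarith) (by linarith)
    nlinarith
  have hρ : P.R₁ * h < x.1 := by
    have e1 := mul_lt_mul_of_pos_left hH hR
    have : ε * x.2 ≤ 0 := mul_nonpos_of_nonneg_of_nonpos hε0.le hψ
    linarith
  set d := min (ε * min P.α (min (P.fall P.R₂) P.steer)) (P.vmin * sin (P.tilt h) / 2) with hd
  have hd1 : d ≤ ε * P.α :=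
    (min_le_left _ _).trans (mul_le_mul_of_nonneg_left (min_le_left _ _) hε0.le)
  have hd2 : d ≤ ε * P.fall P.R₂ := (min_le_left _ _).trans
    (mul_le_mul_of_nonneg_left ((min_le_right _ _).trans (min_le_left _ _)) hε0.le)
  have hd3 : d ≤ ε * P.steer := (min_le_left _ _).trans
    (mul_le_mul_of_nonneg_left ((min_le_right _ _).trans (min_le_right _ _)) hε0.le)
  have hd4 : d ≤ P.vmin * sin (P.tilt h) / 2 := min_le_right _ _
  have h0 := one_sub_mul_pos hκ hx.1 (Params.κ₀_mul_R₂_lt hP hR₂).1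
  have hs0 : sin x.2 ≤ 0 := sin_nonpos_of_nonpos_of_neg_pi_le hψ (by linarith)
  -- The side may contain points with `ψ = 0`, near which there are positive headings. The
  -- continuous allowance `v_max max(0, sin ψ)` covers these and vanishes at the point itself.
  have hCx : -d = -d + P.vmax * max 0 (sin x.2) := by rw [max_eq_left hs0]; ring
  rw [hCx]
  refine filippov_le (A := fun y => sin y.2 - ε * turn κ y) (B := fun _ => ε)
    (C := fun y => -d + P.vmax * max 0 (sin y.2))
    (M := max P.vmax P.ωmax)
    (ContinuousAt.sub (by fun_prop) (continuousAt_const.mul (continuousAt_turn h0.ne')))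
    continuousAt_const (by fun_prop) (volume_exceptional hP)
    (filippov_bounded hP hR₂ hκ) ?_ hw
  filter_upwards [continuousAt_const.eventually_lt continuous_fst.continuousAt hρ,
    continuousAt_const.eventually_lt continuous_snd.continuousAt
      (by linarith : -(π / 2) < x.2)] with y hyρ hyψ hyS hye
  have hbox := feedback_mem (ζ := ζ) hP hR₂ hκ hyS hye
  have hv : 0 < (feedback P κ ζ y).1 := hP.vmin_pos.trans_le hbox.1.1
  have hspin := snd_rate_le_spin hP hR₂ hκ (abs_le.mpr hyS.1) hbox
  have hmax : 0 ≤ P.vmax * max 0 (sin y.2) := mul_nonneg hP.vmax_pos.le (le_max_left _ _)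
  have hsv : sin y.2 * (feedback P κ ζ y).1 ≤ P.vmax * max 0 (sin y.2) := by
    calc sin y.2 * (feedback P κ ζ y).1 ≤ max 0 (sin y.2) * (feedback P κ ζ y).1 :=
          mul_le_mul_of_nonneg_right (le_max_right _ _) hv.le
      _ ≤ max 0 (sin y.2) * P.vmax := mul_le_mul_of_nonneg_left hbox.1.2 (le_max_left _ _)
      _ = _ := mul_comm _ _
  have hRh : 0 < P.R₁ * h := mul_pos hR hh
  -- With `ψ ≤ -tilt`, the fall of `ρ` pays for `ε` times any rotation of the heading, and half of
  -- it remains.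
  have steep : y.2 ≤ -P.tilt h → sin y.2 * (feedback P κ ζ y).1 ≤ -(P.vmin * sin (P.tilt h)) := by
    intro hy
    have e1 : sin y.2 ≤ -sin (P.tilt h) := by
      rw [← sin_neg]
      exact sin_le_sin_of_le_of_le_pi_div_two hyψ.le (by linarith) hy
    have e2 := mul_le_mul_of_nonneg_right e1 hv.le
    have e3 := mul_le_mul_of_nonneg_left hbox.1.1 hsβ.le
    linarith
  have hspin' := mul_le_mul_of_nonneg_left hspin hε0.le
  have hεs := hε.spin
  rcases cases_of_mem_S hP hyS hye with hc | hc | hc | hc | hc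
  · rcases lt_or_gt_of_ne (fun h => hye (Or.inl h) : ϑ P y ≠ 0) with hϑ | hϑ
    -- If `ϑ < 0` and `ρ > R₁ h`, then `(k₂ + k₃) (-ψ) > k₁ R₁ h`, which makes the heading steep. If
    -- `ϑ > 0`, the heading itself decreases at rate `α`.
    · have e : ϑ P y = P.k₁ * y.1 + P.k₂ * y.2 + P.k₃ * sin y.2 := rfl
      have hk1 : P.k₁ * (P.R₁ * h) < P.k₁ * y.1 := mul_lt_mul_of_pos_left hyρ hP.k₁_pos
      have hk0 := mul_pos hP.k₁_pos hRh
      have hk2 := hP.k₂_ge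
      have hk3 := hP.k₃_ge
      have hya := abs_le.mp hc.2.1
      have hneg : y.2 < 0 := by
        by_contra hcon
        have hn := not_lt.mp hcon
        have := sin_nonneg_of_nonneg_of_le_pi hn (by linarith)
        have : 0 ≤ P.k₂ * y.2 := by positivity
        have : 0 ≤ P.k₃ * sin y.2 := by positivity
        linarith
      have hsl : y.2 ≤ sin y.2 := by
        have := sin_le (x := -y.2) (by linarith)
        rw [sin_neg] at this
        linarith
      have h5 := steep (by
        have e1 : P.tilt h ≤ P.k₁ * P.R₁ * h / (P.k₂ + P.k₃) := min_le_left _ _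
        have e2 : P.k₁ * P.R₁ * h / (P.k₂ + P.k₃) ≤ -y.2 := by
          rw [div_le_iff₀ (by linarith)]
          nlinarith
        linarith)
      linarith
    · obtain ⟨-, -, -, h5, -⟩ := feedback_S₁_of_pos (ζ := ζ) hP hκ hc hϑ rfl
      have h6 := mul_le_mul_of_nonneg_left h5 hε0.le
      linarith
  · linarith [hc.1.2]
  · obtain ⟨-, -, h5, h6⟩ := feedback_S₂₄ (ζ := ζ) hP hR₂ hκ hyS hye hc rfl
    rcases le_or_gt (-P.a + P.ε₀) y.2 with hcase | hcase
    · have h7 := mul_le_mul_of_nonneg_left (h5 hcase) hε0.le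
      linarith
    · have h7 := h6 hcase
      have h8 := steep (by linarith)
      have h9 : ε * ((feedback P κ ζ y).2 - (feedback P κ ζ y).1 * turn κ y) = 0 := by
        rw [h7, mul_zero]
      have h10 := mul_pos hP.vmin_pos hsβ
      linarith
  · have e := feedback_of_roof_lt (κ := κ) (ζ := ζ) hP hyS hc
    rw [e] at hsv ⊢
    simp only at hsv ⊢
    have h5 := IsErrorTrajectory.neg_turn_bound (y := y.2) hP hR₂ hκ (abs_le.mpr hyS.1)
    have e2 : turn κ (y.1, y.2) = turn κ y := rfl
    rw [e2] at h5
    have h6 := mul_le_mul_of_nonneg_left h5 hε0.le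
    linarith
  · rw [roof_of_nonpos hP (by linarith)] at hc
    have h5 := steep (by linarith [hP.ε₀_pos])
    linarith

/-- The diagonal sides of the level sets. -/
theorem rate_diag (hP : P.Valid) (hR₂ : P.R₂ < 1 / P.κ₀ - P.vmin / P.ωmax) (hκ : |κ| < P.κ₀)
    (hx : x ∈ inner P) (hx1 : 0 < x.1) (hx2 : 0 < x.2)
    (hw : w ∈ filippov (S P) (feedback P κ ζ) x) :
    (P.a * sin x.2 - P.R₁ * turn κ x) * w.1 + P.R₁ * w.2 ≤ -(P.R₁ * P.α) := by
  have h0 := one_sub_mul_pos hκ hx.1 (Params.κ₀_mul_R₂_lt hP hR₂).1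
  have hR1 : x.1 < P.R₁ := by
    by_contra hcon
    have := hx.2.1
    rw [roof_of_ge hP (not_lt.mp hcon)] at this
    linarith
  refine filippov_le (A := fun y => P.a * sin y.2 - P.R₁ * turn κ y) (B := fun _ => P.R₁)
    (C := fun _ => -(P.R₁ * P.α)) (M := max P.vmax P.ωmax)
    (ContinuousAt.sub (by fun_prop) (continuousAt_const.mul (continuousAt_turn h0.ne')))
    continuousAt_const continuousAt_const (volume_exceptional hP)
    (filippov_bounded hP hR₂ hκ) ?_ hw
  filter_upwards [continuousAt_const.eventually_lt continuous_fst.continuousAt hx1,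
    continuousAt_const.eventually_lt continuous_snd.continuousAt hx2,
    continuous_fst.continuousAt.eventually_lt continuousAt_const hR1] with y hy1 hy2 hy3 hyS hye
  have hys : 0 < sin y.2 := sin_pos_of_pos_of_lt_pi hy2 hyS.2.2
  rcases cases_of_mem_S hP hyS hye with hc | hc | hc | hc | hc
  · have hϑ : 0 < ϑ P y := by
      have e : ϑ P y = P.k₁ * y.1 + P.k₂ * y.2 + P.k₃ * sin y.2 := rfl
      have := hP.k₁_pos
      have : 0 < P.k₂ := by linarith [hP.k₂_ge]
      have : 0 < P.k₃ := by linarith [hP.k₃_ge]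
      rw [e]
      positivity
    obtain ⟨-, -, -, -, h5⟩ := feedback_S₁_of_pos (ζ := ζ) hP hκ hc hϑ rfl
    have := h5 hy1 hy2.le
    linarith
  · linarith [hc.1.2, hP.R₁_pos]
  · linarith [hc.2.2]
  · rw [feedback_of_roof_lt (κ := κ) (ζ := ζ) hP hyS hc]
    have h5 := hP.diag_rate (ψ := y.2) hκ (abs_le.mpr ⟨by linarith, hy3.le⟩)
    have e2 : turn κ (y.1, y.2) = turn κ y := rfl
    rw [e2] at h5
    simp only
    linarith
  · linarith [roof_nonneg (P := P) (ρ := -y.1)]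

end Lyapunov

end UAV

/-! ### Decay of the gauge along trajectories -/

namespace UAV

/-- The Lyapunov function: a gauge of a hexagon whose sides have slope `ε`. -/
noncomputable def lyap (P : Params) (ε ρ ψ : ℝ) : ℝ :=
  max |(ψ - ε * ρ) / P.a| (max |(ρ + ε * ψ) / P.R₁| |(P.a * ρ + P.R₁ * ψ) / (P.a * P.R₁)|)

/-- The rate of decay of the Lyapunov function. -/
noncomputable def decay (P : Params) (h ε : ℝ) : ℝ :=
  min (min P.α (min (P.fall P.R₂) (ε * (P.vmin * sin (P.a - P.ε₀)))) / P.a)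
    (min (min (ε * min P.α (min (P.fall P.R₂) P.steer)) (P.vmin * sin (P.tilt h) / 2) / P.R₁)
      (P.α / P.a))

theorem decay_pos {P : Params} (hP : P.Valid) (hR₂ : P.R₂ < 1 / P.κ₀ - P.vmin / P.ωmax)
    {h ε : ℝ} (hh : 0 < h) (hε : 0 < ε) : 0 < decay P h ε := by
  have h1 := hP.α_pos
  have h2 := IsErrorTrajectory.fall_pos hP hR₂
  have h3 := hP.steer_pos
  have h4 := hP.sin_tilt_pos hh
  have h5 := hP.vmin_pos
  have h6 : 0 < sin (P.a - P.ε₀) := sin_pos_of_pos_of_lt_pi (by linarith [hP.ε₀_lt])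
    (by linarith [hP.ε₀_pos, hP.a_lt, pi_pos])
  have h7 := hP.a_pos
  have h8 := hP.R₁_pos
  unfold decay
  positivity

theorem lyap_neg (P : Params) (ε ρ ψ : ℝ) : lyap P ε (-ρ) (-ψ) = lyap P ε ρ ψ := by
  unfold lyap
  rw [show -ψ - ε * -ρ = -(ψ - ε * ρ) by ring, show -ρ + ε * -ψ = -(ρ + ε * ψ) by ring,
    show P.a * -ρ + P.R₁ * -ψ = -(P.a * ρ + P.R₁ * ψ) by ring]
  simp only [neg_div, abs_neg]

theorem neg_mem_inner {P : Params} {ρ ψ : ℝ} (h : (ρ, ψ) ∈ inner P) : (-ρ, -ψ) ∈ inner P := by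
  obtain ⟨h1, h2, h3⟩ := h
  simp only at h1 h2 h3
  exact ⟨by simpa using h1, h3, by simpa using h2⟩

namespace IsErrorTrajectory

variable {P : Params} {ρ ψ κ ζ v ω : ℝ → ℝ} {a b h ε : ℝ}

theorem ac_linear (ht : IsErrorTrajectory P ρ ψ κ ζ v ω a b) (p q : ℝ) :
    AbsolutelyContinuousOnInterval (fun t => p * ρ t + q * ψ t) a b :=
  (ht.ac_fst.const_mul p).add (ht.ac_snd.const_mul q)

theorem ac_lyap (ht : IsErrorTrajectory P ρ ψ κ ζ v ω a b) :
    AbsolutelyContinuousOnInterval (fun t => lyap P ε (ρ t) (ψ t)) a b := by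
  have habs : ∀ f : ℝ → ℝ, AbsolutelyContinuousOnInterval f a b →
      AbsolutelyContinuousOnInterval (fun t => |f t|) a b := fun f hf =>
    absolutelyContinuousOnInterval_max hf hf.neg
  have e1 : (fun t => (ψ t - ε * ρ t) / P.a) = fun t => (-ε / P.a) * ρ t + (1 / P.a) * ψ t := by
    ext t; ring
  have e2 : (fun t => (ρ t + ε * ψ t) / P.R₁) = fun t => (1 / P.R₁) * ρ t + (ε / P.R₁) * ψ t := by
    ext t; ring
  have e3 : (fun t => (P.a * ρ t + P.R₁ * ψ t) / (P.a * P.R₁)) =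
      fun t => (P.a / (P.a * P.R₁)) * ρ t + (P.R₁ / (P.a * P.R₁)) * ψ t := by
    ext t; ring
  refine absolutelyContinuousOnInterval_max (habs _ (e1 ▸ ht.ac_linear _ _))
    (absolutelyContinuousOnInterval_max (habs _ (e2 ▸ ht.ac_linear _ _))
      (habs _ (e3 ▸ ht.ac_linear _ _)))

/-- Decay of the Lyapunov function where it is attained with a positive sign. -/
theorem ae_lyap_decay (ht : IsErrorTrajectory P ρ ψ κ ζ v ω a b) (hP : P.Valid)
    (hR₂ : P.R₂ < 1 / P.κ₀ - P.vmin / P.ωmax) (hh : 0 < h) (hε : SmallSlope P h ε)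
    (hin : ∀ t ∈ Icc a b, (ρ t, ψ t) ∈ inner P) :
    ∀ᵐ t : ℝ, t ∈ Icc a b → h < lyap P ε (ρ t) (ψ t) →
      ((ψ t - ε * ρ t) / P.a = lyap P ε (ρ t) (ψ t) ∨
        (ρ t + ε * ψ t) / P.R₁ = lyap P ε (ρ t) (ψ t) ∨
        (P.a * ρ t + P.R₁ * ψ t) / (P.a * P.R₁) = lyap P ε (ρ t) (ψ t)) →
      ∀ f', HasDerivAt (fun t => lyap P ε (ρ t) (ψ t)) f' t → f' ≤ -decay P h ε := by
  have ha := hP.a_pos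
  have hR := hP.R₁_pos
  have hε0 := hε.pos
  filter_upwards [ht.ae_mem] with t hae hm hlt hor f' hf'
  obtain ⟨hd1, hd2, hfil⟩ := hae hm
  have hx := hin t hm
  have hra : |ψ t| ≤ π := (inner.le_a hP hx).trans (by linarith [hP.a_lt, pi_pos])
  rw [retract_of_mem hx.1 hra] at hfil
  have le1 : ∀ s, (ψ s - ε * ρ s) / P.a ≤ lyap P ε (ρ s) (ψ s) := fun s =>
    (le_abs_self _).trans (le_max_left _ _)
  have le2 : ∀ s, (ρ s + ε * ψ s) / P.R₁ ≤ lyap P ε (ρ s) (ψ s) := fun s =>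
    (le_abs_self _).trans ((le_max_left _ _).trans (le_max_right _ _))
  have le3 : ∀ s, (P.a * ρ s + P.R₁ * ψ s) / (P.a * P.R₁) ≤ lyap P ε (ρ s) (ψ s) := fun s =>
    (le_abs_self _).trans ((le_max_right _ _).trans (le_max_right _ _))
  have le4 : -((ρ t + ε * ψ t) / P.R₁) ≤ lyap P ε (ρ t) (ψ t) :=
    (neg_le_abs _).trans ((le_max_left _ _).trans (le_max_right _ _))
  set H := lyap P ε (ρ t) (ψ t) with hH
  have hH0 : 0 < H := hh.trans hlt
  have m3 : P.a * ρ t + P.R₁ * ψ t ≤ P.a * P.R₁ * H := by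
    have := le3 t
    rw [div_le_iff₀ (by positivity)] at this
    linarith
  have c1 : (ψ t - ε * ρ t) / P.a = H → f' ≤ -decay P h ε := by
    intro heq
    have hder : HasDerivAt (fun s => (ψ s - ε * ρ s) / P.a)
        ((ω t - v t * turn (κ t) (ρ t, ψ t) - ε * (v t * sin (ψ t))) / P.a) t :=
      (hd2.sub (hd1.const_mul ε)).div_const _
    rw [hasDerivAt_eq_of_le hf' hder le1 heq]
    have m4 : -(ρ t + ε * ψ t) ≤ P.R₁ * H := by
      rw [← neg_div, div_le_iff₀ hR] at le4
      linarith
    rw [div_eq_iff ha.ne'] at heq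
    have key := rate_upper (x := (ρ t, ψ t)) hP hR₂ (ht.curv t) hε hH0 hx (by linarith) m3 m4 hfil
    simp only at key
    have hdec : decay P h ε ≤
      min P.α (min (P.fall P.R₂) (ε * (P.vmin * sin (P.a - P.ε₀)))) / P.a := min_le_left _ _
    rw [le_div_iff₀ ha] at hdec
    rw [div_le_iff₀ ha]
    linarith
  have c2 : (ρ t + ε * ψ t) / P.R₁ = H → f' ≤ -decay P h ε := by
    intro heq
    have hder : HasDerivAt (fun s => (ρ s + ε * ψ s) / P.R₁)
        ((v t * sin (ψ t) + ε * (ω t - v t * turn (κ t) (ρ t, ψ t))) / P.R₁) t :=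
      (hd1.add (hd2.const_mul ε)).div_const _
    rw [hasDerivAt_eq_of_le hf' hder le2 heq]
    rw [div_eq_iff hR.ne'] at heq
    have key := rate_right (x := (ρ t, ψ t)) hP hR₂ (ht.curv t) hε hh hlt hx (by linarith) m3 hfil
    simp only at key
    have hdec : decay P h ε ≤ min (ε * min P.α (min (P.fall P.R₂) P.steer))
      (P.vmin * sin (P.tilt h) / 2) / P.R₁ := (min_le_right _ _).trans (min_le_left _ _)
    rw [le_div_iff₀ hR] at hdec
    rw [div_le_iff₀ hR]
    linarith
  rcases hor with heq | heq | heq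
  · exact c1 heq
  · exact c2 heq
  · have heq' := heq
    rw [div_eq_iff (by positivity)] at heq'
    have l1 := le1 t
    have l2 := le2 t
    rw [div_le_iff₀ ha] at l1
    rw [div_le_iff₀ hR] at l2
    -- The oblique side is outermost only in the closed first quadrant. At its end points the upper
    -- or the right side is active as well, and those cases are settled.
    have hρ : 0 ≤ ρ t := by
      by_contra hcon
      have : (P.a + P.R₁ * ε) * ρ t < 0 := mul_neg_of_pos_of_neg (by positivity) (by linarith)
      nlinarith
    have hψ : 0 ≤ ψ t := by
      by_contra hcon
      have : (P.R₁ - ε * P.a) * ψ t < 0 :=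
        mul_neg_of_pos_of_neg (by linarith [hε.lt₂]) (by linarith)
      nlinarith
    rcases hρ.eq_or_lt with e | hρ'
    · refine c1 ?_
      rw [← heq, ← e]
      field_simp
      ring
    rcases hψ.eq_or_lt with e | hψ'
    · refine c2 ?_
      rw [← heq, ← e]
      field_simp
      ring
    have hder : HasDerivAt (fun s => (P.a * ρ s + P.R₁ * ψ s) / (P.a * P.R₁))
        ((P.a * (v t * sin (ψ t)) + P.R₁ * (ω t - v t * turn (κ t) (ρ t, ψ t)))
          / (P.a * P.R₁)) t :=
      ((hd1.const_mul P.a).add (hd2.const_mul P.R₁)).div_const _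
    rw [hasDerivAt_eq_of_le hf' hder le3 heq]
    have key := rate_diag (x := (ρ t, ψ t)) hP hR₂ (ht.curv t) hx hρ' hψ' hfil
    simp only at key
    have hdec : decay P h ε ≤ P.α / P.a := (min_le_right _ _).trans (min_le_right _ _)
    rw [le_div_iff₀ ha] at hdec
    rw [div_le_iff₀ (by positivity)]
    have := mul_le_mul_of_nonneg_left hdec hR.le
    nlinarith

/-- The gauge is even, so sides attained with a negative sign reduce to `ae_lyap_decay` for the
reflected trajectory. -/
theorem lyap_le (ht : IsErrorTrajectory P ρ ψ κ ζ v ω a b) (hP : P.Valid)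
    (hR₂ : P.R₂ < 1 / P.κ₀ - P.vmin / P.ωmax) (hh : 0 < h) (hε : SmallSlope P h ε)
    (hin : ∀ t ∈ Icc a b, (ρ t, ψ t) ∈ inner P) {t : ℝ} (htm : t ∈ Icc a b) :
    lyap P ε (ρ t) (ψ t) ≤ max h (lyap P ε (ρ a) (ψ a) - decay P h ε * (t - a)) := by
  refine le_max_of_ae_hasDerivAt (f := fun t => lyap P ε (ρ t) (ψ t))
    (decay_pos hP hR₂ hh hε.pos).le ht.ac_lyap ?_ htm
  have hneg := (ht.neg hP).ae_lyap_decay hP hR₂ hh hε (fun t htm => neg_mem_inner (hin t htm))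
  filter_upwards [ht.ae_lyap_decay hP hR₂ hh hε hin, hneg] with s h1 h2 hm hlt f' hf'
  simp only [Pi.neg_apply, lyap_neg] at h2
  have hcase : ∃ z : ℝ, (z = (ψ s - ε * ρ s) / P.a ∨ z = (ρ s + ε * ψ s) / P.R₁ ∨
      z = (P.a * ρ s + P.R₁ * ψ s) / (P.a * P.R₁)) ∧ |z| = lyap P ε (ρ s) (ψ s) := by
    unfold lyap
    rcases max_choice |(ψ s - ε * ρ s) / P.a| (max |(ρ s + ε * ψ s) / P.R₁|
      |(P.a * ρ s + P.R₁ * ψ s) / (P.a * P.R₁)|) with e | e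
    · exact ⟨_, Or.inl rfl, e.symm⟩
    · rcases max_choice |(ρ s + ε * ψ s) / P.R₁|
        |(P.a * ρ s + P.R₁ * ψ s) / (P.a * P.R₁)| with e' | e'
      · exact ⟨_, Or.inr (Or.inl rfl), (e.trans e').symm⟩
      · exact ⟨_, Or.inr (Or.inr rfl), (e.trans e').symm⟩
  obtain ⟨z, hz, hzl⟩ := hcase
  rcases abs_choice z with e | e
  · refine h1 hm hlt ?_ f' hf'
    rw [e] at hzl
    rcases hz with rfl | rfl | rfl
    · exact Or.inl hzl
    · exact Or.inr (Or.inl hzl)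
    · exact Or.inr (Or.inr hzl)
  · refine h2 hm hlt ?_ f' hf'
    rw [e] at hzl
    rcases hz with rfl | rfl | rfl
    · left
      rw [← hzl]
      ring
    · right; left
      rw [← hzl]
      ring
    · right; right
      rw [← hzl]
      ring

/-- In `𝒮` the initial excess over the roof is at most `π`, and it is used up at rate `fall`, on
both sides of the funnel. -/
theorem mem_inner (ht : IsErrorTrajectory P ρ ψ κ ζ v ω a b) (hP : P.Valid)
    (hR₂ : P.R₂ < 1 / P.κ₀ - P.vmin / P.ωmax) (hS : ∀ t ∈ Icc a b, (ρ t, ψ t) ∈ S P) {t : ℝ}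
    (htm : t ∈ Icc a b) (hlate : π ≤ P.fall P.R₂ * (t - a)) : (ρ t, ψ t) ∈ inner P := by
  have hρ : ∀ s ∈ Icc a b, |ρ s| ≤ P.R₂ := fun s hs => abs_le.mpr (hS s hs).1
  have h1 := ht.sub_roof_le hP hR₂ hρ htm
  have h2 := (ht.neg hP).sub_roof_le hP hR₂
    (fun s hs => by rw [Pi.neg_apply, abs_neg]; exact hρ s hs) htm
  have hψ := (hS a ⟨le_rfl, htm.1.trans htm.2⟩).2
  simp only [Pi.neg_apply] at h2 hψ
  have r1 := roof_nonneg (P := P) (ρ := ρ a)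
  have r2 := roof_nonneg (P := P) (ρ := -ρ a)
  rw [max_eq_left (by linarith [hψ.2])] at h1
  rw [max_eq_left (by linarith [hψ.1])] at h2
  exact ⟨hρ t htm, by simp only; linarith, by simp only; linarith⟩

end IsErrorTrajectory

/-- The two tilted coordinates are a rotation of `(ρ, ψ)` scaled by `√(1 + ε²)`. The bound is free
of `ε`, which is needed because `ε` is chosen after `h`. -/
theorem abs_le_of_lyap_le {P : Params} (hP : P.Valid) {ε ρ ψ h : ℝ} (hε : 0 < ε) (hε1 : ε ≤ 1)
    (hl : lyap P ε ρ ψ ≤ h) : |ρ| ≤ (P.R₁ + P.a) * h ∧ |ψ| ≤ (P.R₁ + P.a) * h := by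
  have ha := hP.a_pos
  have hR := hP.R₁_pos
  have h1 : |(ψ - ε * ρ) / P.a| ≤ h := (le_max_left _ _).trans hl
  have h2 : |(ρ + ε * ψ) / P.R₁| ≤ h := ((le_max_left _ _).trans (le_max_right _ _)).trans hl
  have hh : 0 ≤ h := (abs_nonneg _).trans h1
  rw [abs_div, abs_of_pos ha, div_le_iff₀ ha] at h1
  rw [abs_div, abs_of_pos hR, div_le_iff₀ hR] at h2
  obtain ⟨a1, a2⟩ := abs_le.mp h1
  obtain ⟨b1, b2⟩ := abs_le.mp h2
  have key : ∀ z X : ℝ, |z * (1 + ε ^ 2)| ≤ X → |z| ≤ X := by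
    intro z X hz
    rw [abs_mul, abs_of_pos (by positivity : 0 < 1 + ε ^ 2)] at hz
    nlinarith [abs_nonneg z, mul_nonneg (abs_nonneg z) (sq_nonneg ε)]
  have c1 : ε * (h * P.a) ≤ h * P.a := by nlinarith [mul_nonneg hh ha.le]
  have c2 : ε * (h * P.R₁) ≤ h * P.R₁ := by nlinarith [mul_nonneg hh hR.le]
  constructor
  · refine key _ _ (abs_le.mpr ⟨?_, ?_⟩) <;> nlinarith
  · refine key _ _ (abs_le.mpr ⟨?_, ?_⟩) <;> nlinarith

/-- The path following error converges to zero. -/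
theorem tendsto_zero_of_isErrorTrajectory {P : Params} {ρ ψ κ ζ v ω : ℝ → ℝ} {a : ℝ}
    (ht : ∀ b, a ≤ b → IsErrorTrajectory P ρ ψ κ ζ v ω a b) (hP : P.Valid)
    (hR₂ : P.R₂ < 1 / P.κ₀ - P.vmin / P.ωmax) (hS : ∀ t, a ≤ t → (ρ t, ψ t) ∈ S P) :
    Tendsto (fun t => (ρ t, ψ t)) atTop (𝓝 0) := by
  have hf := IsErrorTrajectory.fall_pos hP hR₂
  have hc : 0 < P.R₁ + P.a := add_pos hP.R₁_pos hP.a_pos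
  rw [Metric.tendsto_atTop]
  intro η hη
  -- This level makes `(R₁ + a) h = η / 2`.
  set h := η / (2 * (P.R₁ + P.a)) with hhdef
  have hh : 0 < h := by positivity
  obtain ⟨ε, hε⟩ := exists_smallSlope hP hh
  have hd := decay_pos hP hR₂ hh hε.pos
  set c := a + π / P.fall P.R₂ with hcdef
  have hac : a ≤ c := by
    have : 0 < π / P.fall P.R₂ := div_pos pi_pos hf
    linarith
  have hin : ∀ t, c ≤ t → (ρ t, ψ t) ∈ inner P := by
    intro t htc
    refine (ht t (hac.trans htc)).mem_inner hP hR₂ (fun s hs => hS s hs.1)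
      ⟨hac.trans htc, le_rfl⟩ ?_
    have : π / P.fall P.R₂ ≤ t - a := by linarith
    rw [div_le_iff₀ hf] at this
    linarith
  refine ⟨c + |lyap P ε (ρ c) (ψ c)| / decay P h ε, fun t htt => ?_⟩
  have hct : c ≤ t := by
    have : 0 ≤ |lyap P ε (ρ c) (ψ c)| / decay P h ε := by positivity
    linarith
  have h1 := ((ht t (hac.trans hct)).mono hac hct le_rfl).lyap_le hP hR₂ hh hε
    (fun s hs => hin s hs.1) (right_mem_Icc.mpr hct)
  have h2 : lyap P ε (ρ c) (ψ c) - decay P h ε * (t - c) ≤ h := by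
    have e : |lyap P ε (ρ c) (ψ c)| / decay P h ε ≤ t - c := by linarith
    rw [div_le_iff₀ hd] at e
    linarith [le_abs_self (lyap P ε (ρ c) (ψ c))]
  rw [max_eq_left h2] at h1
  obtain ⟨b1, b2⟩ := abs_le_of_lyap_le hP hε.pos hε.le_one h1
  have e : (P.R₁ + P.a) * h = η / 2 := by
    rw [hhdef]
    field_simp
  rw [e] at b1 b2
  rw [dist_zero_right, Prod.norm_def, Real.norm_eq_abs, Real.norm_eq_abs]
  exact max_lt (by simp only; linarith) (by simp only; linarith)

end UAV

namespace UAV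

/-! ### Speed along the path inside the coordination set -/

theorem continuousAt_coordSpeed {P : Params} (hP : P.Valid) {κ ζ : ℝ} {x : ℝ × ℝ}
    (h : cos x.2 ≠ 0) : ContinuousAt (coordSpeed P κ ζ) x := by
  have e : coordSpeed P κ ζ = fun y : ℝ × ℝ =>
      max P.vmin (min ((1 - κ * y.1) / cos y.2 * P.χ ζ) P.vmax) := by
    funext y
    exact sat_eq hP.vmin_lt_vmax.le
  rw [e]
  have : ContinuousAt (fun y : ℝ × ℝ => (1 - κ * y.1) / cos y.2) x :=
    ContinuousAt.div (by fun_prop) (by fun_prop) h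
  fun_prop

theorem filippov_speed_mem {P : Params} (hP : P.Valid)
    (hR₂ : P.R₂ < 1 / P.κ₀ - P.vmin / P.ωmax) {κ ζ : ℝ} {x w : ℝ × ℝ} (hκ : |κ| < P.κ₀)
    (hx : ∀ᶠ y in 𝓝 x, y ∈ S₁ P) (hw : w ∈ filippov (S P) (feedback P κ ζ) x) :
    w.1 ∈ Icc (min P.vm (coordSpeed P κ ζ x)) (coordSpeed P κ ζ x) := by
  have hc := continuousAt_coordSpeed (κ := κ) (ζ := ζ) hP (S₁.cos_pos hP hx.self_of_nhds).ne'
  constructor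
  · have := filippov_le (A := fun _ => -1) (B := fun _ => 0)
      (C := fun y => -min P.vm (coordSpeed P κ ζ y)) continuousAt_const continuousAt_const
      (by fun_prop) (volume_exceptional hP) (filippov_bounded (ζ := ζ) hP hR₂ hκ) (by
        filter_upwards [hx] with y hy hyS hye
        have := (feedback_S₁_speed (ζ := ζ) hP hκ hyS hye hy rfl).1
        linarith) hw
    linarith
  · have := filippov_le (A := fun _ => 1) (B := fun _ => 0)
      (C := fun y => coordSpeed P κ ζ y) continuousAt_const continuousAt_const
      (by fun_prop) (volume_exceptional hP) (filippov_bounded (ζ := ζ) hP hR₂ hκ) (by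
        filter_upwards [hx] with y hy hyS hye
        have := (feedback_S₁_speed (ζ := ζ) hP hκ hyS hye hy rfl).2.1
        linarith) hw
    linarith

/-- Saturation and resets lower the requested speed at most to `v_m`, which is worth a ground speed
of at least `cap`; the limit `v_min` is never active since `χ ≥ low`. -/
theorem filippov_path_speed_mem {P : Params} (hP : P.Valid)
    (hR₂ : P.R₂ < 1 / P.κ₀ - P.vmin / P.ωmax) {κ ζ : ℝ} {x w : ℝ × ℝ} (hκ : |κ| < P.κ₀)
    (hζ : 0 ≤ ζ) (hx : ∀ᶠ y in 𝓝 x, y ∈ S₁ P)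
    (hw : w ∈ filippov (S P) (feedback P κ ζ) x) :
    w.1 * cos x.2 / (1 - κ * x.1) ∈ Icc (min (P.χ ζ) P.cap) (P.χ ζ) := by
  have hx1 := hx.self_of_nhds
  have hcos := S₁.cos_pos hP hx1
  have hR := hP.κ₀_mul_R₁_lt
  have h0 : 0 < 1 - κ * x.1 := one_sub_mul_pos hκ hx1.1 hR
  have habs := abs_le.mp (abs_mul_le_of_abs_lt hκ hx1.1)
  have hlow := hP.low_le_χ hζ
  have hcosle : cos P.a ≤ cos x.2 := by
    rw [← cos_abs x.2]
    exact cos_le_cos_of_nonneg_of_le_pi (abs_nonneg _) (by linarith [hP.a_lt, pi_pos]) hx1.2.1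
  obtain ⟨w1, w2⟩ := filippov_speed_mem hP hR₂ hκ hx hw
  have hcs : coordSpeed P κ ζ x = max P.vmin (min ((1 - κ * x.1) / cos x.2 * P.χ ζ) P.vmax) :=
    sat_eq hP.vmin_lt_vmax.le
  have hχ : 0 < P.χ ζ := hP.low_pos.trans_le hlow
  have hg : P.vmin ≤ (1 - κ * x.1) / cos x.2 * P.χ ζ := by
    have h1 : (1 - P.κ₀ * P.R₁) * P.low = P.vmin := by
      unfold Params.low
      field_simp [(by linarith : 1 - P.κ₀ * P.R₁ ≠ 0)]
    have h2 : (1 - κ * x.1) ≤ (1 - κ * x.1) / cos x.2 := by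
      rw [le_div_iff₀ hcos]
      exact mul_le_of_le_one_right h0.le (cos_le_one _)
    rw [← h1]
    exact mul_le_mul (by linarith) hlow hP.low_pos.le (h0.le.trans h2)
  rw [max_eq_right (le_min hg hP.vmin_lt_vmax.le)] at hcs
  have hgq : (1 - κ * x.1) / cos x.2 * P.χ ζ * (cos x.2 / (1 - κ * x.1)) = P.χ ζ := by
    field_simp
  have hq : 0 < cos x.2 / (1 - κ * x.1) := div_pos hcos h0
  rw [mul_div_assoc]
  constructor
  · have h3 : P.cap ≤ P.vm * (cos x.2 / (1 - κ * x.1)) := by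
      unfold Params.cap
      rw [mul_comm]
      refine mul_le_mul_of_nonneg_left ?_ hP.vm_pos.le
      exact div_le_div₀ hcos.le hcosle h0 (by linarith)
    have h4 : min P.vm ((1 - κ * x.1) / cos x.2 * P.χ ζ) ≤ w.1 := by
      refine le_trans ?_ w1
      rw [hcs]
      exact le_min (min_le_left _ _) (le_min (min_le_right _ _)
        ((min_le_left _ _).trans hP.vm_le))
    rcases min_le_iff.mp h4 with h | h
    · exact (min_le_right _ _).trans (h3.trans (mul_le_mul_of_nonneg_right h hq.le))
    · refine (min_le_left _ _).trans ?_
      calc P.χ ζ = _ := hgq.symm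
        _ ≤ _ := mul_le_mul_of_nonneg_right h hq.le
  · calc _ ≤ _ := mul_le_mul_of_nonneg_right (w2.trans (hcs.le.trans (min_le_left _ _))) hq.le
      _ = _ := hgq

theorem eventually_mem_S₁_nhds_zero {P : Params} (hP : P.Valid) : ∀ᶠ y in 𝓝 (0 : ℝ × ℝ), y ∈ S₁ P := by
  have h1 : ∀ᶠ y in 𝓝 (0 : ℝ × ℝ), |y.1| < P.R₁ :=
    ContinuousAt.eventually_lt (by fun_prop) continuousAt_const (by simpa using hP.R₁_pos)
  have h2 : ∀ᶠ y in 𝓝 (0 : ℝ × ℝ), |y.2| < P.a :=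
    ContinuousAt.eventually_lt (by fun_prop) continuousAt_const (by simpa using hP.a_pos)
  have h3 : ∀ᶠ y in 𝓝 (0 : ℝ × ℝ), |P.a * y.1 + P.R₁ * y.2| < P.a * P.R₁ :=
    ContinuousAt.eventually_lt (by fun_prop) continuousAt_const
      (by simpa using mul_pos hP.a_pos hP.R₁_pos)
  filter_upwards [h1, h2, h3] with y h1 h2 h3 using ⟨h1.le, h2.le, h3.le⟩

end UAV

namespace UAV

/-! ### Persistence of the order of two vehicles -/

/-- A function that does not decrease while it takes values in `(k, k + m)` never crosses `k`
downwards. -/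
theorem lt_of_ae_hasDerivAt_nonneg {d : ℝ → ℝ} {a k m : ℝ} (hm : 0 < m)
    (hac : ∀ b, a ≤ b → AbsolutelyContinuousOnInterval d a b)
    (H : ∀ᵐ t : ℝ, a ≤ t → d t ∈ Ioo k (k + m) → ∃ d', HasDerivAt d d' t ∧ 0 ≤ d')
    (ha : k < d a) {t : ℝ} (ht : a ≤ t) : k < d t := by
  obtain ⟨M, hM⟩ : ∃ M, M = min (d a) (k + m) := ⟨_, rfl⟩
  have hkM : k < M := hM ▸ lt_min ha (by linarith)
  -- Clipping `d` from below at `c > k` hides the values at which nothing is known about the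
  -- derivative. The clipped function stays above `M`, and `c < M` allows the clip to be removed.
  obtain ⟨c, hkc, hcM⟩ := exists_between hkM
  have hMa : M ≤ d a := hM ▸ min_le_left _ _
  have hMk : M ≤ k + m := hM ▸ min_le_right _ _
  have := le_max_of_ae_hasDerivAt (f := fun s => -max (d s) c) (a := a) (b := t) (h := -M) (d := 0)
    le_rfl (absolutelyContinuousOnInterval_max (hac t ht)
      (absolutelyContinuousOnInterval_const c a t)).neg (by
      filter_upwards [H] with s hs hsm hlt f' hf'
      have hlt' : max (d s) c < M := by simpa using hlt
      have hF : HasDerivAt (fun s => max (d s) c) (-f') s := by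
        convert! hf'.neg using 1
        funext r
        simp
      rcases le_or_gt (d s) c with h | h
      · have := hasDerivAt_eq_of_le hF (hasDerivAt_const s c) (fun r => le_max_right _ _)
          (max_eq_right h).symm
        linarith
      · obtain ⟨d', hd', h0⟩ := hs hsm.1 ⟨hkc.trans h, (le_max_left _ _).trans_lt
          (hlt'.trans_le hMk)⟩
        have := hasDerivAt_eq_of_le hF hd' (fun r => le_max_left _ _) (max_eq_left h.le).symm
        linarith) (t := t) ⟨ht, le_rfl⟩
  rw [zero_mul, sub_zero, le_max_iff, neg_le_neg_iff, neg_le_neg_iff] at this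
  have hle : M ≤ max (d t) c := by
    rcases this with h | h
    · exact h
    · exact (hMa.trans (le_max_left _ _)).trans h
  rcases le_max_iff.mp hle with h | h
  · exact hkM.trans_le h
  · linarith

/-! ### Consensus of the arc distances -/

section Profile

/-- The deviation of the capped speed profile from its desired value. -/
noncomputable def Params.dev (P : Params) (x : ℝ) : ℝ := min (P.χ (max x 0)) P.cap - P.χ P.L

/-- A primitive of the deviation. -/
noncomputable def Params.energy (P : Params) (x : ℝ) : ℝ := ∫ t in P.L..x, P.dev t

variable {P : Params}

theorem Params.Valid.continuous_dev (hP : P.Valid) : Continuous P.dev := by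
  have : Continuous fun x : ℝ => P.χ (max x 0) :=
    hP.χ_cont.comp_continuous (by fun_prop) fun x => mem_Ici.mpr (le_max_right _ _)
  unfold Params.dev
  fun_prop

theorem Params.Valid.monotone_dev (hP : P.Valid) : Monotone P.dev := by
  intro x y hxy
  have : P.χ (max x 0) ≤ P.χ (max y 0) :=
    hP.χ_mono (mem_Ici.mpr (le_max_right _ _)) (mem_Ici.mpr (le_max_right _ _)) (max_le_max_right _ hxy)
  unfold Params.dev
  gcongr

theorem Params.Valid.dev_L (hP : P.Valid) : P.dev P.L = 0 := by
  unfold Params.dev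
  rw [max_eq_left hP.L_pos.le, min_eq_left hP.χ_L_lt_cap.le, sub_self]

theorem Params.Valid.dev_pos (hP : P.Valid) {x : ℝ} (hx : P.L < x) : 0 < P.dev x := by
  have hδ := hP.δ₂_pos
  have h1 : P.L < min x (P.L + P.δ₂) := lt_min hx (by linarith)
  refine lt_of_lt_of_le ?_ (hP.monotone_dev (min_le_left x (P.L + P.δ₂)))
  have h2 := hP.χ_strict (show P.L ∈ _ from ⟨by linarith, by linarith⟩)
    ⟨by linarith, min_le_right x (P.L + P.δ₂)⟩ h1
  unfold Params.dev
  rw [max_eq_left (hP.L_pos.le.trans h1.le), sub_pos]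
  exact lt_min h2 hP.χ_L_lt_cap

theorem Params.Valid.dev_neg (hP : P.Valid) {x : ℝ} (hx : x < P.L) : P.dev x < 0 := by
  have hδ := hP.δ₂_pos
  have h1 : max x (P.L - P.δ₂) < P.L := max_lt hx (by linarith)
  refine lt_of_le_of_lt (hP.monotone_dev (le_max_left x (P.L - P.δ₂))) ?_
  have h2 := hP.χ_strict (show max x (P.L - P.δ₂) ∈ _ from ⟨le_max_right _ _, by linarith⟩)
    (show P.L ∈ _ from ⟨by linarith, by linarith⟩) h1
  have h3 := hP.δ₁_lt
  have h4 := hP.δ₂_le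
  unfold Params.dev
  rw [max_eq_left ((by linarith : (0 : ℝ) ≤ P.L - P.δ₂).trans (le_max_right _ _)), sub_neg]
  exact min_lt_of_left_lt h2

theorem Params.Valid.abs_dev_le (hP : P.Valid) (x : ℝ) : |P.dev x| ≤ P.cap := by
  have h1 := hP.low_le_χ (le_max_right x 0)
  have h2 := hP.low_lt_cap
  have h3 := hP.low_lt_χ_L
  have h4 := hP.low_pos
  have h5 := hP.χ_L_lt_cap
  unfold Params.dev
  rw [abs_le]
  constructor
  · linarith [le_min h1 h2.le]
  · linarith [min_le_right (P.χ (max x 0)) P.cap]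

theorem Params.Valid.hasDerivAt_energy (hP : P.Valid) (x : ℝ) :
    HasDerivAt P.energy (P.dev x) x :=
  intervalIntegral.integral_hasDerivAt_right (hP.continuous_dev.intervalIntegrable _ _)
    (hP.continuous_dev.stronglyMeasurableAtFilter _ _) hP.continuous_dev.continuousAt

theorem Params.energy_L : P.energy P.L = 0 := intervalIntegral.integral_same

theorem Params.Valid.abs_energy_sub_le (hP : P.Valid) (x y : ℝ) :
    |P.energy x - P.energy y| ≤ P.cap * |x - y| := by
  have := Convex.norm_image_sub_le_of_norm_hasDerivWithin_le (s := univ) (C := P.cap)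
    (fun z _ => (hP.hasDerivAt_energy z).hasDerivWithinAt)
    (fun z _ => by simpa using hP.abs_dev_le z) convex_univ (mem_univ y) (mem_univ x)
  simpa using this

theorem Params.Valid.strictMonoOn_energy (hP : P.Valid) : StrictMonoOn P.energy (Ici P.L) := by
  refine strictMonoOn_of_deriv_pos (convex_Ici _)
    (fun x _ => (hP.hasDerivAt_energy x).continuousAt.continuousWithinAt) fun x hx => ?_
  rw [interior_Ici] at hx
  rw [(hP.hasDerivAt_energy x).deriv]
  exact hP.dev_pos hx

theorem Params.Valid.strictAntiOn_energy (hP : P.Valid) : StrictAntiOn P.energy (Iic P.L) := by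
  refine strictAntiOn_of_deriv_neg (convex_Iic _)
    (fun x _ => (hP.hasDerivAt_energy x).continuousAt.continuousWithinAt) fun x hx => ?_
  rw [interior_Iic] at hx
  rw [(hP.hasDerivAt_energy x).deriv]
  exact hP.dev_neg hx

theorem Params.Valid.energy_nonneg (hP : P.Valid) (x : ℝ) : 0 ≤ P.energy x := by
  rw [← Params.energy_L (P := P)]
  rcases le_total x P.L with h | h
  · exact hP.strictAntiOn_energy.antitoneOn h self_mem_Iic h
  · exact hP.strictMonoOn_energy.monotoneOn self_mem_Ici h h

theorem Params.Valid.exists_le_energy (hP : P.Valid) {η : ℝ} (hη : 0 < η) :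
    ∃ ε > 0, ∀ x, η ≤ |x - P.L| → ε ≤ P.energy x := by
  refine ⟨min (P.energy (P.L + η)) (P.energy (P.L - η)), lt_min ?_ ?_, fun x hx => ?_⟩
  · rw [← Params.energy_L (P := P)]
    exact hP.strictMonoOn_energy self_mem_Ici (mem_Ici.mpr (by linarith)) (by linarith)
  · rw [← Params.energy_L (P := P)]
    exact hP.strictAntiOn_energy (mem_Iic.mpr (by linarith)) self_mem_Iic (by linarith)
  · rcases le_abs.mp hx with h | h
    · exact (min_le_left _ _).trans (hP.strictMonoOn_energy.monotoneOn
        (mem_Ici.mpr (by linarith)) (mem_Ici.mpr (by linarith)) (by linarith))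
    · exact (min_le_right _ _).trans (hP.strictAntiOn_energy.antitoneOn
        (mem_Iic.mpr (by linarith)) (mem_Iic.mpr (by linarith)) (by linarith))

theorem Params.Valid.exists_le_abs_dev (hP : P.Valid) {η : ℝ} (hη : 0 < η) :
    ∃ c > 0, ∀ x, η ≤ |x - P.L| → c ≤ |P.dev x| := by
  refine ⟨min (P.dev (P.L + η)) (-P.dev (P.L - η)), lt_min (hP.dev_pos (by linarith)) ?_,
    fun x hx => ?_⟩
  · linarith [hP.dev_neg (show P.L - η < P.L by linarith)]
  · rcases le_abs.mp hx with h | h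
    · exact (min_le_left _ _).trans ((hP.monotone_dev (by linarith)).trans (le_abs_self _))
    · exact (min_le_right _ _).trans ((neg_le_neg (hP.monotone_dev (by linarith))).trans
        (neg_le_abs _))

end Profile

/-! ### Dissipation in a cyclic chain -/

open Fin.CommRing in
/-- Along a cycle, the sum of the squared increments controls the oscillation. -/
theorem abs_sub_le_of_cycle {n : ℕ} (z : Fin (n + 1) → ℝ) (p q : Fin (n + 1)) :
    |z q - z p| ≤ n * √(∑ i, (z (i + 1) - z i) ^ 2) := by
  set D := √(∑ i, (z (i + 1) - z i) ^ 2)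
  have h1 : ∀ i, |z (i + 1) - z i| ≤ D := fun i =>
    Real.abs_le_sqrt (Finset.single_le_sum (f := fun i => (z (i + 1) - z i) ^ 2)
      (fun i _ => sq_nonneg _) (Finset.mem_univ i))
  have h2 : ∀ k : ℕ, |z (p + (k : Fin (n + 1))) - z p| ≤ k * D := by
    intro k
    induction k with
    | zero => simp
    | succ k ih =>
      have := h1 (p + (k : Fin (n + 1)))
      rw [add_assoc] at this
      calc |z (p + ((k + 1 : ℕ) : Fin (n + 1))) - z p|
          = |(z (p + ((k : Fin (n + 1)) + 1)) - z (p + (k : Fin (n + 1))))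
            + (z (p + (k : Fin (n + 1))) - z p)| := by push_cast; ring_nf
        _ ≤ D + k * D := (abs_add_le _ _).trans (add_le_add this ih)
        _ = (k + 1 : ℕ) * D := by push_cast; ring
  have h3 := h2 (q - p).val
  rw [Fin.cast_val_eq_self, add_sub_cancel] at h3
  refine h3.trans (mul_le_mul_of_nonneg_right ?_ (Real.sqrt_nonneg _))
  exact_mod_cast Nat.lt_succ_iff.mp (q - p).isLt

/-- Decay of the energy in a cyclic chain whose speeds are close to a monotone profile. -/
theorem sum_mul_sub_le_of_cycle {n : ℕ} {z y : Fin (n + 1) → ℝ} {r cap : ℝ}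
    (hz : ∀ i, z i ≤ cap) (hy : ∀ i, r + z i ≤ y i) (hc : ∀ i, z i = cap ∨ y i = r + z i) :
    ∑ i, z i * (y (i + 1) - y i) ≤ -(1 / 2) * ∑ i, (z (i + 1) - z i) ^ 2 := by
  have hsh : ∀ f : Fin (n + 1) → ℝ, ∑ i, f (i + 1) = ∑ i, f i := fun f =>
    Equiv.sum_comp (Equiv.addRight (1 : Fin (n + 1))) f
  -- Summation by parts around the cycle. The defect `y - (r + z)` is nonzero only where `z` has its
  -- maximal value `cap`, so its contribution has a favourable sign.
  have e1 : ∑ i, z i * (y (i + 1) - y i) = -(1 / 2) * ∑ i, (z (i + 1) - z i) ^ 2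
      + ∑ i, (z i - z (i + 1)) * (y (i + 1) - (r + z (i + 1))) := by
    have a1 := hsh fun i => z i ^ 2
    have a2 := hsh fun i => z i * (y i - (r + z i))
    have : ∑ i, z i * (y (i + 1) - y i) - (-(1 / 2) * ∑ i, (z (i + 1) - z i) ^ 2
        + ∑ i, (z i - z (i + 1)) * (y (i + 1) - (r + z (i + 1))))
        = (1 / 2) * (∑ i, z (i + 1) ^ 2 - ∑ i, z i ^ 2)
          + (∑ i, z (i + 1) * (y (i + 1) - (r + z (i + 1))) - ∑ i, z i * (y i - (r + z i))) := by
      simp only [Finset.mul_sum, ← Finset.sum_sub_distrib, ← Finset.sum_add_distrib]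
      exact Finset.sum_congr rfl fun i _ => by ring
    rw [a1, a2] at this
    linarith
  rw [e1]
  have : ∑ i, (z i - z (i + 1)) * (y (i + 1) - (r + z (i + 1))) ≤ 0 := by
    refine Finset.sum_nonpos fun i _ => ?_
    rcases hc (i + 1) with h | h
    · exact mul_nonpos_of_nonpos_of_nonneg (by linarith [hz i]) (by linarith [hy (i + 1)])
    · rw [h, sub_self, mul_zero]
  linarith

theorem AbsolutelyContinuousOnInterval.sum_univ {ι : Type*} [Fintype ι] {f : ι → ℝ → ℝ} {a b : ℝ}
    (h : ∀ i, AbsolutelyContinuousOnInterval (f i) a b) :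
    AbsolutelyContinuousOnInterval (fun t => ∑ i, f i t) a b := by
  classical
  have : ∀ s : Finset ι, AbsolutelyContinuousOnInterval (fun t => ∑ i ∈ s, f i t) a b := by
    intro s
    induction s using Finset.induction_on with
    | empty => simpa using absolutelyContinuousOnInterval_const 0 a b
    | insert i s hi ih =>
      simp only [Finset.sum_insert hi]
      exact (h i).add ih
  exact this _

/-- Consensus: distances in a cyclic chain of vehicles, each of which moves at (nearly) the speed
prescribed by its distance to the next one, converge to the desired distance. A vehicle without
predecessor keeps the distance `L`. -/
theorem tendsto_of_cycle {P : Params} (hP : P.Valid) {n : ℕ} {ζ y : Fin (n + 1) → ℝ → ℝ} {a : ℝ}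
    (hac : ∀ i b, a ≤ b → AbsolutelyContinuousOnInterval (ζ i) a b)
    (hder : ∀ᵐ t : ℝ, a ≤ t → ∀ i, HasDerivAt (ζ i) (y (i + 1) t - y i t) t ∨
      (ζ i t = P.L ∧ HasDerivAt (ζ i) 0 t))
    (hy : ∀ᵐ t : ℝ, a ≤ t → ∀ i, y i t ∈ Icc (min (P.χ (ζ i t)) P.cap) (P.χ (ζ i t)))
    (hζ : ∀ t, a ≤ t → ∀ i, 0 ≤ ζ i t)
    (hge : ∀ t, a ≤ t → ∃ i, P.L ≤ ζ i t) (hle : ∀ t, a ≤ t → ∃ i, ζ i t ≤ P.L)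
    (i : Fin (n + 1)) : Tendsto (ζ i) atTop (𝓝 P.L) := by
  have hcap : 0 < P.cap := hP.low_pos.trans hP.low_lt_cap
  set E : ℝ → ℝ := fun t => ∑ i, P.energy (ζ i t) with hE
  have hEac : ∀ b, a ≤ b → AbsolutelyContinuousOnInterval E a b := fun b hb =>
    AbsolutelyContinuousOnInterval.sum_univ fun i =>
      absolutelyContinuousOnInterval_of_le (K := P.cap) (hac i b hb) (hac i b hb) fun s _ t _ => by
        refine (hP.abs_energy_sub_le _ _).trans (mul_le_mul_of_nonneg_left ?_ hcap.le)
        linarith [abs_nonneg (ζ i s - ζ i t)]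
  have hE' : ∀ᵐ t : ℝ, a ≤ t → ∀ f', HasDerivAt E f' t →
      f' ≤ -(1 / 2) * ∑ i, (P.dev (ζ (i + 1) t) - P.dev (ζ i t)) ^ 2 := by
    filter_upwards [hder, hy] with t hd hy hat f' hf'
    have h1 : HasDerivAt E (∑ i, P.dev (ζ i t) * (y (i + 1) t - y i t)) t := by
      refine HasDerivAt.fun_sum fun i _ => ?_
      rcases hd hat i with h | ⟨h, h0⟩
      · exact (hP.hasDerivAt_energy _).comp t h
      -- A constant distance `L` fits the formula for the chain because the deviation vanishes
      -- there.
      · have := (hP.hasDerivAt_energy (ζ i t)).comp t h0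
        rw [h, hP.dev_L, zero_mul] at this ⊢
        exact this
    rw [hf'.unique h1]
    refine sum_mul_sub_le_of_cycle (z := fun i => P.dev (ζ i t)) (y := fun i => y i t)
      (r := P.χ P.L) (cap := P.cap - P.χ P.L) (fun i => ?_) (fun i => ?_) fun i => ?_
    · simp only [Params.dev]
      linarith [min_le_right (P.χ (max (ζ i t) 0)) P.cap]
    · simp only [Params.dev]
      rw [max_eq_left (hζ t hat i)]
      linarith [(hy hat i).1]
    · simp only [Params.dev]
      rw [max_eq_left (hζ t hat i)]
      obtain ⟨y1, y2⟩ := hy hat i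
      rcases le_total (P.χ (ζ i t)) P.cap with h | h
      · rw [min_eq_left h] at y1 ⊢
        right
        linarith
      · rw [min_eq_right h]
        exact Or.inl rfl
  have hsmall : ∀ ε > 0, ∀ᶠ t in atTop, E t ≤ ε := by
    intro ε hε
    have hη : 0 < ε / (n + 1) / P.cap := by positivity
    obtain ⟨c, hc, hcx⟩ := hP.exists_le_abs_dev hη
    have hbig : ∀ t, a ≤ t → ε < E t →
        (c / (n + 1)) ^ 2 ≤ ∑ i, (P.dev (ζ (i + 1) t) - P.dev (ζ i t)) ^ 2 := by
      intro t hat hEt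
      obtain ⟨p, hp⟩ : ∃ p, ε / (n + 1) < P.energy (ζ p t) := by
        by_contra! hcon
        have : E t ≤ ∑ _i : Fin (n + 1), ε / (n + 1) := Finset.sum_le_sum fun i _ => hcon i
        rw [Finset.sum_const, Finset.card_univ, Fintype.card_fin, nsmul_eq_mul] at this
        push_cast at this
        rw [mul_div_cancel₀ _ (by positivity)] at this
        linarith
      have h1 : c ≤ |P.dev (ζ p t)| := by
        refine hcx _ ?_
        rw [div_le_iff₀ hcap, mul_comm]
        have := hP.abs_energy_sub_le (ζ p t) P.L
        rw [Params.energy_L, sub_zero] at this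
        exact (hp.le.trans (le_abs_self _)).trans this
      -- Distances on both sides of `L` exist, so a deviation of size `c` is met by one that is zero
      -- or of opposite sign.
      obtain ⟨q, hq⟩ : ∃ q, c ≤ |P.dev (ζ q t) - P.dev (ζ p t)| := by
        rcases le_abs.mp h1 with h | h
        · obtain ⟨q, hq⟩ := hle t hat
          have := hP.monotone_dev hq
          rw [hP.dev_L] at this
          exact ⟨q, le_abs.mpr (Or.inr (by linarith))⟩
        · obtain ⟨q, hq⟩ := hge t hat
          have := hP.monotone_dev hq
          rw [hP.dev_L] at this
          exact ⟨q, le_abs.mpr (Or.inl (by linarith))⟩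
      have h2 := hq.trans (abs_sub_le_of_cycle (fun i => P.dev (ζ i t)) p q)
      set D := ∑ i, (P.dev (ζ (i + 1) t) - P.dev (ζ i t)) ^ 2
      -- The divisor `n + 1` instead of `n` avoids a division by zero for a single vehicle.
      have h3 : c / (n + 1) ≤ √D := by
        rw [div_le_iff₀ (by positivity)]
        linarith [Real.sqrt_nonneg D]
      exact (Real.le_sqrt' (by positivity)).mp h3
    obtain ⟨d, hd⟩ : ∃ d, d = 1 / 2 * (c / (n + 1)) ^ 2 := ⟨_, rfl⟩
    have hd0 : 0 < d := by rw [hd]; positivity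
    have hdec : ∀ t, a ≤ t → E t ≤ max ε (E a - d * (t - a)) := fun t ht =>
      le_max_of_ae_hasDerivAt hd0.le (hEac t ht) (by
        filter_upwards [hE'] with s hs hsm hlt f' hf'
        have h1 := hs hsm.1 f' hf'
        have h2 := hbig s hsm.1 hlt
        linarith) ⟨ht, le_rfl⟩
    filter_upwards [eventually_ge_atTop a, eventually_ge_atTop (a + E a / d)] with t ht ht2
    refine (hdec t ht).trans (max_le le_rfl ?_)
    have : E a ≤ d * (t - a) := by
      rw [← div_le_iff₀' hd0]
      linarith
    linarith
  rw [Metric.tendsto_nhds]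
  intro η hη
  obtain ⟨ε, hε, hx⟩ := hP.exists_le_energy hη
  filter_upwards [hsmall (ε / 2) (by positivity)] with t ht
  by_contra hcon
  rw [Real.dist_eq, not_lt] at hcon
  have h1 := hx _ hcon
  have h2 : P.energy (ζ i t) ≤ E t :=
    Finset.single_le_sum (f := fun i => P.energy (ζ i t)) (fun i _ => hP.energy_nonneg _)
      (Finset.mem_univ i)
  linarith

end UAV

namespace UAV

/-! ### Arc distances and pre-neighbors -/

section Static

variable {n : ℕ} {Γ : PathType} {R₀ L : ℝ} {s ρ : Fin n → ℝ} {i j : Fin n}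

/-- The choice of a pre-neighbor is immaterial: two candidates are minimal for the same
lexicographic order, so their arc distances agree. -/
theorem preDist_eq_arcDist (h : IsPreNeighbor Γ R₀ s ρ i j) :
    preDist Γ R₀ L s ρ i = arcDist Γ s i j := by
  have hex : ∃ j, IsPreNeighbor Γ R₀ s ρ i j := ⟨j, h⟩
  rw [preDist, dif_pos hex]
  have h' := hex.choose_spec
  have h1 := h.2.2.2 _ h'.2.1 h'.2.2.1
  have h2 := h'.2.2.2 _ h.2.1 h.2.2.1
  rcases h1 with h1 | h1 <;> rcases h2 with h2 | h2 <;> linarith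

theorem preDist_eq_of_forall (h : ∀ k, ¬ InFront Γ s i k) : preDist Γ R₀ L s ρ i = L := by
  rw [preDist, dif_neg]
  rintro ⟨j, hj⟩
  exact h j hj.2.2.1

theorem preDist_le_arcDist (hρ : ∀ k, |ρ k| < R₀) (h : InFront Γ s i j) :
    preDist Γ R₀ L s ρ i ≤ arcDist Γ s i j := by
  classical
  obtain ⟨k, hk, hmin⟩ := Finset.exists_min_image (Finset.univ.filter fun k => InFront Γ s i k)
    (fun k => toLex (arcDist Γ s i k, k)) ⟨j, by simpa using h⟩
  simp only [Finset.mem_filter, Finset.mem_univ, true_and, Prod.Lex.toLex_le_toLex] at hk hmin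
  rw [preDist_eq_arcDist ⟨hρ i, hρ k, hk, fun m _ hm => hmin m hm⟩]
  rcases hmin j h with h | h
  · exact h.le
  · exact h.1.le

theorem arcDist_nonneg (hΓ : ∀ ℓ, Γ = .loop ℓ → 0 < ℓ) (h : InFront Γ s i j) :
    0 ≤ arcDist Γ s i j := by
  cases Γ with
  | line =>
    rcases h with h | h
    · exact sub_nonneg.mpr h.le
    · exact sub_nonneg.mpr h.1.le
  | loop ℓ =>
    have hℓ := hΓ ℓ rfl
    simp only [arcDist]
    split_ifs
    · exact mul_nonneg hℓ.le (Int.fract_nonneg _)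
    · have := mul_le_mul_of_nonneg_left (Int.fract_lt_one ((s i - s j) / ℓ)).le hℓ.le
      linarith

theorem preDist_nonneg (hΓ : ∀ ℓ, Γ = .loop ℓ → 0 < ℓ) (hL : 0 ≤ L) :
    0 ≤ preDist Γ R₀ L s ρ i := by
  rw [preDist]
  split_ifs with h
  · exact arcDist_nonneg hΓ h.choose_spec.2.2.1
  · exact hL

end Static

/-! ### Pre-neighbors of a sorted fleet -/

section Sorted

variable {n : ℕ} {R₀ L : ℝ} {s ρ : Fin (n + 1) → ℝ} {e : Equiv.Perm (Fin (n + 1))}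

theorem lt_add_one_of_ne_last {p : Fin (n + 1)} (hp : p ≠ Fin.last n) : p < p + 1 := by
  rw [Fin.lt_add_one_iff]
  exact Fin.lt_last_iff_ne_last.mpr hp

/-- Ties are sorted by label as in `InFront`, so only later indices can be in front of `e p`, and `e
(p + 1)` is the first of them. Nobody is in front of the last vehicle, which gets the default `L`.
-/
theorem preDist_line (hρ : ∀ k, |ρ k| < R₀)
    (he : ∀ p q, p < q → s (e p) < s (e q) ∨ (s (e p) = s (e q) ∧ e p < e q)) (p : Fin (n + 1)) :
    preDist .line R₀ L s ρ (e p) = if p = Fin.last n then L else s (e (p + 1)) - s (e p) := by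
  have hf : ∀ q, InFront .line s (e p) (e q) → p < q := by
    intro q hq
    by_contra! hcon
    rcases hcon.eq_or_lt with h | h
    · subst h
      simp [InFront] at hq
    · rcases he q p h with h1 | h1 <;> rcases hq with h2 | h2
      · linarith
      · linarith [h2.1]
      · linarith [h1.1]
      · exact lt_asymm h1.2 h2.2
  split_ifs with hp
  · refine preDist_eq_of_forall fun k hk => ?_
    obtain ⟨q, rfl⟩ := e.surjective k
    have := hf q hk
    rw [hp] at this
    exact absurd this (Fin.le_last q).not_gt
  · rw [preDist_eq_arcDist (j := e (p + 1))]
    · rfl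
    refine ⟨hρ _, hρ _, he _ _ (lt_add_one_of_ne_last hp), fun k _ hk => ?_⟩
    obtain ⟨q, rfl⟩ := e.surjective k
    rcases (Fin.add_one_le_of_lt (hf q hk)).eq_or_lt with h | h
    · rw [h]
      exact Or.inr ⟨rfl, le_rfl⟩
    · simp only [arcDist]
      rcases he _ _ h with h1 | h1
      · left; linarith
      · exact Or.inr ⟨by rw [h1.1], h1.2.le⟩

/-- Addition in `Fin` wraps around just as the loop does: the last vehicle follows the first, and
the extra `ℓ` accounts for the lap. -/
theorem preDist_loop {ℓ : ℝ} {g : Fin (n + 1) → ℝ} (hn : 0 < n) (hρ : ∀ k, |ρ k| < R₀)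
    (harc : ∀ p q, p < q → arcDist (.loop ℓ) s (e p) (e q) = g (e q) - g (e p) ∧
      arcDist (.loop ℓ) s (e q) (e p) = ℓ - (g (e q) - g (e p)))
    (hlo : ∀ p q, p < q → g (e p) < g (e q) ∨ (g (e p) = g (e q) ∧ e p < e q))
    (hhi : ∀ p q, p < q → g (e q) - g (e p) < ℓ ∨ (g (e q) - g (e p) = ℓ ∧ e q < e p))
    (p : Fin (n + 1)) :
    preDist (.loop ℓ) R₀ L s ρ (e p) =
      g (e (p + 1)) - g (e p) + if p = Fin.last n then ℓ else 0 := by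
  have hinj : ∀ {q}, e p ≠ e q ↔ p ≠ q := fun {q} => e.injective.ne_iff
  split_ifs with hp
  · have h0 : (0 : Fin (n + 1)) < Fin.last n := by
      rw [Fin.lt_def]
      simpa using hn
    subst hp
    rw [Fin.last_add_one, preDist_eq_arcDist (j := e 0)]
    · rw [(harc _ _ h0).2]
      ring
    refine ⟨hρ _, hρ _, hinj.mpr h0.ne', fun k _ hk => ?_⟩
    obtain ⟨q, rfl⟩ := e.surjective k
    have hq : q < Fin.last n := Fin.lt_last_iff_ne_last.mpr (hinj.mp hk).symm
    rw [(harc _ _ h0).2, (harc _ _ hq).2]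
    rcases (Fin.zero_le q).eq_or_lt with h | h
    · rw [h]
      exact Or.inr ⟨rfl, le_rfl⟩
    · rcases hlo _ _ h with h1 | h1
      · left; linarith
      · exact Or.inr ⟨by rw [h1.1], h1.2.le⟩
  · have hlt := lt_add_one_of_ne_last hp
    rw [preDist_eq_arcDist (j := e (p + 1))]
    · rw [(harc _ _ hlt).1, add_zero]
    refine ⟨hρ _, hρ _, hinj.mpr hlt.ne, fun k _ hk => ?_⟩
    obtain ⟨q, rfl⟩ := e.surjective k
    rw [(harc _ _ hlt).1]
    rcases lt_or_gt_of_ne (hinj.mp hk) with hq | hq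
    · rw [(harc _ _ hq).1]
      rcases (Fin.add_one_le_of_lt hq).eq_or_lt with h | h
      · rw [h]
        exact Or.inr ⟨rfl, le_rfl⟩
      · rcases hlo _ _ h with h1 | h1
        · left; linarith
        · exact Or.inr ⟨by rw [h1.1], h1.2.le⟩
    · rw [(harc _ _ hq).2]
      rcases hhi _ _ (hq.trans hlt) with h1 | h1
      · left; linarith
      · exact Or.inr ⟨by linarith [h1.1], h1.2.le⟩

/-- The unwrapped positions `g` on a loop order the vehicles. -/
theorem arcDist_loop_of_floor {ℓ : ℝ} (hℓ : 0 < ℓ) {s₀ : Fin (n + 1) → ℝ}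
    (hfl : ∀ i j, i < j → ⌊(s j - s i) / ℓ⌋ = ⌊(s₀ j - s₀ i) / ℓ⌋)
    (he : e = Tuple.sort fun i => Int.fract (s₀ i / ℓ)) {g : Fin (n + 1) → ℝ}
    (hg : ∀ i, g i = s i - ℓ * ⌊s₀ i / ℓ⌋) (p q : Fin (n + 1)) (hpq : p < q) :
    (arcDist (.loop ℓ) s (e p) (e q) = g (e q) - g (e p) ∧
      arcDist (.loop ℓ) s (e q) (e p) = ℓ - (g (e q) - g (e p))) ∧
    (g (e p) < g (e q) ∨ (g (e p) = g (e q) ∧ e p < e q)) ∧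
    (g (e q) - g (e p) < ℓ ∨ (g (e q) - g (e p) = ℓ ∧ e q < e p)) := by
  obtain ⟨hmono, htie⟩ := Tuple.eq_sort_iff.mp he
  have hle : Int.fract (s₀ (e p) / ℓ) ≤ Int.fract (s₀ (e q) / ℓ) := hmono hpq.le
  have htie' : Int.fract (s₀ (e p) / ℓ) = Int.fract (s₀ (e q) / ℓ) → e p < e q := htie p q hpq
  -- The integer `k` is the lap offset between the unwrapped positions and the label convention of
  -- `arcDist`: `0` if the sorted order agrees with the labels, `-1` if it reverses them.
  have key : ∀ i j, i < j → ∀ k : ℤ,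
      (k : ℝ) ≤ Int.fract (s₀ j / ℓ) - Int.fract (s₀ i / ℓ) →
      Int.fract (s₀ j / ℓ) - Int.fract (s₀ i / ℓ) < k + 1 →
      arcDist (.loop ℓ) s i j = g j - g i - ℓ * k ∧
        arcDist (.loop ℓ) s j i = ℓ - (g j - g i - ℓ * k) ∧
        0 ≤ g j - g i - ℓ * k ∧ g j - g i - ℓ * k < ℓ := by
    intro i j hij k h1 h2
    have hfl0 : ⌊(s₀ j - s₀ i) / ℓ⌋ = ⌊s₀ j / ℓ⌋ - ⌊s₀ i / ℓ⌋ + k := by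
      rw [Int.floor_eq_iff, sub_div]
      unfold Int.fract at h1 h2
      push_cast
      constructor <;> linarith
    have hN := (hfl i j hij).trans hfl0
    have hfr : ℓ * Int.fract ((s j - s i) / ℓ) = g j - g i - ℓ * k := by
      unfold Int.fract
      rw [hN, mul_sub, mul_div_cancel₀ _ hℓ.ne', hg, hg]
      push_cast
      ring
    refine ⟨?_, ?_, ?_, ?_⟩
    · simp only [arcDist, if_pos hij]
      exact hfr
    · simp only [arcDist, if_neg hij.not_gt]
      rw [hfr]
    · rw [← hfr]
      exact mul_nonneg hℓ.le (Int.fract_nonneg _)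
    · rw [← hfr]
      exact mul_lt_of_lt_one_right hℓ (Int.fract_lt_one _)
  have f1 := Int.fract_lt_one (s₀ (e q) / ℓ)
  have f2 := Int.fract_nonneg (s₀ (e p) / ℓ)
  have f3 := Int.fract_lt_one (s₀ (e p) / ℓ)
  have f4 := Int.fract_nonneg (s₀ (e q) / ℓ)
  rcases lt_or_gt_of_ne (e.injective.ne hpq.ne) with h | h
  · obtain ⟨k1, k2, k3, k4⟩ := key _ _ h 0 (by push_cast; linarith) (by push_cast; linarith)
    simp only [Int.cast_zero, mul_zero, sub_zero] at k1 k2 k3 k4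
    refine ⟨⟨k1, k2⟩, ?_, Or.inl k4⟩
    rcases (sub_nonneg.mp k3).lt_or_eq with h' | h'
    · exact Or.inl h'
    · exact Or.inr ⟨h', h⟩
  · have hlt : Int.fract (s₀ (e p) / ℓ) < Int.fract (s₀ (e q) / ℓ) :=
      lt_of_le_of_ne hle fun h' => lt_asymm h (htie' h')
    obtain ⟨k1, k2, k3, k4⟩ := key _ _ h (-1) (by push_cast; linarith) (by push_cast; linarith)
    simp only [Int.cast_neg, Int.cast_one, mul_neg, mul_one, sub_neg_eq_add] at k1 k2 k3 k4
    refine ⟨⟨by linarith, by linarith⟩, Or.inl (by linarith), ?_⟩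
    rcases (show g (e q) - g (e p) ≤ ℓ by linarith).lt_or_eq with h' | h'
    · exact Or.inl h'
    · exact Or.inr ⟨h', h⟩

end Sorted

end UAV

namespace UAV

/-! ### Coordination along the path -/

/-- Motion along the path of vehicles that, from time `a` on, are close to the path and move at
the speed prescribed by the coordination law. -/
structure IsCoordinated (P : Params) {n : ℕ} (Γ : PathType) (s ρ y : Fin n → ℝ → ℝ) (a : ℝ) :
    Prop where
  ac : ∀ i b, a ≤ b → AbsolutelyContinuousOnInterval (s i) a b
  hasDerivAt : ∀ᵐ t : ℝ, a ≤ t → ∀ i, HasDerivAt (s i) (y i t) t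
  near : ∀ t, a ≤ t → ∀ i, |ρ i t| < 1 / P.κ₀
  speed : ∀ᵐ t : ℝ, a ≤ t → ∀ i,
    y i t ∈ Icc (min (P.χ (preDist Γ (1 / P.κ₀) P.L (s · t) (ρ · t) i)) P.cap)
      (P.χ (preDist Γ (1 / P.κ₀) P.L (s · t) (ρ · t) i))

namespace IsCoordinated

variable {P : Params} {n : ℕ} {Γ : PathType} {s ρ y : Fin n → ℝ → ℝ} {a : ℝ}

theorem mono (h : IsCoordinated P Γ s ρ y a) {b : ℝ} (hb : a ≤ b) :
    IsCoordinated P Γ s ρ y b where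
  ac i c hc := AbsolutelyContinuousOnInterval.mono_Icc (h.ac i c (hb.trans hc)) hb hc le_rfl
  hasDerivAt := h.hasDerivAt.mono fun _ ht hm => ht (hb.trans hm)
  near t ht := h.near t (hb.trans ht)
  speed := h.speed.mono fun _ ht hm => ht (hb.trans hm)

/-- A vehicle that is close behind another one is not faster. -/
theorem ae_speed_le (h : IsCoordinated P Γ s ρ y a) (hP : P.Valid)
    (hΓ : ∀ ℓ, Γ = .loop ℓ → 0 < ℓ) :
    ∀ᵐ t : ℝ, a ≤ t → ∀ i j, InFront Γ (s · t) i j → arcDist Γ (s · t) i j < P.L - P.δ₁ →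
      y i t ≤ y j t := by
  filter_upwards [h.speed] with t ht hat i j hij hd
  have h1 := (ht hat i).2
  have h2 := (ht hat j).1
  have h3 := preDist_le_arcDist (L := P.L) (ρ := fun k => ρ k t) (h.near t hat) hij
  have h4 : ∀ k, 0 ≤ preDist Γ (1 / P.κ₀) P.L (s · t) (ρ · t) k := fun k =>
    preDist_nonneg hΓ hP.L_pos.le
  have h5 := hP.χ_low _ ⟨h4 i, h3.trans_lt hd⟩
  have h6 : P.low ≤ y j t := (le_min (hP.low_le_χ (h4 j)) hP.low_lt_cap.le).trans h2
  exact (h1.trans h5.le).trans h6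

/-- While the gap is in `(k, k + (L - δ₁))`, vehicle `i` is close behind `j` and not faster, so the
gap does not shrink to `k`. -/
theorem lt_of_lt (h : IsCoordinated P Γ s ρ y a) (hP : P.Valid) (hΓ : ∀ ℓ, Γ = .loop ℓ → 0 < ℓ)
    {i j : Fin n} {k : ℝ}
    (harc : ∀ t, s j t - s i t ∈ Ioo k (k + (P.L - P.δ₁)) →
      InFront Γ (s · t) i j ∧ arcDist Γ (s · t) i j < P.L - P.δ₁)
    (ha : k < s j a - s i a) {t : ℝ} (ht : a ≤ t) : k < s j t - s i t := by
  refine lt_of_ae_hasDerivAt_nonneg (d := fun t => s j t - s i t) (sub_pos.mpr hP.δ₁_lt)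
    (fun b hb => (h.ac j b hb).sub (h.ac i b hb)) ?_ ha ht
  filter_upwards [h.hasDerivAt, h.ae_speed_le hP hΓ] with t hd hle hat hm
  obtain ⟨h1, h2⟩ := harc t hm
  exact ⟨_, (hd hat j).sub (hd hat i), sub_nonneg.mpr (hle hat i j h1 h2)⟩

/-- A vehicle that is once strictly ahead stays ahead, and a relation that can only switch on
switches at most once. -/
theorem eventually_lt_iff (h : IsCoordinated P .line s ρ y a) (hP : P.Valid) (i j : Fin n) :
    ∀ᶠ T in atTop, ∀ t, T ≤ t → (s i t < s j t ↔ s i T < s j T) := by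
  by_cases hex : ∃ b, a ≤ b ∧ s i b < s j b
  · obtain ⟨b, hab, hb⟩ := hex
    have key : ∀ t, b ≤ t → s i t < s j t := fun t ht =>
      sub_pos.mp ((h.mono hab).lt_of_lt hP (fun _ h => nomatch h) (fun t hm =>
        ⟨Or.inl (sub_pos.mp hm.1), by simpa [arcDist] using hm.2⟩) (sub_pos.mpr hb) ht)
    filter_upwards [eventually_ge_atTop b] with T hT t ht
    exact iff_of_true (key t (hT.trans ht)) (key T hT)
  · push Not at hex
    filter_upwards [eventually_ge_atTop a] with T hT t ht
    exact iff_of_false (hex t (hT.trans ht)).not_gt (hex T hT).not_gt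

/-- Multiples of `ℓ` are barriers in both directions, since near one of them one vehicle is close
behind the other. Only a gap equal to a multiple leaves a choice, and once it is left the choice is
final. -/
theorem eventually_floor_eq {ℓ : ℝ} (h : IsCoordinated P (.loop ℓ) s ρ y a) (hP : P.Valid)
    (hℓ : 0 < ℓ) (hL : P.L ≤ ℓ) {i j : Fin n} (hij : i < j) :
    ∀ᶠ T in atTop, ∀ t, T ≤ t → ⌊(s j t - s i t) / ℓ⌋ = ⌊(s j T - s i T) / ℓ⌋ := by
  have hΓ : ∀ ℓ', PathType.loop ℓ = .loop ℓ' → 0 < ℓ' := by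
    rintro _ ⟨⟩
    exact hℓ
  have hδ : P.L - P.δ₁ ≤ ℓ := by linarith [hP.δ₂_pos, hP.δ₂_le]
  have hup : ∀ (k : ℤ) b, a ≤ b → ℓ * k < s j b - s i b →
      ∀ t, b ≤ t → ℓ * k < s j t - s i t := by
    intro k b hab hb t ht
    refine (h.mono hab).lt_of_lt hP hΓ (fun t hm => ⟨hij.ne, ?_⟩) hb ht
    have : ⌊(s j t - s i t) / ℓ⌋ = k := by
      rw [Int.floor_eq_iff, le_div_iff₀ hℓ, div_lt_iff₀ hℓ]
      constructor <;> linarith [hm.1, hm.2]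
    simp only [arcDist, if_pos hij]
    unfold Int.fract
    rw [this, mul_sub, mul_div_cancel₀ _ hℓ.ne']
    linarith [hm.2]
  have hdown : ∀ (k : ℤ) b, a ≤ b → s j b - s i b < ℓ * k →
      ∀ t, b ≤ t → s j t - s i t < ℓ * k := by
    intro k b hab hb t ht
    have := (h.mono hab).lt_of_lt (i := j) (j := i) (k := -(ℓ * k)) hP hΓ
      (fun t hm => ⟨hij.ne', ?_⟩) (by linarith) ht
    · linarith
    have : ⌊(s j t - s i t) / ℓ⌋ = k - 1 := by
      rw [Int.floor_eq_iff, le_div_iff₀ hℓ, div_lt_iff₀ hℓ]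
      push_cast
      constructor <;> linarith [hm.1, hm.2]
    simp only [arcDist, if_neg hij.not_gt]
    unfold Int.fract
    rw [this, mul_sub, mul_div_cancel₀ _ hℓ.ne']
    push_cast
    linarith [hm.2]
  obtain ⟨k, hk⟩ : ∃ k, k = ⌊(s j a - s i a) / ℓ⌋ := ⟨_, rfl⟩
  have hka := Int.floor_eq_iff.mp hk.symm
  rw [le_div_iff₀ hℓ, div_lt_iff₀ hℓ] at hka
  have hlt : ∀ t, a ≤ t → s j t - s i t < ℓ * (k + 1 : ℤ) :=
    hdown (k + 1) a le_rfl (by push_cast; linarith [hka.2])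
  have hgt : ∀ t, a ≤ t → ℓ * (k - 1 : ℤ) < s j t - s i t :=
    hup (k - 1) a le_rfl (by push_cast; linarith [hka.1])
  push_cast at hlt hgt
  by_cases hex : ∃ b, a ≤ b ∧ s j b - s i b < ℓ * k
  · obtain ⟨b, hab, hb⟩ := hex
    have key : ∀ t, b ≤ t → ⌊(s j t - s i t) / ℓ⌋ = k - 1 := by
      intro t ht
      rw [Int.floor_eq_iff, le_div_iff₀ hℓ, div_lt_iff₀ hℓ]
      push_cast
      constructor <;> linarith [hgt t (hab.trans ht), hdown k b hab hb t ht]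
    filter_upwards [eventually_ge_atTop b] with T hT t ht
    rw [key t (hT.trans ht), key T hT]
  · push Not at hex
    have key : ∀ t, a ≤ t → ⌊(s j t - s i t) / ℓ⌋ = k := by
      intro t ht
      rw [Int.floor_eq_iff, le_div_iff₀ hℓ, div_lt_iff₀ hℓ]
      constructor <;> linarith [hlt t ht, hex t ht]
    filter_upwards [eventually_ge_atTop a] with T hT t ht
    rw [key t (hT.trans ht), key T hT]

end IsCoordinated

/-! ### The fleet as a cyclic chain -/

section Chain

variable {P : Params} {n : ℕ} {Γ : PathType} {s ρ y : Fin (n + 1) → ℝ → ℝ} {a : ℝ}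

/-- From some time on, the vehicles form a chain: sorted by `e`, each one follows the next, and
the last one follows the first (on a loop) or has no predecessor. -/
theorem IsCoordinated.exists_chain (h : IsCoordinated P Γ s ρ y a) (hP : P.Valid)
    (hΓ : ∀ ℓ, Γ = .loop ℓ → 0 < ℓ ∧ (2 ≤ n + 1 → (n + 1 : ℕ) * P.L = ℓ)) :
    ∃ (e : Equiv.Perm (Fin (n + 1))) (z : Fin (n + 1) → ℝ → ℝ) (T : ℝ), a ≤ T ∧
      (∀ p, (∃ c, z p = fun t => s (e (p + 1)) t - s (e p) t + c) ∨ z p = fun _ => P.L) ∧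
      ∀ t, T ≤ t → (∀ p, preDist Γ (1 / P.κ₀) P.L (s · t) (ρ · t) (e p) = z p t) ∧
        (∃ p, P.L ≤ z p t) ∧ ∃ p, z p t ≤ P.L := by
  cases Γ with
  | line =>
    have hev : ∀ᶠ T in atTop, ∀ i j, ∀ t, T ≤ t → (s i t < s j t ↔ s i T < s j T) :=
      eventually_all.mpr fun i => eventually_all.mpr fun j => h.eventually_lt_iff hP i j
    obtain ⟨T, hT, hcmp⟩ := ((eventually_ge_atTop a).and hev).exists
    obtain ⟨e, he⟩ : ∃ e, e = Tuple.sort fun i => s i T := ⟨_, rfl⟩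
    obtain ⟨hmono, htie⟩ := Tuple.eq_sort_iff.mp he
    have hsort : ∀ t, T ≤ t → ∀ p q, p < q →
        s (e p) t < s (e q) t ∨ (s (e p) t = s (e q) t ∧ e p < e q) := by
      intro t ht p q hpq
      have h1 : s (e p) T ≤ s (e q) T := hmono hpq.le
      have h2 : s (e p) t ≤ s (e q) t :=
        not_lt.mp fun hcon => ((hcmp _ _ t ht).mp hcon).not_ge h1
      rcases h2.lt_or_eq with h3 | h3
      · exact Or.inl h3
      · refine Or.inr ⟨h3, htie p q hpq (le_antisymm h1 (not_lt.mp fun hcon => ?_))⟩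
        exact h3.not_lt ((hcmp _ _ t ht).mpr hcon)
    refine ⟨e, fun p t => if p = Fin.last n then P.L else s (e (p + 1)) t - s (e p) t, T, hT,
      fun p => ?_, fun t ht => ⟨fun p => ?_, ⟨Fin.last n, by simp⟩, ⟨Fin.last n, by simp⟩⟩⟩
    · by_cases hp : p = Fin.last n
      · right
        simp [hp]
      · left
        exact ⟨0, by simp [hp]⟩
    · exact preDist_line (h.near t (hT.trans ht)) (hsort t ht) p
  | loop ℓ =>
    obtain ⟨hℓ, hnL⟩ := hΓ ℓ rfl
    -- A single vehicle on a loop has no pre-neighbor, and its loop length is not tied to `L`.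
    rcases Nat.eq_zero_or_pos n with rfl | hn
    · refine ⟨1, fun _ _ => P.L, a, le_rfl, fun p => Or.inr rfl, fun t _ => ⟨fun p => ?_,
        ⟨0, le_rfl⟩, ⟨0, le_rfl⟩⟩⟩
      exact preDist_eq_of_forall fun k hk => hk (Fin.ext (by lia))
    have hnL := hnL (by lia)
    have hL : P.L ≤ ℓ := by
      rw [← hnL]
      refine le_mul_of_one_le_left hP.L_pos.le ?_
      exact_mod_cast Nat.succ_le_succ (Nat.zero_le n)
    have hev : ∀ᶠ T in atTop, ∀ i j, ∀ t, T ≤ t → i < j →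
        ⌊(s j t - s i t) / ℓ⌋ = ⌊(s j T - s i T) / ℓ⌋ := by
      refine eventually_all.mpr fun i => eventually_all.mpr fun j => ?_
      by_cases hij : i < j
      · filter_upwards [h.eventually_floor_eq hP hℓ hL hij] with T hT t ht _ using hT t ht
      · exact Eventually.of_forall fun _ _ _ h => absurd h hij
    obtain ⟨T, hT, hfl⟩ := ((eventually_ge_atTop a).and hev).exists
    obtain ⟨e, he⟩ : ∃ e, e = Tuple.sort fun i => Int.fract (s i T / ℓ) := ⟨_, rfl⟩
    obtain ⟨g, hg⟩ : ∃ g : Fin (n + 1) → ℝ → ℝ, ∀ t i, g i t = s i t - ℓ * ⌊s i T / ℓ⌋ :=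
      ⟨fun i t => s i t - ℓ * ⌊s i T / ℓ⌋, fun _ _ => rfl⟩
    -- The distances around the loop add up to `ℓ = (n + 1) L`, so one is at least `L` and one at
    -- most `L`. On a line the distance `L` of the leader plays both roles.
    have hsum : ∀ t, ∑ p, (g (e (p + 1)) t - g (e p) t + if p = Fin.last n then ℓ else 0)
        = ∑ _p : Fin (n + 1), P.L := by
      intro t
      have hsh : ∑ p, g (e (p + 1)) t = ∑ p, g (e p) t :=
        Equiv.sum_comp (Equiv.addRight (1 : Fin (n + 1))) fun p => g (e p) t
      rw [Finset.sum_add_distrib, Finset.sum_sub_distrib, hsh]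
      simp only [sub_self, zero_add, Finset.sum_ite_eq', Finset.mem_univ, if_true,
        Finset.sum_const, Finset.card_univ, Fintype.card_fin, nsmul_eq_mul]
      exact hnL.symm
    refine ⟨e, fun p t => g (e (p + 1)) t - g (e p) t + if p = Fin.last n then ℓ else 0, T, hT,
      fun p => Or.inl ⟨ℓ * ⌊s (e p) T / ℓ⌋ - ℓ * ⌊s (e (p + 1)) T / ℓ⌋
        + if p = Fin.last n then ℓ else 0, ?_⟩, fun t ht => ⟨fun p => ?_, ?_, ?_⟩⟩
    · funext t
      simp only [hg]
      ring
    · have hall := arcDist_loop_of_floor (s := fun i => s i t) (s₀ := fun i => s i T) hℓ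
        (fun i j hij => hfl i j t ht hij) he (hg t)
      exact preDist_loop (g := fun i => g i t) hn (h.near t (hT.trans ht))
        (fun p q hpq => (hall p q hpq).1) (fun p q hpq => (hall p q hpq).2.1)
        (fun p q hpq => (hall p q hpq).2.2) p
    · obtain ⟨p, -, hp⟩ := Finset.exists_le_of_sum_le Finset.univ_nonempty (hsum t).ge
      exact ⟨p, hp⟩
    · obtain ⟨p, -, hp⟩ := Finset.exists_le_of_sum_le Finset.univ_nonempty (hsum t).le
      exact ⟨p, hp⟩

theorem IsCoordinated.tendsto (h : IsCoordinated P Γ s ρ y a) (hP : P.Valid)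
    (hΓ : ∀ ℓ, Γ = .loop ℓ → 0 < ℓ ∧ (2 ≤ n + 1 → (n + 1 : ℕ) * P.L = ℓ)) (i : Fin (n + 1)) :
    Tendsto (fun t => preDist Γ (1 / P.κ₀) P.L (s · t) (ρ · t) i) atTop (𝓝 P.L) := by
  obtain ⟨e, z, T, hT, hz, hchain⟩ := h.exists_chain hP hΓ
  obtain ⟨p, rfl⟩ := e.surjective i
  have hT' := h.mono hT
  have key : Tendsto (z p) atTop (𝓝 P.L) := by
    refine tendsto_of_cycle (y := fun p => y (e p)) (a := T) hP (fun p b hb => ?_) ?_ ?_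
      (fun t ht p => ?_) (fun t ht => (hchain t ht).2.1) (fun t ht => (hchain t ht).2.2) p
    · rcases hz p with ⟨c, hc⟩ | hc
      · rw [hc]
        exact ((hT'.ac _ b hb).sub (hT'.ac _ b hb)).add
          (absolutelyContinuousOnInterval_const c T b)
      · rw [hc]
        exact absolutelyContinuousOnInterval_const _ _ _
    · filter_upwards [hT'.hasDerivAt] with t ht hat p
      rcases hz p with ⟨c, hc⟩ | hc
      · left
        rw [hc]
        exact ((ht hat _).sub (ht hat _)).add_const c
      · right
        rw [hc]
        exact ⟨rfl, hasDerivAt_const _ _⟩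
    · filter_upwards [hT'.speed] with t ht hat p
      have := ht hat (e p)
      rwa [(hchain t hat).1 p] at this
    · rw [← (hchain t ht).1 p]
      exact preDist_nonneg (fun ℓ hℓ => (hΓ ℓ hℓ).1) hP.L_pos.le
  refine key.congr' ?_
  filter_upwards [eventually_ge_atTop T] with t ht
  exact ((hchain t ht).1 p).symm

end Chain

end UAV

namespace UAV

/-! ### The fleet -/

namespace Fleet.IsTrajectory

variable {n : ℕ} {P : Params} {γ : ℝ → EuclideanSpace ℝ (Fin 2)} {Γ : PathType} {t₀ : ℝ}
  {T : EReal} {F : Fleet n}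

theorem isErrorTrajectory (hF : F.IsTrajectory P γ Γ t₀ T) (hκ : ∀ s, |curvature γ s| < P.κ₀)
    (i : Fin n) {b : ℝ} (hb : t₀ ≤ b) (hbT : (b : EReal) < T) :
    IsErrorTrajectory P (F.ρ i) (F.ψ i) (fun t => curvature γ (F.s i t)) (F.ζ P Γ i) (F.v i)
      (F.ω i) t₀ b where
  ac_fst := (hF.ac b hb hbT i).2.1
  ac_snd := (hF.ac b hb hbT i).2.2
  curv t := hκ _
  ae_mem := by
    filter_upwards [hF.dynamics, hF.control] with t hd hc hm
    have htT : (t : EReal) < T := (EReal.coe_le_coe_iff.mpr hm.2).trans_lt hbT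
    obtain ⟨-, h2, h3⟩ := hd hm.1 htT i
    refine ⟨h2, ?_, hc hm.1 htT i⟩
    convert! h3 using 1
    unfold turn
    ring

theorem ae_speed (hF : F.IsTrajectory P γ Γ t₀ T) (hP : P.Valid)
    (hR₂ : P.R₂ < 1 / P.κ₀ - P.vmin / P.ωmax) (hκ : ∀ s, |curvature γ s| < P.κ₀) :
    ∀ᵐ t : ℝ, t₀ ≤ t → (t : EReal) < T → ∀ i,
      F.v i t ∈ Icc P.vmin P.vmax ∧ |F.ω i t| ≤ P.ωmax := by
  filter_upwards [hF.control] with t hc h0 hT i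
  obtain ⟨h1, h2⟩ := filippov_feedback_mem hP hR₂ (hκ _) (hc h0 hT i)
  exact ⟨h1, abs_le.mpr h2⟩

/-- Convergence of the errors eventually puts a whole neighbourhood of each error into `𝒮₁`, so the
regularization sees the coordination law only. -/
theorem exists_isCoordinated (hF : F.IsTrajectory P γ Γ t₀ ⊤) (hP : P.Valid)
    (hR₂ : P.R₂ < 1 / P.κ₀ - P.vmin / P.ωmax) (hκ : ∀ s, |curvature γ s| < P.κ₀)
    (hΓ : ∀ ℓ, Γ = .loop ℓ → 0 < ℓ) (hS : ∀ t, t₀ ≤ t → ∀ i, F.φ i t ∈ S P)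
    (hlim : ∀ i, Tendsto (F.φ i) atTop (𝓝 0)) :
    ∃ a, IsCoordinated P Γ F.s F.ρ (fun i t =>
      F.v i t * cos (F.ψ i t) / (1 - curvature γ (F.s i t) * F.ρ i t)) a := by
  have hev : ∀ᶠ T in atTop, ∀ t, T ≤ t → ∀ i, ∀ᶠ y in 𝓝 (F.φ i t), y ∈ S₁ P := by
    refine eventually_forall_ge_atTop.mpr (eventually_all.mpr fun i => ?_)
    exact (hlim i).eventually (eventually_mem_S₁_nhds_zero hP).eventually_nhds
  obtain ⟨a, ha, hmem⟩ := ((eventually_ge_atTop t₀).and hev).exists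
  refine ⟨a, fun i b hb => ?_, ?_, fun t ht i => ?_, ?_⟩
  · exact AbsolutelyContinuousOnInterval.mono_Icc
      (hF.ac b (ha.trans hb) (EReal.coe_lt_top b) i).1 ha hb le_rfl
  · filter_upwards [hF.dynamics] with t hd hat i
    exact (hd (ha.trans hat) (EReal.coe_lt_top t) i).1
  · have := (hmem t ht i).self_of_nhds.1
    exact this.trans_lt hP.R₁_lt
  · filter_upwards [hF.control] with t hc hat i
    have h1 := hc (ha.trans hat) (EReal.coe_lt_top t) i
    have h2 := hS t (ha.trans hat) i
    rw [retract_of_mem (abs_le.mpr h2.1) (abs_le.mpr ⟨h2.2.1, h2.2.2.le⟩)] at h1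
    exact filippov_path_speed_mem hP hR₂ (hκ _) (preDist_nonneg hΓ hP.L_pos.le) (hmem t hat i) h1

end Fleet.IsTrajectory

end UAV

/-! ### Conclusion -/

theorem theorem8 (n : ℕ) (P : UAV.Params) (hP : P.Valid)
    (γ : ℝ → EuclideanSpace ℝ (Fin 2)) (Γ : UAV.PathType) (hγ : UAV.IsPath n P.L γ Γ)
    (hκ : ∀ s, |UAV.curvature γ s| < P.κ₀)
    (hR₂ : P.R₂ < 1 / P.κ₀ - P.vmin / P.ωmax)
    (t₀ : ℝ) (T : EReal) (hT : (t₀ : EReal) < T)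
    (F : UAV.Fleet n) (hF : F.IsTrajectory P γ Γ t₀ T)
    (h₀ : ∀ i, UAV.Admissible P (F.φ i t₀)) :
    -- the errors never leave the region on which the control law is defined
    (∀ t : ℝ, t₀ ≤ t → (t : EReal) < T → ∀ i, F.φ i t ∈ UAV.S P) ∧
    -- the speed constraints are respected
    (∀ᵐ t : ℝ, t₀ ≤ t → (t : EReal) < T → ∀ i,
      F.v i t ∈ Set.Icc P.vmin P.vmax ∧ |F.ω i t| ≤ P.ωmax) ∧
    -- convergence of the path following errors and of the arc distances
    (T = ⊤ → ∀ i, Filter.Tendsto (F.φ i) Filter.atTop (nhds 0) ∧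
      Filter.Tendsto (F.ζ P Γ i) Filter.atTop (nhds P.L)) := by
  have hS : ∀ t : ℝ, t₀ ≤ t → (t : EReal) < T → ∀ i, F.φ i t ∈ UAV.S P := fun t ht htT i =>
    (hF.isErrorTrajectory hκ i ht htT).mem_S hP hR₂ (h₀ i) ⟨ht, le_rfl⟩
  refine ⟨hS, hF.ae_speed hP hR₂ hκ, ?_⟩
  rintro rfl i
  have hS' : ∀ t, t₀ ≤ t → ∀ i, F.φ i t ∈ UAV.S P := fun t ht => hS t ht (EReal.coe_lt_top t)
  have hlim : ∀ i, Tendsto (F.φ i) atTop (𝓝 0) := fun i =>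
    UAV.tendsto_zero_of_isErrorTrajectory
      (fun b hb => hF.isErrorTrajectory hκ i hb (EReal.coe_lt_top b)) hP hR₂ fun t ht => hS' t ht i
  refine ⟨hlim i, ?_⟩
  have hΓ : ∀ ℓ, Γ = .loop ℓ → 0 < ℓ ∧ (2 ≤ n → n * P.L = ℓ) := by
    rintro ℓ rfl
    exact ⟨hγ.2.2.1, hγ.2.2.2.2⟩
  obtain ⟨a, ha⟩ := hF.exists_isCoordinated hP hR₂ hκ (fun ℓ h => (hΓ ℓ h).1) hS' hlim
  cases n with
  | zero => exact i.elim0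
  | succ n => exact ha.tendsto hP hΓ i
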